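/- Let $2\le n<d$ be integers and $a\in\mathbb R$ with $d+a>2$ and $a+n\in(0,2)$; put $s=\frac{2-a-n}{2}\in(0,1)$. Write $z=(x,y)\in\mathbb R^{d-n}\times\mathbb R^n$ and $\Sigma_0=\{y=0\}$. Let $\mathcal D^s(\mathbb R^{d-n})$ be the completion of $C_c^\infty(\mathbb R^{d-n})$ for the norm $\|(-\Delta)^{s/2}\varphi\|_{L^2}$, where $(-\Delta)^{\sigma}$ is the Fourier multiplier $|\xi|^{2\sigma}$, and let $\mathcal D^{1,a}(\mathbb R^d)$ be the completion of $C_c^\infty(\mathbb R^d)$ for the norm $\big(\int_{\mathbb R^d}|y|^a|\nabla\varphi|^2\,dz\big)^{1/2}$; both are realized as spaces of locally integrable functions modulo null sets. Let $\mathrm{Tr}:\mathcal D^{1,a}(\mathbb R^d)\to\mathcal D^s(\mathbb R^{d-n})$ be the continuous extension of $\varphi\mapsto\varphi(\cdot,0)$. For $u\in\mathcal D^s(\mathbb R^{d-n})$ let $\mathrm{Ext}(u)$ be the unique minimizer of $\int_{\mathbb R^d}|y|^a|\nabla U|^2\,dz$ among $U\in\mathcal D^{1,a}(\mathbb R^d)$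 with $\mathrm{Tr}\,U=u$. Then for every $u\in\mathcal D^s(\mathbb R^{d-n})$ the minimizer exists, is unique, and is given by $$\mathrm{Ext}(u)(x,y)=(u*P)(x,y)=\int_{\mathbb R^{d-n}}u(\xi)\,P(x-\xi,y)\,d\xi,\qquad P(x,y)=\frac{\Gamma\big(\frac{d-n+2s}{2}\big)}{\pi^{\frac{d-n}{2}}\Gamma(s)}\,\frac{|y|^{2s}}{(|x|^2+|y|^2)^{\frac{d-n+2s}{2}}},$$ where the integral converges absolutely whenever $y\ne0$. Moreover $U=\mathrm{Ext}(u)$ is a solution of $$\begin{cases}-\mathrm{div}(|y|^a\nabla U)=0&\text{in }\mathbb R^d\setminus\Sigma_0,\\ \displaystyle-\lim_{|y|\to0}|y|^{a+n-1}\nabla U\cdot\tfrac{y}{|y|}=d_{a,n}(-\Delta)^su&\text{on }\Sigma_0,\end{cases}\qquad d_{a,n}=2^{a+n-1}\,\frac{\Gamma(\frac{a+n}{2})}{\Gamma(\frac{2-a-n}{2})},$$ in the weak sense, that is, $U\in\mathcal D^{1,a}(\mathbb R^d)$ and $$\int_{\mathbb R^d}|y|^a\,\nabla U\cdot\nabla\phi\,dx\,dy=|\mathbb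 S^{n-1}|\,d_{a,n}\int_{\mathbb R^{d-n}}(-\Delta)^su\;\phi(x,0)\,dx\qquad\text{for every }\phi\in C_c^\infty(\mathbb R^d),$$ where $|\mathbb S^{n-1}|$ is the surface measure of the unit sphere of $\mathbb R^n$ and the right-hand integral denotes the duality pairing $\int_{\mathbb R^{d-n}}(-\Delta)^{s/2}u\,(-\Delta)^{s/2}[\phi(\cdot,0)]\,dx$. -/

import Mathlib

open MeasureTheory Filter Topology
open scoped ContDiff FourierTransform

namespace ThinExtension

noncomputable section

/-- The Euclidean space `ℝ^k`. -/
abbrev Euc (k : ℕ) : Type := EuclideanSpace ℝ (Fin k)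

/-- Real-valued test functions: the class `C_c^∞(X)`. -/
def IsTest {X : Type*} [NormedAddCommGroup X] [NormedSpace ℝ X] (φ : X → ℝ) : Prop :=
  ContDiff ℝ ∞ φ ∧ HasCompactSupport φ

/-- Convergence in `L^1_loc(X)` of a sequence of functions. -/
def TendstoL1loc {X : Type*} [TopologicalSpace X] [MeasureSpace X]
    (φ : ℕ → X → ℝ) (f : X → ℝ) : Prop :=
  ∀ K : Set X, IsCompact K →
    Tendsto (fun k => ∫⁻ x in K, ‖φ k x - f x‖ₑ) atTop (𝓝 0)

/-- The fractional Laplacian `(-Δ)^σ φ` on `ℝ^m`, that is, the Fourier multiplier with symbol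
`|ζ|^{2σ}`. Mathlib's Fourier transform has the phase `e^{-2πi x·ξ}`, so that the frequency `ζ`
is `2πξ`. The symbol is real and even, so the function is real for real `φ`. -/
def fracLaplacian {m : ℕ} (σ : ℝ) (φ : Euc m → ℝ) : Euc m → ℝ := fun x =>
  (𝓕⁻ (fun ξ : Euc m =>
    (((2 * Real.pi * ‖ξ‖) ^ (2 * σ) : ℝ) : ℂ) * 𝓕 (fun t : Euc m => (φ t : ℂ)) ξ) x).re

/-- The test functions `φ k` converge in the energy space `𝓓^s(ℝ^m)`: they converge to the
function `u` in `L^1_loc`, and `(-Δ)^{s/2} φ k` converges to `g` in `L^2(ℝ^m)`. -/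
structure TendstoDs {m : ℕ} (s : ℝ) (φ : ℕ → Euc m → ℝ) (u g : Euc m → ℝ) : Prop where
  test : ∀ k, IsTest (φ k)
  locInt : LocallyIntegrable u volume
  tendsto_fun : TendstoL1loc φ u
  memLp : MemLp g 2 volume
  tendsto_energy :
    Tendsto (fun k => eLpNorm (fracLaplacian (s / 2) (φ k) - g) 2 volume) atTop (𝓝 0)

/-- `u` belongs to `𝓓^s(ℝ^m)`, and `(-Δ)^{s/2} u = g` in `L^2(ℝ^m)`. Here `𝓓^s(ℝ^m)`, the completion
of `C_c^∞(ℝ^m)` for the norm `‖(-Δ)^{s/2} φ‖_{L²}`, is realized as a space of locally integrable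
functions (modulo null sets), which is possible for `m > 2s` by the fractional Hardy inequality. -/
def HasHalfFracLaplacian {m : ℕ} (s : ℝ) (u g : Euc m → ℝ) : Prop :=
  ∃ φ : ℕ → Euc m → ℝ, TendstoDs s φ u g

/-- Membership in `𝓓^s(ℝ^m)`. -/
def MemDs {m : ℕ} (s : ℝ) (u : Euc m → ℝ) : Prop :=
  ∃ g : Euc m → ℝ, HasHalfFracLaplacian s u g

/-- The full gradient `∇φ = (∇_x φ, ∇_y φ)` of a function of `(x, y) ∈ ℝ^m × ℝ^n`, with the
Euclidean inner product of `ℝ^m × ℝ^n`. -/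
def grad {m n : ℕ} (φ : Euc m × Euc n → ℝ) (z : Euc m × Euc n) : WithLp 2 (Euc m × Euc n) :=
  WithLp.toLp 2 (gradient (fun x => φ (x, z.2)) z.1, gradient (fun y => φ (z.1, y)) z.2)

/-- The weighted measure `|y|^a dx dy` on `ℝ^m × ℝ^n`. -/
def weightedVolume (m n : ℕ) (a : ℝ) : Measure (Euc m × Euc n) :=
  (volume : Measure (Euc m × Euc n)).withDensity (fun z => ENNReal.ofReal (‖z.2‖ ^ a))

/-- The test functions `φ k` converge in the energy space `𝓓^{1,a}(ℝ^m × ℝ^n)`: they converge to the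
function `U` in `L^1_loc`, and `∇φ k` converges to `G` in `L^2(|y|^a dx dy)`. -/
structure TendstoD1a {m n : ℕ} (a : ℝ) (φ : ℕ → Euc m × Euc n → ℝ) (U : Euc m × Euc n → ℝ)
    (G : Euc m × Euc n → WithLp 2 (Euc m × Euc n)) : Prop where
  test : ∀ k, IsTest (φ k)
  locInt : LocallyIntegrable U volume
  tendsto_fun : TendstoL1loc φ U
  memLp : MemLp G 2 (weightedVolume m n a)
  tendsto_energy :
    Tendsto (fun k => eLpNorm (grad (φ k) - G) 2 (weightedVolume m n a)) atTop (𝓝 0)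

/-- `U` belongs to `𝓓^{1,a}(ℝ^m × ℝ^n)` and `∇U = G`. Here `𝓓^{1,a}`, the completion of `C_c^∞` for
the norm `(∫ |y|^a |∇φ|²)^{1/2}`, is realized as a space of locally integrable functions (modulo
null sets), which is possible by the weighted Hardy inequality. -/
def HasEnergyGradient {m n : ℕ} (a : ℝ) (U : Euc m × Euc n → ℝ)
    (G : Euc m × Euc n → WithLp 2 (Euc m × Euc n)) : Prop :=
  ∃ φ : ℕ → Euc m × Euc n → ℝ, TendstoD1a a φ U G

/-- `Tr U = u`: the trace operator `𝓓^{1,a}(ℝ^m × ℝ^n) → 𝓓^s(ℝ^m)` is the continuous extension of the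
restriction `φ ↦ φ(·, 0)` of test functions to the thin set `{y = 0}`. -/
def IsTrace {m n : ℕ} (a s : ℝ) (U : Euc m × Euc n → ℝ) (u : Euc m → ℝ) : Prop :=
  ∃ (φ : ℕ → Euc m × Euc n → ℝ) (G : Euc m × Euc n → WithLp 2 (Euc m × Euc n)) (g : Euc m → ℝ),
    TendstoD1a a φ U G ∧ TendstoDs s (fun k x => φ k (x, 0)) u g

/-- `U` minimizes `∫ |y|^a |∇U|²` among the elements of `𝓓^{1,a}(ℝ^m × ℝ^n)` with trace `u`. -/
def IsMinimalExtension {m n : ℕ} (a s : ℝ) (u : Euc m → ℝ) (U : Euc m × Euc n → ℝ) : Prop :=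
  ∃ G : Euc m × Euc n → WithLp 2 (Euc m × Euc n),
    HasEnergyGradient a U G ∧ IsTrace a s U u ∧
    ∀ (V : Euc m × Euc n → ℝ) (H : Euc m × Euc n → WithLp 2 (Euc m × Euc n)),
      HasEnergyGradient a V H → IsTrace a s V u →
      ∫ z, ‖G z‖ ^ 2 ∂(weightedVolume m n a) ≤ ∫ z, ‖H z‖ ^ 2 ∂(weightedVolume m n a)

/-- The Poisson-type kernel
`P(x,y) = Γ((m+2s)/2) / (π^{m/2} Γ(s)) * |y|^{2s} / (|x|²+|y|²)^{(m+2s)/2}` on `ℝ^m × ℝ^n`. -/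
def poissonKernel {m n : ℕ} (s : ℝ) (x : Euc m) (y : Euc n) : ℝ :=
  Real.Gamma (((m : ℝ) + 2 * s) / 2) / (Real.pi ^ ((m : ℝ) / 2) * Real.Gamma s) *
    (‖y‖ ^ (2 * s) / (‖x‖ ^ 2 + ‖y‖ ^ 2) ^ (((m : ℝ) + 2 * s) / 2))

/-- `(u ∗ P)(x,y)`, the convolution in the `x` variable with the kernel. -/
def poissonExtension {m : ℕ} (n : ℕ) (s : ℝ) (u : Euc m → ℝ) : Euc m × Euc n → ℝ := fun z =>
  ∫ ξ, u ξ * poissonKernel s (z.1 - ξ) z.2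

/-- The constant `d_{a,n} = 2^{a+n-1} Γ((a+n)/2) / Γ((2-a-n)/2)`. -/
def conormalConst (a : ℝ) (n : ℕ) : ℝ :=
  (2 : ℝ) ^ (a + n - 1) * Real.Gamma ((a + n) / 2) / Real.Gamma ((2 - a - n) / 2)

/-- The surface measure `|S^{n-1}|` of the unit sphere of `ℝ^n`. -/
def sphereArea (n : ℕ) : ℝ :=
  (volume : Measure (Euc n)).toSphere.real Set.univ

end

end ThinExtension

/-!
The theorem identifies the minimal extension of `u ∈ 𝓓^s(ℝ^m)`, `m = d - n`, to the weighted space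
`𝓓^{1,a}(ℝ^m × ℝ^n)` with the Poisson extension `u ∗ P`. With `a + n = 2 - 2s`, the hypothesis
`d + a > 2` says exactly that `2s < m`, and `n ≥ 2` gives `a ≤ 0`.

**Test functions.** The Fourier transform in `x` turns the equation `div(|y|^a ∇U) = 0` into an
ordinary differential equation in `r = |y|`, whose decaying solution at the frequency `ξ` is
`θ_s((2π|ξ|r)²)`, the function `θ_s` being a normalized Bessel-type integral (`profile`). The flux
`r^{1-2s} ∂_r θ_s` is a multiple of `θ_{1-s}`, so that the derivative formula, used at `s` and at
`1 - s`, is the differential equation; integrating over `r > 0` gives the energy identity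
(`integral_profile_energy`) and the weak equation (`integral_profile_weak`). By Plancherel's and
Fubini's theorems the field `extField`, the gradient of the extension of a test function `φ`,
satisfies `∫ |y|^a |∇U|² = c ‖(-Δ)^{s/2} φ‖²` (`lintegral_extField_sq`) and the weak equation
(`integral_inner_extField`), with the same constant `c = |S^{n-1}| d_{a,n}`. Expanding a square,
these two facts give the trace inequality (`trace_le`). That the function with the Fourier transform
`θ_s((2π|ξ||y|)²) φ̂(ξ)` is `φ ∗ P` follows by writing `θ_s` as a superposition of Gaussians in `ξ`
(`fourierInv_profile`). It lies in `𝓓^{1,a}`, since it is the limit of cut-off extensions evaluated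
at the height `√(|y|² + ε²)`, which are smooth across `y = 0` (`exists_test_tendsto_extension`).

**General `u`.** As `2s < m`, the symbol `|ξ|^{-s}` is locally square integrable, which yields the
duality estimate `∫ |u| |w| ≤ C ‖(-Δ)^{s/2} u‖` for `w ∈ L¹ ∩ L²` (`TendstoDs.lintegral_mul_le`).
With `w` a translate of the kernel, this gives absolute convergence of `u ∗ P` and its continuity in
`u` at each point with `y ≠ 0`. The extensions of approximating test functions thus converge
pointwise, and by the energy identity their gradients converge in the weighted `L²` space. The
energy controls the `L¹` norm on balls (`TendstoD1a.setLIntegral_ball_le`), hence the limit belongs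
to `𝓓^{1,a}`, by a diagonal argument (`exists_diagonal`), and by the trace inequality the diagonal
test functions have traces converging to `u`. The energy identity and the weak equation pass to the
limit (`TendstoDs.exists_extension`).

**Minimality.** The gradient of an element of `𝓓^{1,a}` and the half Laplacian of an element of
`𝓓^s` are determined almost everywhere (`TendstoD1a.ae_eq_zero`, `HasHalfFracLaplacian.ae_eq`). By
the weak equation the energy of any competitor exceeds that of `u ∗ P` by the energy of the
difference (`exists_gradient_poissonExtension`), which vanishes only if the two functions agree.
-/

namespace ThinExtension

/-! ### Test functions and the Fourier transform -/

theorem IsTest.continuous {X : Type*} [NormedAddCommGroup X] [NormedSpace ℝ X] {φ : X → ℝ}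
    (h : IsTest φ) : Continuous φ := h.1.continuous

theorem IsTest.sub {X : Type*} [NormedAddCommGroup X] [NormedSpace ℝ X] {φ ψ : X → ℝ}
    (h : IsTest φ) (h' : IsTest ψ) : IsTest (φ - ψ) :=
  ⟨h.1.sub h'.1, h.2.sub h'.2⟩

/-- `A(-ξ)` is the complex conjugate of `A(ξ)`: the amplitudes with a real inverse Fourier
transform. -/
def IsHermitianSymm {V : Type*} [Neg V] (A : V → ℂ) : Prop := ∀ ξ, A (-ξ) = (starRingEnd ℂ) (A ξ)

theorem isHermitianSymm_radial {V : Type*} [SeminormedAddGroup V] (b : ℝ → ℝ) :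
    IsHermitianSymm (fun ξ : V => (b ‖ξ‖ : ℂ)) := fun ξ => by
  simp

section Fourier

variable {V : Type*} [NormedAddCommGroup V] [InnerProductSpace ℝ V] [FiniteDimensional ℝ V]
  [MeasurableSpace V] [BorelSpace V]

theorem integral_fourierInv_mul_flip {f g : V → ℂ} (hf : Integrable f) (hg : Integrable g) :
    ∫ x, 𝓕⁻ f x * g x = ∫ x, f x * 𝓕⁻ g x := by
  have h := VectorFourier.integral_fourierIntegral_smul_eq_flip (μ := (volume : Measure V))
    (ν := (volume : Measure V)) (L := -innerₗ V) (e := Real.fourierChar) Real.continuous_fourierChar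
    ((continuous_inner (𝕜 := ℝ) (E := V)).neg) hf hg
  have h2 : (-innerₗ V).flip = -innerₗ V := by
    ext x y
    simp [real_inner_comm]
  rw [h2] at h
  exact h

theorem continuous_fourierInv {f : V → ℂ} (hf : Integrable f) : Continuous (𝓕⁻ f) := by
  exact VectorFourier.fourierIntegral_continuous Real.continuous_fourierChar
    ((continuous_inner (𝕜 := ℝ) (E := V)).neg) hf

/-- On `L¹ ∩ L²` the Fourier transform of `L²` is given by the integral. -/
theorem fourierInv_toLp_ae {f : V → ℂ} (h1 : Integrable f) (h2 : MemLp f 2 volume) :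
    ((𝓕⁻ (h2.toLp f) : Lp (α := V) ℂ 2 volume) : V → ℂ) =ᵐ[volume] 𝓕⁻ f := by
  refine ae_eq_of_integral_contDiff_smul_eq
    ((Lp.memLp _).locallyIntegrable (by norm_num)) (continuous_fourierInv h1).locallyIntegrable ?_
  intro g hg hg'
  have hgc : ContDiff ℝ ∞ (fun x => (g x : ℂ)) := Complex.ofRealCLM.contDiff.comp hg
  have hgs : HasCompactSupport (fun x => (g x : ℂ)) := hg'.comp_left (g := fun r : ℝ => (r : ℂ)) rfl
  set G : SchwartzMap V ℂ := hgs.toSchwartzMap hgc with hG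
  have hGx : ∀ x, G x = (g x : ℂ) := fun x => rfl
  have e1 := congrArg (fun T => T G) (Lp.fourierInv_toTemperedDistribution_eq (h2.toLp f))
  simp only [TemperedDistribution.fourierInv_apply, Lp.toTemperedDistribution_apply] at e1
  have e2 : ∫ x, (𝓕⁻ G) x • (h2.toLp f) x = ∫ x, 𝓕⁻ (G : V → ℂ) x * f x := by
    apply integral_congr_ae
    filter_upwards [h2.coeFn_toLp] with x hx
    rw [hx, SchwartzMap.fourierInv_coe, smul_eq_mul]
  rw [e2, integral_fourierInv_mul_flip G.integrable h1] at e1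
  have e3 : ∀ x, ∀ z : ℂ, g x • z = G x • z := fun x z => by
    rw [hGx, Complex.real_smul, smul_eq_mul]
  simp only [e3]
  exact e1.symm

theorem memLp_fourierInv {f : V → ℂ} (h1 : Integrable f) (h2 : MemLp f 2 volume) :
    MemLp (𝓕⁻ f) 2 volume :=
  (memLp_congr_ae (fourierInv_toLp_ae h1 h2)).1 (Lp.memLp _)

/-- Plancherel's identity on `L¹ ∩ L²`. -/
theorem integral_inner_fourierInv {f g : V → ℂ} (hf : Integrable f) (hf2 : MemLp f 2 volume)
    (hg : Integrable g) (hg2 : MemLp g 2 volume) :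
    ∫ x, inner ℂ (𝓕⁻ f x) (𝓕⁻ g x) = ∫ x, inner ℂ (f x) (g x) := by
  have h : inner ℂ (𝓕⁻ (hf2.toLp f) : Lp (α := V) ℂ 2 volume)
      (𝓕⁻ (hg2.toLp g) : Lp (α := V) ℂ 2 volume) =
      inner ℂ (hf2.toLp f) (hg2.toLp g) :=
    (Lp.fourierTransformₗᵢ V ℂ).symm.inner_map_map _ _
  rw [L2.inner_def, L2.inner_def] at h
  rw [integral_congr_ae (g := fun x => inner ℂ ((𝓕⁻ (hf2.toLp f) : Lp (α := V) ℂ 2 volume) x)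
    ((𝓕⁻ (hg2.toLp g) : Lp (α := V) ℂ 2 volume) x)), h]
  · apply integral_congr_ae
    filter_upwards [hf2.coeFn_toLp, hg2.coeFn_toLp] with x hx hx'
    rw [hx, hx']
  · filter_upwards [fourierInv_toLp_ae hf hf2, fourierInv_toLp_ae hg hg2] with x hx hx'
    rw [hx, hx']

theorem eLpNorm_fourierInv {f : V → ℂ} (h1 : Integrable f) (h2 : MemLp f 2 volume) :
    eLpNorm (𝓕⁻ f) 2 volume = eLpNorm f 2 volume := by
  rw [← eLpNorm_congr_ae (fourierInv_toLp_ae h1 h2)]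
  have h : ‖(𝓕⁻ (h2.toLp f) : Lp (α := V) ℂ 2 volume)‖ = ‖h2.toLp f‖ :=
    (Lp.fourierTransformₗᵢ V ℂ).symm.norm_map _
  rw [Lp.norm_def, Lp.norm_toLp] at h
  exact (ENNReal.toReal_eq_toReal_iff' (Lp.eLpNorm_ne_top _) h2.2.ne).1 h

theorem IsHermitianSymm.im_fourierInv {A : V → ℂ} (hA : IsHermitianSymm A) (x : V) :
    (𝓕⁻ A x).im = 0 := by
  rw [← Complex.conj_eq_iff_im, Real.fourierInv_eq', ← integral_conj, ← integral_neg_eq_self]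
  congr 1
  ext v
  simp only [inner_neg_left, mul_neg, smul_eq_mul, map_mul, hA v, Complex.conj_conj]
  congr 1
  rw [← Complex.exp_conj]
  simp [Complex.conj_ofNat]

theorem IsHermitianSymm.ofReal_re_fourierInv {A : V → ℂ} (hA : IsHermitianSymm A) (x : V) :
    (((𝓕⁻ A x).re : ℝ) : ℂ) = 𝓕⁻ A x :=
  Complex.ext (by simp) (by simp [hA.im_fourierInv x])

theorem IsHermitianSymm.eLpNorm_re_fourierInv {A : V → ℂ} (hA : IsHermitianSymm A)
    (h1 : Integrable A) (h2 : MemLp A 2 volume) :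
    eLpNorm (fun x => (𝓕⁻ A x).re) 2 volume = eLpNorm A 2 volume := by
  rw [← eLpNorm_fourierInv h1 h2]
  apply eLpNorm_congr_norm_ae
  filter_upwards with x
  rw [← hA.ofReal_re_fourierInv x]
  simp

theorem IsHermitianSymm.lintegral_re_fourierInv_sq {A : V → ℂ} (hA : IsHermitianSymm A)
    (h1 : Integrable A) (h2 : MemLp A 2 volume) :
    ∫⁻ x, ‖(𝓕⁻ A x).re‖ₑ ^ 2 = ∫⁻ ξ, ‖A ξ‖ₑ ^ 2 := by
  have h := hA.eLpNorm_re_fourierInv h1 h2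
  rw [eLpNorm_eq_lintegral_rpow_enorm_toReal (by norm_num) (by norm_num),
    eLpNorm_eq_lintegral_rpow_enorm_toReal (by norm_num) (by norm_num)] at h
  have h' := ENNReal.rpow_left_injective (by norm_num) h
  simpa using h'

theorem IsHermitianSymm.integral_re_fourierInv_mul {A B : V → ℂ} (hA : IsHermitianSymm A)
    (hB : IsHermitianSymm B) (h1 : Integrable A) (h2 : MemLp A 2 volume)
    (h3 : Integrable B) (h4 : MemLp B 2 volume) :
    ∫ x, (𝓕⁻ A x).re * (𝓕⁻ B x).re = (∫ ξ, inner ℂ (A ξ) (B ξ)).re := by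
  rw [← integral_inner_fourierInv h1 h2 h3 h4]
  rw [← Complex.ofReal_re (∫ x, (𝓕⁻ A x).re * (𝓕⁻ B x).re), ← integral_complex_ofReal]
  congr 2
  ext x
  rw [← hA.ofReal_re_fourierInv x, ← hB.ofReal_re_fourierInv x]
  simp [mul_comm]

theorem memLp_re {f : V → ℂ} (hf : MemLp f 2 volume) : MemLp (fun x => (f x).re) 2 volume :=
  hf.re

/-- The Fourier transform of a real function, with the phase `e^{-2πi x·ξ}`. -/
noncomputable def specHat (φ : V → ℝ) : V → ℂ := 𝓕 (fun t => (φ t : ℂ))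

/-- A test function as a complex Schwartz function. -/
noncomputable def IsTest.toSchwartz {φ : V → ℝ} (h : IsTest φ) : SchwartzMap V ℂ :=
  (h.2.comp_left (g := fun r : ℝ => (r : ℂ)) rfl :
      HasCompactSupport (fun x => (φ x : ℂ))).toSchwartzMap
    (Complex.ofRealCLM.contDiff.comp h.1)

theorem IsTest.specHat_eq {φ : V → ℝ} (h : IsTest φ) : specHat φ =
    (𝓕 h.toSchwartz : SchwartzMap V ℂ) := rfl

theorem IsTest.integrable {φ : V → ℝ} (h : IsTest φ) : Integrable φ :=
  h.continuous.integrable_of_hasCompactSupport h.2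

theorem IsTest.memLp {φ : V → ℝ} (h : IsTest φ) (p : ENNReal) : MemLp φ p volume :=
  h.continuous.memLp_of_hasCompactSupport h.2

theorem specHat_neg (φ : V → ℝ) (ξ : V) : specHat φ (-ξ) = (starRingEnd ℂ) (specHat φ ξ) := by
  unfold specHat
  rw [Real.fourier_eq', Real.fourier_eq', ← integral_conj]
  congr 1
  ext v
  simp only [smul_eq_mul, map_mul, Complex.conj_ofReal]
  congr 1
  rw [← Complex.exp_conj]
  simp [Complex.conj_ofNat]

theorem specHat_sub {φ ψ : V → ℝ} (h : Integrable φ) (h' : Integrable ψ) :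
    specHat (φ - ψ) = specHat φ - specHat ψ := by
  ext ξ
  have h1 := (Real.fourierIntegral_convergent_iff (f := fun x => (φ x : ℂ)) ξ).2 h.ofReal
  have h2 := (Real.fourierIntegral_convergent_iff (f := fun x => (ψ x : ℂ)) ξ).2 h'.ofReal
  simp only [specHat, Pi.sub_apply, Real.fourier_eq]
  rw [← integral_sub h1 h2]
  congr 1
  ext v
  simp [smul_sub]

theorem IsTest.continuous_specHat {φ : V → ℝ} (h : IsTest φ) : Continuous (specHat φ) := by
  rw [h.specHat_eq]; exact (𝓕 h.toSchwartz : SchwartzMap V ℂ).continuous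

theorem IsTest.integrable_pow_mul_specHat {φ : V → ℝ} (h : IsTest φ) (k : ℕ) :
    Integrable (fun ξ => (1 + ‖ξ‖) ^ k * ‖specHat φ ξ‖) := by
  have h0 := (𝓕 h.toSchwartz : SchwartzMap V ℂ).integrable_pow_mul volume
  rw [h.specHat_eq]
  refine (((h0 0).add (h0 k)).const_mul (2 ^ (k - 1) : ℝ)).mono' ?_ ?_
  · exact (((continuous_const.add continuous_norm).pow k).mul
      (𝓕 h.toSchwartz : SchwartzMap V ℂ).continuous.norm).aestronglyMeasurable
  · filter_upwards with ξ
    have := add_pow_le (zero_le_one) (norm_nonneg ξ) k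
    rw [Real.norm_of_nonneg (by positivity)]
    simp only [Pi.add_apply, pow_zero, one_pow] at this ⊢
    calc _ ≤ (2 ^ (k-1) * (1 + ‖ξ‖ ^ k)) * ‖(𝓕 h.toSchwartz : SchwartzMap V ℂ) ξ‖ := by gcongr
      _ = _ := by ring

theorem IsTest.bound_pow_mul_specHat {φ : V → ℝ} (h : IsTest φ) (k : ℕ) :
    ∃ C, ∀ ξ, (1 + ‖ξ‖) ^ k * ‖specHat φ ξ‖ ≤ C := by
  obtain ⟨C, hC⟩ := (𝓕 h.toSchwartz : SchwartzMap V ℂ).decay k 0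
  obtain ⟨D, hD⟩ := (𝓕 h.toSchwartz : SchwartzMap V ℂ).decay 0 0
  refine ⟨2 ^ (k - 1) * (D + C), fun ξ => ?_⟩
  rw [h.specHat_eq]
  have := add_pow_le (zero_le_one) (norm_nonneg ξ) k
  have h1 := hC.2 ξ
  have h2 := hD.2 ξ
  simp only [norm_iteratedFDeriv_zero, pow_zero, one_pow, one_mul] at h1 h2 this
  calc _ ≤ (2 ^ (k-1) * (1 + ‖ξ‖ ^ k)) * ‖(𝓕 h.toSchwartz : SchwartzMap V ℂ) ξ‖ := by gcongr
    _ = 2 ^ (k-1) * (‖(𝓕 h.toSchwartz : SchwartzMap V ℂ) ξ‖ + ‖ξ‖ ^ k *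
        ‖(𝓕 h.toSchwartz : SchwartzMap V ℂ) ξ‖) := by ring
    _ ≤ _ := by gcongr

/-- The Fourier transform of a test function stays integrable after multiplication by a symbol of
polynomial growth. -/
theorem IsTest.integrable_mul_specHat {φ : V → ℝ} (h : IsTest φ) {b : V → ℂ}
    (hb : AEStronglyMeasurable b volume) {C : ℝ} {k : ℕ} (hC : ∀ ξ, ‖b ξ‖ ≤ C * (1 + ‖ξ‖) ^ k) :
    Integrable (fun ξ => b ξ * specHat φ ξ) := by
  refine ((h.integrable_pow_mul_specHat k).const_mul C).mono'
    (hb.mul h.continuous_specHat.aestronglyMeasurable) ?_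
  filter_upwards with ξ
  rw [norm_mul, ← mul_assoc]
  exact mul_le_mul_of_nonneg_right (hC ξ) (norm_nonneg _)

theorem IsTest.memLp_mul_specHat {φ : V → ℝ} (h : IsTest φ) {b : V → ℂ}
    (hb : AEStronglyMeasurable b volume) {C : ℝ} {k : ℕ} (hC : ∀ ξ, ‖b ξ‖ ≤ C * (1 + ‖ξ‖) ^ k) :
    MemLp (fun ξ => b ξ * specHat φ ξ) 2 volume := by
  have h1 := h.integrable_mul_specHat hb hC
  rw [memLp_two_iff_integrable_sq_norm h1.1]
  obtain ⟨D, hD⟩ := h.bound_pow_mul_specHat k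
  refine (h1.norm.const_mul (|C| * D)).mono' (h1.1.norm.pow 2) ?_
  filter_upwards with ξ
  rw [Real.norm_of_nonneg (by positivity), sq]
  gcongr
  rw [norm_mul]
  calc ‖b ξ‖ * ‖specHat φ ξ‖ ≤ (|C| * (1 + ‖ξ‖) ^ k) * ‖specHat φ ξ‖ := by
        gcongr
        exact (hC ξ).trans (by gcongr; exact le_abs_self C)
    _ = |C| * ((1 + ‖ξ‖) ^ k * ‖specHat φ ξ‖) := by ring
    _ ≤ _ := by gcongr; exact hD ξ

theorem IsTest.fourierInv_specHat {φ : V → ℝ} (h : IsTest φ) (x : V) :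
    𝓕⁻ (specHat φ) x = (φ x : ℂ) := by
  have e : 𝓕⁻ (𝓕 h.toSchwartz : SchwartzMap V ℂ) = h.toSchwartz :=
      FourierTransform.fourierInv_fourier_eq _
  have := congrArg (fun g : SchwartzMap V ℂ => g x) e
  simp only [SchwartzMap.fourierInv_coe] at this
  rw [h.specHat_eq, this]
  rfl

theorem isHermitianSymm_mul_specHat (φ : V → ℝ) {b : V → ℂ} (hb : IsHermitianSymm b) :
    IsHermitianSymm (fun ξ => b ξ * specHat φ ξ) := fun ξ => by
  simp [hb ξ, specHat_neg]

end Fourier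

/-! ### Weighted integrability of test functions and of elements of `𝓓^s` -/

section General

theorem lintegral_enorm_mul_le_eLpNorm_two {α E F : Type*} [MeasurableSpace α] {μ : Measure α}
    [NormedAddCommGroup E] [NormedAddCommGroup F] {f : α → E} {g : α → F}
    (hf : AEStronglyMeasurable f μ) (hg : AEStronglyMeasurable g μ) :
    ∫⁻ x, ‖f x‖ₑ * ‖g x‖ₑ ∂μ ≤ eLpNorm f 2 μ * eLpNorm g 2 μ := by
  rw [eLpNorm_eq_lintegral_rpow_enorm_toReal (by norm_num) (by norm_num),
    eLpNorm_eq_lintegral_rpow_enorm_toReal (by norm_num) (by norm_num)]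
  simpa using ENNReal.lintegral_mul_le_Lp_mul_Lq μ Real.HolderConjugate.two_two hf.enorm hg.enorm

theorem integrableOn_norm_rpow_ball {E : Type*} [NormedAddCommGroup E] [NormedSpace ℝ E]
    [FiniteDimensional ℝ E] [Nontrivial E] [MeasurableSpace E] [BorelSpace E] (μ : Measure E)
    [μ.IsAddHaarMeasure] {p : ℝ} (hp : -(Module.finrank ℝ E : ℝ) < p) (r : ℝ) :
    IntegrableOn (fun x : E => ‖x‖ ^ p) (Metric.ball 0 r) μ := by
  rw [integrableOn_fun_norm_addHaar μ (f := fun t : ℝ => t ^ p)]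
  rcases le_or_gt r 0 with hr | hr
  · simp [Set.Ioo_eq_empty (not_lt.2 hr)]
  have h1 : IntegrableOn (fun y : ℝ => y ^ ((Module.finrank ℝ E : ℝ) - 1 + p)) (Set.Ioo 0 r) :=
    (intervalIntegral.integrableOn_Ioo_rpow_iff hr).2 (by linarith)
  refine h1.congr_fun (fun y hy => ?_) measurableSet_Ioo
  have hpos : 0 < Module.finrank ℝ E := Module.finrank_pos
  simp only [smul_eq_mul]
  rw [Real.rpow_add hy.1, ← Real.rpow_natCast, Nat.cast_pred hpos]

/-- Fatou's lemma for convergence in `L¹_loc` and a weight `w` with values in `[0, ∞]`. -/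
theorem TendstoL1loc.lintegral_mul_le {X : Type*} [NormedAddCommGroup X] [ProperSpace X]
    [MeasureSpace X] [BorelSpace X] {φ : ℕ → X → ℝ} {u : X → ℝ} (h : TendstoL1loc φ u)
    (hφ : ∀ k, AEStronglyMeasurable (φ k) volume) (hu : AEStronglyMeasurable u volume)
    {w : X → ENNReal} (hw : AEMeasurable w volume) {B : ℕ → ENNReal} {b : ENNReal}
    (hB : ∀ k, ∫⁻ x, ‖φ k x‖ₑ * w x ≤ B k) (hb : Tendsto B atTop (𝓝 b)) :
    ∫⁻ x, ‖u x‖ₑ * w x ≤ b := by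
  have hball : ∀ N : ℕ, ∫⁻ x in Metric.closedBall (0 : X) N, ‖u x‖ₑ * w x ≤ b := by
    intro N
    have h1 : Tendsto (fun k => eLpNorm (φ k - u) 1
        (volume.restrict (Metric.closedBall (0 : X) N))) atTop (𝓝 0) := by
      simpa [eLpNorm_one_eq_lintegral_enorm] using h _ (isCompact_closedBall (0 : X) N)
    have h2 := tendstoInMeasure_of_tendsto_eLpNorm (by norm_num)
      (fun k => (hφ k).restrict) hu.restrict h1
    -- on each ball, a subsequence converges almost everywhere
    obtain ⟨ns, hns, hae⟩ := h2.exists_seq_tendsto_ae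
    calc ∫⁻ x in Metric.closedBall (0 : X) N, ‖u x‖ₑ * w x
        ≤ ∫⁻ x in Metric.closedBall (0 : X) N, liminf (fun k => ‖φ (ns k) x‖ₑ * w x) atTop := by
          apply lintegral_mono_ae
          filter_upwards [hae] with x hx
          -- where `w = ∞`, the product is not continuous in the first factor, but it equals `∞` as
          -- soon as `φ k x ≠ 0`
          by_cases hwx : w x = ⊤
          · by_cases hux : u x = 0
            · simp [hux]
            · have : ∀ᶠ k in atTop, φ (ns k) x ≠ 0 := hx.eventually_ne hux
              refine le_trans le_top (le_of_eq ?_)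
              symm
              rw [liminf_congr (v := fun _ => (⊤ : ENNReal)), liminf_const]
              filter_upwards [this] with k hk
              rw [hwx, ENNReal.mul_top]
              simpa using hk
          · exact (ENNReal.Tendsto.mul_const hx.enorm (Or.inr hwx)).liminf_eq.ge
      _ ≤ liminf (fun k => ∫⁻ x in Metric.closedBall (0 : X) N, ‖φ (ns k) x‖ₑ * w x) atTop :=
          lintegral_liminf_le' fun k => ((hφ _).restrict.enorm.mul hw.restrict)
      _ ≤ liminf (fun k => B (ns k)) atTop := by
          refine liminf_le_liminf (Eventually.of_forall fun k => ?_)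
          exact (setLIntegral_le_lintegral _ _).trans (hB _)
      _ = b := (hb.comp hns.tendsto_atTop).liminf_eq
  have hU : ⋃ N : ℕ, Metric.closedBall (0 : X) N = Set.univ := Metric.iUnion_closedBall_nat 0
  rw [← setLIntegral_univ, ← hU, setLIntegral_iUnion_of_directed]
  · exact iSup_le hball
  · exact directed_of_isDirected_le fun i j hij => Metric.closedBall_subset_closedBall
        (by simpa using hij)

theorem TendstoL1loc.sub {X : Type*} [TopologicalSpace X] [MeasureSpace X] {φ ψ : ℕ → X → ℝ}
    {u v : X → ℝ} (h : TendstoL1loc φ u) (h' : TendstoL1loc ψ v)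
    (hφ : ∀ k, AEStronglyMeasurable (φ k) volume) (hu : AEStronglyMeasurable u volume) :
    TendstoL1loc (fun k => φ k - ψ k) (u - v) := by
  intro K hK
  have h1 := (h K hK).add (h' K hK)
  rw [add_zero] at h1
  refine tendsto_of_tendsto_of_tendsto_of_le_of_le tendsto_const_nhds h1 (fun _ => zero_le) ?_
  intro k
  change _ ≤ (∫⁻ x in K, ‖φ k x - u x‖ₑ) + (∫⁻ x in K, ‖ψ k x - v x‖ₑ)
  have hm : AEMeasurable (fun x => ‖φ k x - u x‖ₑ) (volume.restrict K) :=
    ((hφ k).sub hu).restrict.enorm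
  rw [← lintegral_add_left' hm]
  apply lintegral_mono
  intro x
  simp only [Pi.sub_apply]
  rw [show φ k x - ψ k x - (u x - v x) = (φ k x - u x) - (ψ k x - v x) by ring]
  exact enorm_sub_le

end General

section HalfLaplacian

variable {m : ℕ} {s : ℝ}

/-- The Fourier transform `|2πξ|^s φ̂(ξ)` of `(-Δ)^{s/2} φ`. -/
noncomputable def halfAmp (s : ℝ) (φ : Euc m → ℝ) (ξ : Euc m) : ℂ :=
  (((2 * Real.pi * ‖ξ‖) ^ s : ℝ) : ℂ) * specHat φ ξ

theorem fracLaplacian_half (s : ℝ) (φ : Euc m → ℝ) :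
    fracLaplacian (s / 2) φ = fun x => (𝓕⁻ (halfAmp s φ) x).re := by
  ext x
  rw [fracLaplacian, mul_div_cancel₀ s two_ne_zero]
  rfl

theorem rpow_le_one_add_sq {t p : ℝ} (ht : 0 ≤ t) (hp : 0 ≤ p) (hp2 : p ≤ 2) :
    t ^ p ≤ (1 + t) ^ 2 := by
  calc t ^ p ≤ (1 + t) ^ p := Real.rpow_le_rpow ht (by linarith) hp
    _ ≤ (1 + t) ^ (2 : ℝ) := Real.rpow_le_rpow_of_exponent_le (by linarith) hp2
    _ = _ := by norm_cast

theorem two_pi_mul_rpow_le {p : ℝ} (hp : 0 ≤ p) (hp2 : p ≤ 2) {t : ℝ} (ht : 0 ≤ t) :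
    (2 * Real.pi * t) ^ p ≤ (2 * Real.pi) ^ p * (1 + t) ^ 2 := by
  rw [Real.mul_rpow (by positivity) ht]
  gcongr
  exact rpow_le_one_add_sq ht hp hp2

theorem halfAmp_bound (hs : s ∈ Set.Ioo (0 : ℝ) 1) (ξ : Euc m) :
    ‖(((2 * Real.pi * ‖ξ‖) ^ s : ℝ) : ℂ)‖ ≤ (2 * Real.pi) ^ s * (1 + ‖ξ‖) ^ 2 := by
  rw [Complex.norm_real, Real.norm_of_nonneg (by positivity)]
  exact two_pi_mul_rpow_le hs.1.le (by linarith [hs.2]) (norm_nonneg _)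

theorem measurable_halfSymbol :
    Measurable (fun ξ : Euc m => (((2 * Real.pi * ‖ξ‖) ^ s : ℝ) : ℂ)) := by
  fun_prop

theorem IsTest.integrable_halfAmp {φ : Euc m → ℝ} (h : IsTest φ) (hs : s ∈ Set.Ioo (0 : ℝ) 1) :
    Integrable (halfAmp s φ) :=
  h.integrable_mul_specHat measurable_halfSymbol.aestronglyMeasurable (halfAmp_bound hs)

theorem IsTest.memLp_halfAmp {φ : Euc m → ℝ} (h : IsTest φ) (hs : s ∈ Set.Ioo (0 : ℝ) 1) :
    MemLp (halfAmp s φ) 2 volume :=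
  h.memLp_mul_specHat measurable_halfSymbol.aestronglyMeasurable (halfAmp_bound hs)

theorem isHermitianSymm_halfAmp (φ : Euc m → ℝ) : IsHermitianSymm (halfAmp s φ) :=
  isHermitianSymm_mul_specHat φ (isHermitianSymm_radial (fun t => (2 * Real.pi * t) ^ s))

theorem IsTest.memLp_fracLaplacian {φ : Euc m → ℝ} (h : IsTest φ) (hs : s ∈ Set.Ioo (0 : ℝ) 1) :
    MemLp (fracLaplacian (s / 2) φ) 2 volume := by
  rw [fracLaplacian_half]
  exact memLp_re (memLp_fourierInv (h.integrable_halfAmp hs) (h.memLp_halfAmp hs))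

theorem IsTest.eLpNorm_fracLaplacian {φ : Euc m → ℝ} (h : IsTest φ) (hs : s ∈ Set.Ioo (0 : ℝ) 1) :
    eLpNorm (fracLaplacian (s / 2) φ) 2 volume = eLpNorm (halfAmp s φ) 2 volume := by
  rw [fracLaplacian_half]
  exact (isHermitianSymm_halfAmp φ).eLpNorm_re_fourierInv (h.integrable_halfAmp hs)
    (h.memLp_halfAmp hs)

theorem IsTest.integral_fracLaplacian_mul {φ ψ : Euc m → ℝ} (h : IsTest φ) (h' : IsTest ψ)
    (hs : s ∈ Set.Ioo (0 : ℝ) 1) :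
    ∫ x, fracLaplacian (s / 2) φ x * fracLaplacian (s / 2) ψ x =
      (∫ ξ, inner ℂ (halfAmp s φ ξ) (halfAmp s ψ ξ)).re := by
  simp only [fracLaplacian_half]
  exact (isHermitianSymm_halfAmp φ).integral_re_fourierInv_mul (isHermitianSymm_halfAmp ψ)
    (h.integrable_halfAmp hs) (h.memLp_halfAmp hs) (h'.integrable_halfAmp hs) (h'.memLp_halfAmp hs)

theorem halfAmp_sub {φ ψ : Euc m → ℝ} (h : IsTest φ) (h' : IsTest ψ) :
    halfAmp s (φ - ψ) = halfAmp s φ - halfAmp s ψ := by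
  ext ξ
  simp only [halfAmp, specHat_sub h.integrable h'.integrable, Pi.sub_apply, mul_sub]

theorem fracLaplacian_sub {φ ψ : Euc m → ℝ} (h : IsTest φ) (h' : IsTest ψ)
    (hs : s ∈ Set.Ioo (0 : ℝ) 1) :
    fracLaplacian (s / 2) (φ - ψ) = fracLaplacian (s / 2) φ - fracLaplacian (s / 2) ψ := by
  simp only [fracLaplacian_half, halfAmp_sub h h']
  ext x
  have e1 := (Real.fourierIntegral_convergent_iff (f := halfAmp s φ) (-x)).2
      (h.integrable_halfAmp hs)
  have e2 := (Real.fourierIntegral_convergent_iff (f := halfAmp s ψ) (-x)).2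
      (h'.integrable_halfAmp hs)
  simp only [Real.fourierInv_eq_fourier_neg, Pi.sub_apply, Real.fourier_eq]
  rw [← Complex.sub_re, ← integral_sub e1 e2]
  simp [smul_sub]

theorem enorm_fourierInv_le {f : Euc m → ℂ} (x : Euc m) : ‖𝓕⁻ f x‖ₑ ≤ eLpNorm f 1 volume := by
  rw [eLpNorm_one_eq_lintegral_enorm, Real.fourierInv_eq]
  refine (enorm_integral_le_lintegral_enorm _).trans (le_of_eq ?_)
  congr 1
  ext v
  rw [← ofReal_norm, ← ofReal_norm, Circle.norm_smul]

/-- The constant in the duality estimate: the summand `1` accounts for the frequencies `|ξ| ≥ 1`,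
where `|2πξ|^{-s} ≤ 1`, and the `L²` norm of `|2πξ|^{-s}` on the unit ball for the low
frequencies. -/
noncomputable def dualityConst (m : ℕ) (s : ℝ) : ENNReal :=
  1 + eLpNorm ((Metric.ball (0 : Euc m) 1).indicator fun ξ => (2 * Real.pi * ‖ξ‖) ^ (-s)) 2 volume

theorem nontrivial_euc (hm : 0 < m) : Nontrivial (Euc m) := by
  have : Nonempty (Fin m) := ⟨⟨0, hm⟩⟩
  infer_instance

/-- The negative power `|2πξ|^{-s}` is locally square integrable since `2s < m`. -/
theorem dualityConst_ne_top (hs : s ∈ Set.Ioo (0 : ℝ) 1) (hm : 2 * s < m) :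
    dualityConst m s ≠ ⊤ := by
  have hm0 : 0 < m := by
    have : (0 : ℝ) < m := by linarith [hs.1]
    exact_mod_cast this
  have := nontrivial_euc hm0
  refine ENNReal.add_ne_top.2 ⟨ENNReal.one_ne_top, ?_⟩
  have hmeas : Measurable (fun ξ : Euc m => (2 * Real.pi * ‖ξ‖) ^ (-s)) := by fun_prop
  refine (MemLp.eLpNorm_lt_top (f := _) ?_).ne
  rw [memLp_indicator_iff_restrict measurableSet_ball,
    memLp_two_iff_integrable_sq hmeas.aestronglyMeasurable]
  have h := integrableOn_norm_rpow_ball (volume : Measure (Euc m)) (p := -(2 * s))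
    (by simpa using hm) 1
  refine (h.const_mul ((2 * Real.pi) ^ (-(2 * s)))).congr ?_
  filter_upwards with ξ
  rw [Real.mul_rpow (by positivity) (norm_nonneg _), mul_pow, ← Real.rpow_natCast,
    ← Real.rpow_natCast, ← Real.rpow_mul (by positivity), ← Real.rpow_mul (norm_nonneg _)]
  congr 2 <;> push_cast <;> ring

/-- The negative half Laplacian maps `L¹ ∩ L²` to `L²`: at frequencies `|ξ| < 1` the Fourier
transform is bounded by the `L¹` norm, at the others Plancherel's identity applies. -/
theorem eLpNorm_riesz_le (hs : s ∈ Set.Ioo (0 : ℝ) 1) {f : Euc m → ℂ}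
    (h1 : Integrable f) (h2 : MemLp f 2 volume) :
    eLpNorm (fun ξ => (((2 * Real.pi * ‖ξ‖) ^ (-s) : ℝ) : ℂ) * 𝓕⁻ f ξ) 2 volume ≤
      dualityConst m s * (eLpNorm f 1 volume + eLpNorm f 2 volume) := by
  set w : Euc m → ℝ := (Metric.ball (0 : Euc m) 1).indicator fun ξ => (2 * Real.pi * ‖ξ‖) ^ (-s)
  have hmeas : Measurable (fun ξ : Euc m => (2 * Real.pi * ‖ξ‖) ^ (-s)) := by fun_prop
  have hw : Measurable w := hmeas.indicator measurableSet_ball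
  have htop : eLpNorm f 1 volume ≠ ⊤ := (memLp_one_iff_integrable.2 h1).2.ne
  set c : ℝ := (eLpNorm f 1 volume).toReal
  have hle : ∀ ξ, ‖𝓕⁻ f ξ‖ ≤ c := fun ξ => by
    rw [← toReal_enorm]
    exact ENNReal.toReal_mono htop (enorm_fourierInv_le ξ)
  have hpt : ∀ ξ, ‖(((2 * Real.pi * ‖ξ‖) ^ (-s) : ℝ) : ℂ) * 𝓕⁻ f ξ‖ ≤
      ‖c * w ξ + ‖𝓕⁻ f ξ‖‖ := by
    intro ξ
    have hw0 : 0 ≤ w ξ := Set.indicator_nonneg (fun _ _ => by positivity) _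
    have hc0 : 0 ≤ c := ENNReal.toReal_nonneg
    rw [norm_mul, Complex.norm_real, Real.norm_of_nonneg (by positivity),
      Real.norm_of_nonneg (by positivity)]
    by_cases hξ : ξ ∈ Metric.ball (0 : Euc m) 1
    · have e : w ξ = (2 * Real.pi * ‖ξ‖) ^ (-s) := Set.indicator_of_mem hξ _
      rw [e, mul_comm]
      have := mul_le_mul_of_nonneg_right (hle ξ) (e ▸ hw0)
      linarith [norm_nonneg (𝓕⁻ f ξ)]
    · have h1 : 1 ≤ ‖ξ‖ := by simpa using hξ
      have h2 : (2 * Real.pi * ‖ξ‖) ^ (-s) ≤ 1 := by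
        apply Real.rpow_le_one_of_one_le_of_nonpos _ (by linarith [hs.1])
        nlinarith [Real.pi_gt_three]
      have := mul_le_mul_of_nonneg_right h2 (norm_nonneg (𝓕⁻ f ξ))
      have := mul_nonneg hc0 hw0
      linarith
  calc _ ≤ eLpNorm (fun ξ => c * w ξ + ‖𝓕⁻ f ξ‖) 2 volume := eLpNorm_mono hpt
    _ ≤ eLpNorm (fun ξ => c * w ξ) 2 volume + eLpNorm (fun ξ => ‖𝓕⁻ f ξ‖) 2 volume :=
        eLpNorm_add_le (hw.const_mul c).aestronglyMeasurable
          (continuous_fourierInv h1).norm.aestronglyMeasurable (by norm_num)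
    _ = eLpNorm f 1 volume * eLpNorm w 2 volume + eLpNorm f 2 volume := by
        rw [eLpNorm_norm, eLpNorm_fourierInv h1 h2]
        congr 1
        have := eLpNorm_const_smul c w 2 (volume : Measure (Euc m))
        simp only [Pi.smul_def, smul_eq_mul] at this
        rw [this, Real.enorm_eq_ofReal ENNReal.toReal_nonneg, ENNReal.ofReal_toReal htop]
    _ ≤ _ := by
        unfold dualityConst
        rw [add_mul, one_mul, mul_add, add_comm]
        gcongr
        · exact self_le_add_left _ _
        · rw [mul_comm]; exact self_le_add_right _ _

/-- The pairing of a test function with `h ∈ L¹ ∩ L²` is controlled by the `𝓓^s` norm: on the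
Fourier side, write `1 = |2πξ|^s |2πξ|^{-s}`. -/
theorem enorm_integral_mul_le (hs : s ∈ Set.Ioo (0 : ℝ) 1) {φ : Euc m → ℝ} (hφ : IsTest φ)
    (hm : 0 < m) {h : Euc m → ℝ} (h1 : Integrable h) (h2 : MemLp h 2 volume) :
    ‖∫ x, φ x * h x‖ₑ ≤ dualityConst m s * (eLpNorm h 1 volume + eLpNorm h 2 volume) *
      eLpNorm (fracLaplacian (s / 2) φ) 2 volume := by
  have := nontrivial_euc hm
  set H : Euc m → ℂ := fun x => (h x : ℂ)
  have H1 : Integrable H := h1.ofReal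
  have H2 : MemLp H 2 volume := h2.ofReal
  have hfin : Integrable (specHat φ) := by
    simpa using hφ.integrable_mul_specHat (b := fun _ => 1) (C := 1) (k := 0)
      aestronglyMeasurable_const (by simp)
  have e1 : ((∫ x, φ x * h x : ℝ) : ℂ) = ∫ ξ, specHat φ ξ * 𝓕⁻ H ξ := by
    rw [← integral_fourierInv_mul_flip hfin H1, ← integral_complex_ofReal]
    congr 1
    ext x
    rw [hφ.fourierInv_specHat]
    simp [H]
  have e2 : ∫ ξ, specHat φ ξ * 𝓕⁻ H ξ =
      ∫ ξ, halfAmp s φ ξ * ((((2 * Real.pi * ‖ξ‖) ^ (-s) : ℝ) : ℂ) * 𝓕⁻ H ξ) := by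
    apply integral_congr_ae
    have : ∀ᵐ ξ : Euc m, ξ ≠ 0 := by
      simp [ae_iff]
    filter_upwards [this] with ξ hξ
    have hpos : 0 < 2 * Real.pi * ‖ξ‖ := by positivity
    have : ((((2 * Real.pi * ‖ξ‖) ^ s : ℝ) : ℂ)) * (((2 * Real.pi * ‖ξ‖) ^ (-s) : ℝ) : ℂ) = 1 := by
      rw [← Complex.ofReal_mul, ← Real.rpow_add hpos]; simp
    rw [halfAmp]
    linear_combination (-(specHat φ ξ * 𝓕⁻ H ξ)) * this
  have e3 : ‖∫ x, φ x * h x‖ₑ = ‖((∫ x, φ x * h x : ℝ) : ℂ)‖ₑ := by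
    rw [← ofReal_norm, ← ofReal_norm, Complex.norm_real]
  have n1 : eLpNorm H 1 volume = eLpNorm h 1 volume :=
    eLpNorm_congr_norm_ae (by filter_upwards with x; simp [H])
  have n2 : eLpNorm H 2 volume = eLpNorm h 2 volume :=
    eLpNorm_congr_norm_ae (by filter_upwards with x; simp [H])
  have hmeas : Measurable (fun ξ : Euc m => (((2 * Real.pi * ‖ξ‖) ^ (-s) : ℝ) : ℂ)) := by fun_prop
  rw [e3, e1, e2, hφ.eLpNorm_fracLaplacian hs, ← n1, ← n2]
  calc _ ≤ ∫⁻ ξ, ‖halfAmp s φ ξ * ((((2 * Real.pi * ‖ξ‖) ^ (-s) : ℝ) : ℂ) * 𝓕⁻ H ξ)‖ₑ :=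
        enorm_integral_le_lintegral_enorm _
    _ = ∫⁻ ξ, ‖halfAmp s φ ξ‖ₑ * ‖(((2 * Real.pi * ‖ξ‖) ^ (-s) : ℝ) : ℂ) * 𝓕⁻ H ξ‖ₑ := by
        simp only [enorm_mul]
    _ ≤ eLpNorm (halfAmp s φ) 2 volume *
          eLpNorm (fun ξ => (((2 * Real.pi * ‖ξ‖) ^ (-s) : ℝ) : ℂ) * 𝓕⁻ H ξ) 2 volume :=
        lintegral_enorm_mul_le_eLpNorm_two (hφ.integrable_halfAmp hs).1
          (hmeas.aestronglyMeasurable.mul (continuous_fourierInv H1).aestronglyMeasurable)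
    _ ≤ _ := by
        rw [mul_comm]
        gcongr
        exact eLpNorm_riesz_le hs H1 H2

/-- The duality estimate `∫ |φ| |w| ≤ C ‖(-Δ)^{s/2} φ‖_{L²}` for a weight `w ∈ L¹ ∩ L²`. -/
theorem IsTest.lintegral_mul_le (hs : s ∈ Set.Ioo (0 : ℝ) 1) {φ : Euc m → ℝ} (hφ : IsTest φ)
    (hm : 0 < m) {w : Euc m → ℝ} (h1 : Integrable w) (h2 : MemLp w 2 volume) :
    ∫⁻ x, ‖φ x‖ₑ * ‖w x‖ₑ ≤ dualityConst m s * (eLpNorm w 1 volume + eLpNorm w 2 volume) *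
      eLpNorm (fracLaplacian (s / 2) φ) 2 volume := by
  classical
  -- testing against `sign(φ) |w|` turns the integral of `φ` into that of `|φ|`
  set h : Euc m → ℝ := {x | 0 ≤ φ x}.piecewise (fun x => ‖w x‖) (fun x => -‖w x‖) with hdef
  have hms : MeasurableSet {x | 0 ≤ φ x} :=
    (isClosed_le continuous_const hφ.continuous).measurableSet
  have hmeas : AEStronglyMeasurable h volume :=
    AEStronglyMeasurable.piecewise hms h1.1.norm.restrict h1.1.norm.neg.restrict
  have hn : ∀ x, ‖h x‖ = ‖w x‖ := fun x => by
    by_cases hx : 0 ≤ φ x <;> simp [hdef, hx]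
  have hh1 : Integrable h := h1.mono hmeas (Eventually.of_forall fun x => (hn x).le)
  have hh2 : MemLp h 2 volume := h2.mono hmeas (Eventually.of_forall fun x => (hn x).le)
  have key := enorm_integral_mul_le hs hφ hm hh1 hh2
  rw [eLpNorm_congr_norm_ae (Eventually.of_forall hn : ∀ᵐ x, ‖h x‖ = ‖w x‖),
    eLpNorm_congr_norm_ae (Eventually.of_forall hn : ∀ᵐ x, ‖h x‖ = ‖w x‖)] at key
  refine le_trans (le_of_eq ?_) key
  have e : ∀ x, φ x * h x = ‖φ x * w x‖ := fun x => by
    by_cases hx : 0 ≤ φ x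
    · simp [hdef, hx, abs_of_nonneg hx]
    · simp [hdef, hx, abs_of_neg (not_le.1 hx)]
  have hint : Integrable (fun x => φ x * w x) := (hφ.memLp 2).integrable_mul h2
  simp only [e]
  rw [Real.enorm_of_nonneg (integral_nonneg fun x => norm_nonneg _),
    ofReal_integral_norm_eq_lintegral_enorm hint]
  simp only [enorm_mul]

theorem TendstoDs.sub {φ ψ : ℕ → Euc m → ℝ} {u v g h : Euc m → ℝ} (H : TendstoDs s φ u g)
    (H' : TendstoDs s ψ v h) (hs : s ∈ Set.Ioo (0 : ℝ) 1) :
    TendstoDs s (fun k => φ k - ψ k) (u - v) (g - h) where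
  test k := (H.test k).sub (H'.test k)
  locInt := H.locInt.sub H'.locInt
  tendsto_fun := H.tendsto_fun.sub H'.tendsto_fun
    (fun k => (H.test k).continuous.aestronglyMeasurable) H.locInt.aestronglyMeasurable
  memLp := H.memLp.sub H'.memLp
  tendsto_energy := by
    have h1 := H.tendsto_energy.add H'.tendsto_energy
    rw [add_zero] at h1
    refine tendsto_of_tendsto_of_tendsto_of_le_of_le tendsto_const_nhds h1 (fun _ => zero_le) ?_
    intro k
    have e : fracLaplacian (s / 2) (φ k - ψ k) - (g - h) =
        (fracLaplacian (s / 2) (φ k) - g) - (fracLaplacian (s / 2) (ψ k) - h) := by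
      rw [fracLaplacian_sub (H.test k) (H'.test k) hs]
      abel
    simp only [e]
    exact eLpNorm_sub_le (((H.test k).memLp_fracLaplacian hs).sub H.memLp).1
      (((H'.test k).memLp_fracLaplacian hs).sub H'.memLp).1 (by norm_num)

/-- The duality estimate for elements of `𝓓^s`. -/
theorem TendstoDs.lintegral_mul_le {φ : ℕ → Euc m → ℝ} {u g : Euc m → ℝ} (H : TendstoDs s φ u g)
    (hs : s ∈ Set.Ioo (0 : ℝ) 1) (hm : 2 * s < m) {w : Euc m → ℝ} (h1 : Integrable w)
    (h2 : MemLp w 2 volume) :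
    ∫⁻ x, ‖u x‖ₑ * ‖w x‖ₑ ≤ dualityConst m s * (eLpNorm w 1 volume + eLpNorm w 2 volume) *
      eLpNorm g 2 volume := by
  have hm0 : 0 < m := by
    have : (0 : ℝ) < m := by linarith [hs.1]
    exact_mod_cast this
  refine H.tendsto_fun.lintegral_mul_le (fun k => (H.test k).continuous.aestronglyMeasurable)
    H.locInt.aestronglyMeasurable h1.1.enorm (B := fun k => dualityConst m s *
      (eLpNorm w 1 volume + eLpNorm w 2 volume) *
      (eLpNorm (fracLaplacian (s / 2) (φ k) - g) 2 volume + eLpNorm g 2 volume)) ?_ ?_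
  · intro k
    refine ((H.test k).lintegral_mul_le hs hm0 h1 h2).trans ?_
    gcongr
    calc _ = eLpNorm ((fracLaplacian (s / 2) (φ k) - g) + g) 2 volume := by rw [sub_add_cancel]
      _ ≤ _ := eLpNorm_add_le (((H.test k).memLp_fracLaplacian hs).sub H.memLp).1 H.memLp.1
        (by norm_num)
  · have h := (H.tendsto_energy.add_const (eLpNorm g 2 volume))
    rw [zero_add] at h
    refine ENNReal.Tendsto.const_mul h (Or.inr ?_)
    exact ENNReal.mul_ne_top (dualityConst_ne_top hs hm)
      (ENNReal.add_ne_top.2 ⟨(memLp_one_iff_integrable.2 h1).2.ne, h2.2.ne⟩)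

end HalfLaplacian

/-! ### The radial profile -/

section Profile

/-- The integral `∫_0^∞ τ^{s-1} e^{-τ - q/(4τ)} dτ`, a modified Bessel function of `√q` up to a
power. -/
noncomputable def besselIntegral (s q : ℝ) : ℝ :=
  ∫ τ in Set.Ioi (0 : ℝ), τ ^ (s - 1) * Real.exp (-τ - q / (4 * τ))

/-- The profile `θ_s(q)`, normalized by `θ_s(0) = 1`. The Fourier transform in `x` of the Poisson
kernel is `θ_s((2π|ξ||y|)²)`. -/
noncomputable def profile (s q : ℝ) : ℝ := (Real.Gamma s)⁻¹ * besselIntegral s q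

/-- The constant `2^{1-2s} Γ(1-s)/Γ(s)` of the Dirichlet-to-Neumann map. -/
noncomputable def dtnConst (s : ℝ) : ℝ := 2 ^ (1 - 2 * s) * Real.Gamma (1 - s) / Real.Gamma s

variable {s : ℝ}

theorem integrableOn_gamma (hs : 0 < s) :
    IntegrableOn (fun τ : ℝ => τ ^ (s - 1) * Real.exp (-τ)) (Set.Ioi 0) :=
  (Real.GammaIntegral_convergent hs).congr_fun (fun _ _ => mul_comm _ _) measurableSet_Ioi

theorem aestronglyMeasurable_besselIntegrand (p q : ℝ) :
    AEStronglyMeasurable (fun τ : ℝ => τ ^ p * Real.exp (-τ - q / (4 * τ)))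
      (volume.restrict (Set.Ioi 0)) := by
  have : Measurable (fun τ : ℝ => τ ^ p * Real.exp (-τ - q / (4 * τ))) := by fun_prop
  exact this.aestronglyMeasurable

theorem besselIntegrand_le {q τ : ℝ} (hq : 0 ≤ q) (hτ : 0 < τ) (p : ℝ) :
    ‖τ ^ p * Real.exp (-τ - q / (4 * τ))‖ ≤ τ ^ p * Real.exp (-τ) := by
  rw [Real.norm_of_nonneg (by positivity)]
  gcongr
  have : 0 ≤ q / (4 * τ) := by positivity
  linarith

theorem integrableOn_besselIntegrand (hs : 0 < s) {q : ℝ} (hq : 0 ≤ q) :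
    IntegrableOn (fun τ : ℝ => τ ^ (s - 1) * Real.exp (-τ - q / (4 * τ))) (Set.Ioi 0) := by
  refine (integrableOn_gamma hs).mono' (aestronglyMeasurable_besselIntegrand _ _) ?_
  filter_upwards [ae_restrict_mem measurableSet_Ioi] with τ hτ
  exact besselIntegrand_le hq hτ _

theorem besselIntegral_zero (hs : 0 < s) : besselIntegral s 0 = Real.Gamma s := by
  rw [besselIntegral, Real.Gamma_eq_integral hs]
  simp [mul_comm]

theorem besselIntegral_nonneg (q : ℝ) : 0 ≤ besselIntegral s q :=
  setIntegral_nonneg measurableSet_Ioi fun τ hτ => by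
    have : (0 : ℝ) < τ := hτ
    positivity

theorem besselIntegral_antitone (hs : 0 < s) {q q' : ℝ} (hq : 0 ≤ q) (h : q ≤ q') :
    besselIntegral s q' ≤ besselIntegral s q := by
  refine setIntegral_mono_on (integrableOn_besselIntegrand hs (hq.trans h))
    (integrableOn_besselIntegrand hs hq) measurableSet_Ioi fun τ hτ => ?_
  have : (0 : ℝ) < τ := hτ
  gcongr

theorem continuousOn_besselIntegral (hs : 0 < s) : ContinuousOn (besselIntegral s) (Set.Ici 0) := by
  refine continuousOn_of_dominated (bound := fun τ => τ ^ (s - 1) * Real.exp (-τ))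
    (fun q _ => aestronglyMeasurable_besselIntegrand _ q) (fun q hq => ?_)
        (integrableOn_gamma hs) ?_
  · filter_upwards [ae_restrict_mem measurableSet_Ioi] with τ hτ
    exact besselIntegrand_le hq hτ _
  · filter_upwards with τ
    fun_prop

theorem tendsto_besselIntegral (hs : 0 < s) : Tendsto (besselIntegral s) atTop (𝓝 0) := by
  have h : Tendsto (besselIntegral s) atTop (𝓝 (∫ _τ in Set.Ioi (0 : ℝ), (0 : ℝ))) := by
    refine tendsto_integral_filter_of_dominated_convergence
      (fun τ => τ ^ (s - 1) * Real.exp (-τ))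
      (Eventually.of_forall fun q => aestronglyMeasurable_besselIntegrand _ q) ?_
      (integrableOn_gamma hs) ?_
    · filter_upwards [eventually_ge_atTop 0] with q hq
      filter_upwards [ae_restrict_mem measurableSet_Ioi] with τ hτ
      exact besselIntegrand_le hq hτ _
    · filter_upwards [ae_restrict_mem measurableSet_Ioi] with τ hτ
      have hτ' : (0 : ℝ) < 4 * τ := by have : (0 : ℝ) < τ := hτ; positivity
      have h1 : Tendsto (fun q : ℝ => -τ - q / (4 * τ)) atTop atBot := by
        have := (tendsto_id.atTop_div_const hτ' : Tendsto (fun q : ℝ => q / (4 * τ)) atTop atTop)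
        simpa [sub_eq_add_neg] using tendsto_atBot_add_const_left _ (-τ)
            (tendsto_neg_atTop_atBot.comp this)
      simpa using (Real.tendsto_exp_atBot.comp h1).const_mul (τ ^ (s - 1))
  simpa using h

/-- The inversion `τ ↦ q/(4τ)` exchanges the orders `s - 1` and `1 - s`. -/
theorem integral_bessel_inversion {q : ℝ} (hq : 0 < q) :
    ∫ τ in Set.Ioi (0 : ℝ), τ ^ (s - 2) * Real.exp (-τ - q / (4 * τ)) =
      (q / 4) ^ (s - 1) * besselIntegral (1 - s) q := by
  have hc : 0 < q / 4 := by positivity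
  set g : ℝ → ℝ := fun τ => τ ^ (s - 2) * Real.exp (-τ - q / (4 * τ)) with hg
  have h1 := integral_comp_mul_left_Ioi g 0 hc
  have h2 := integral_comp_rpow_Ioi (fun x => g (q / 4 * x)) (p := -1) (by norm_num)
  rw [mul_zero] at h1
  have h3 : ∫ τ in Set.Ioi (0 : ℝ), g τ = q / 4 * ∫ x in Set.Ioi (0 : ℝ), g (q / 4 * x) := by
    rw [h1, smul_eq_mul, mul_inv_cancel_left₀ hc.ne']
  rw [h3, ← h2, besselIntegral, ← integral_const_mul, ← integral_const_mul]
  refine setIntegral_congr_fun measurableSet_Ioi fun τ hτ => ?_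
  have hτ' : (0 : ℝ) < τ := hτ
  have e1 : q / 4 * τ ^ (-1 : ℝ) = q / 4 / τ := by rw [Real.rpow_neg_one]; rfl
  simp only [hg, e1, smul_eq_mul, abs_neg, abs_one, one_mul]
  have e2 : -(q / 4 / τ) - q / (4 * (q / 4 / τ)) = -τ - q / (4 * τ) := by
    field_simp; ring
  rw [e2, Real.div_rpow hc.le hτ'.le]
  have e3 : (q / 4) * (q / 4) ^ (s - 2) = (q / 4) ^ (s - 1) := by
    rw [show s - 1 = 1 + (s - 2) by ring, Real.rpow_add hc, Real.rpow_one]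
  have e4 : τ ^ (-1 - 1 : ℝ) / τ ^ (s - 2) = τ ^ (1 - s - 1) := by
    rw [← Real.rpow_sub hτ']; congr 1; ring
  rw [← e3, ← e4]
  ring

/-- Differentiating under the integral sign lowers the exponent `s - 1` by one; the inversion of
`integral_bessel_inversion` then expresses the result by the Bessel integral of order `1 - s`. -/
theorem hasDerivAt_besselIntegral (hs : 0 < s) {q : ℝ} (hq : 0 < q) :
    HasDerivAt (besselIntegral s)
        (-(1 / 4) * ((q / 4) ^ (s - 1) * besselIntegral (1 - s) q)) q := by
  have hmem : Set.Ioi (q / 2) ∈ 𝓝 q := Ioi_mem_nhds (by linarith)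
  have key := hasDerivAt_integral_of_dominated_loc_of_deriv_le
    (μ := volume.restrict (Set.Ioi (0 : ℝ)))
    (F := fun q τ => τ ^ (s - 1) * Real.exp (-τ - q / (4 * τ)))
    (F' := fun q τ => τ ^ (s - 1) * (Real.exp (-τ - q / (4 * τ)) * (-(1 / (4 * τ)))))
    (bound := fun τ => 2 / q * (τ ^ (s - 1) * Real.exp (-τ)))
    (x₀ := q) hmem (Eventually.of_forall fun q => aestronglyMeasurable_besselIntegrand _ q)
    (integrableOn_besselIntegrand hs hq.le) ?_ ?_ ((integrableOn_gamma hs).const_mul _) ?_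
  · have e : ∫ τ in Set.Ioi (0 : ℝ),
        τ ^ (s - 1) * (Real.exp (-τ - q / (4 * τ)) * (-(1 / (4 * τ)))) =
        -(1 / 4) * ((q / 4) ^ (s - 1) * besselIntegral (1 - s) q) := by
      rw [← integral_bessel_inversion hq, ← integral_const_mul]
      refine setIntegral_congr_fun measurableSet_Ioi fun τ hτ => ?_
      have hτ' : (0 : ℝ) < τ := hτ
      have : τ ^ (s - 1) = τ ^ (s - 2) * τ := by
        rw [show s - 1 = s - 2 + 1 by ring, Real.rpow_add_one hτ'.ne']
      simp only [this]
      field_simp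
    rw [← e]
    exact key.2
  · have : Measurable (fun τ : ℝ => τ ^ (s - 1) *
        (Real.exp (-τ - q / (4 * τ)) * (-(1 / (4 * τ))))) := by
      fun_prop
    exact this.aestronglyMeasurable
  · filter_upwards [ae_restrict_mem measurableSet_Ioi] with τ hτ p hp
    have hτ' : (0 : ℝ) < τ := hτ
    have hp' : q / 2 < p := hp
    have hp0 : 0 < p := by linarith
    -- `x e^{-x} ≤ 1` with `x = p/(4τ)`
    have hx : (p / (4 * τ)) * Real.exp (-(p / (4 * τ))) ≤ 1 := by
      have := Real.add_one_le_exp (p / (4 * τ))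
      rw [Real.exp_neg, ← div_eq_mul_inv, div_le_one (Real.exp_pos _)]
      linarith
    rw [Real.norm_eq_abs, abs_mul, abs_mul, abs_neg, abs_of_nonneg (by positivity),
      abs_of_nonneg (Real.exp_pos _).le,
          abs_of_nonneg (by positivity), sub_eq_add_neg (-τ), Real.exp_add]
    have h2 : Real.exp (-(p / (4 * τ))) * (1 / (4 * τ)) ≤ 2 / q := by
      have h3 : Real.exp (-(p / (4 * τ))) * (1 / (4 * τ)) =
          (p / (4 * τ)) * Real.exp (-(p / (4 * τ))) * (1 / p) := by field_simp
      rw [h3]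
      calc _ ≤ 1 * (1 / p) := by gcongr
        _ ≤ 2 / q := by rw [one_mul, div_le_div_iff₀ hp0 hq]; linarith
    calc τ ^ (s - 1) * (Real.exp (-τ) * Real.exp (-(p / (4 * τ))) * (1 / (4 * τ)))
        = τ ^ (s - 1) * Real.exp (-τ) * (Real.exp (-(p / (4 * τ))) * (1 / (4 * τ))) := by ring
      _ ≤ τ ^ (s - 1) * Real.exp (-τ) * (2 / q) := by gcongr
      _ = _ := by ring
  · filter_upwards [ae_restrict_mem measurableSet_Ioi] with τ hτ p hp
    have hd : HasDerivAt (fun p : ℝ => -τ - p / (4 * τ)) (-(1 / (4 * τ))) p := by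
      simpa using ((hasDerivAt_id p).div_const (4 * τ)).const_sub (-τ)
    exact (hd.exp).const_mul _

theorem profile_zero (hs : 0 < s) : profile s 0 = 1 := by
  rw [profile, besselIntegral_zero hs, inv_mul_cancel₀ (Real.Gamma_pos_of_pos hs).ne']

theorem profile_nonneg (hs : 0 < s) (q : ℝ) : 0 ≤ profile s q :=
  mul_nonneg (inv_nonneg.2 (Real.Gamma_pos_of_pos hs).le) (besselIntegral_nonneg q)

theorem profile_antitone (hs : 0 < s) {q q' : ℝ} (hq : 0 ≤ q) (h : q ≤ q') :
    profile s q' ≤ profile s q :=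
  mul_le_mul_of_nonneg_left (besselIntegral_antitone hs hq h)
    (inv_nonneg.2 (Real.Gamma_pos_of_pos hs).le)

theorem profile_le_one (hs : 0 < s) {q : ℝ} (hq : 0 ≤ q) : profile s q ≤ 1 :=
  profile_zero hs ▸ profile_antitone hs le_rfl hq

theorem continuousOn_profile (hs : 0 < s) : ContinuousOn (profile s) (Set.Ici 0) :=
  (continuousOn_besselIntegral hs).const_smul (Real.Gamma s)⁻¹

theorem tendsto_profile (hs : 0 < s) : Tendsto (profile s) atTop (𝓝 0) := by
  rw [← mul_zero (Real.Gamma s)⁻¹]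
  exact (tendsto_besselIntegral hs).const_mul (Real.Gamma s)⁻¹

theorem continuous_profile_sq (hs : 0 < s) : Continuous (fun t : ℝ => profile s (t ^ 2)) :=
  (continuousOn_profile hs).comp_continuous (by fun_prop) fun t => sq_nonneg t

theorem dtnConst_pos (hs : s ∈ Set.Ioo (0 : ℝ) 1) : 0 < dtnConst s := by
  have h1 := Real.Gamma_pos_of_pos hs.1
  have h2 := Real.Gamma_pos_of_pos (sub_pos.2 hs.2)
  unfold dtnConst
  positivity

/-- The constants of the derivative formulas at `s` and at `1 - s` cancel, which makes the profile a
solution of the differential equation in `hasDerivAt_profileFlux`. -/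
theorem dtnConst_mul (hs : s ∈ Set.Ioo (0 : ℝ) 1) : dtnConst s * dtnConst (1 - s) = 1 := by
  have h1 := (Real.Gamma_pos_of_pos hs.1).ne'
  have h2 := (Real.Gamma_pos_of_pos (sub_pos.2 hs.2)).ne'
  unfold dtnConst
  rw [sub_sub_cancel]
  have : (2 : ℝ) ^ (1 - 2 * s) * 2 ^ (1 - 2 * (1 - s)) = 1 := by
    rw [← Real.rpow_add two_pos, show 1 - 2 * s + (1 - 2 * (1 - s)) = 0 by ring, Real.rpow_zero]
  field_simp
  linear_combination this

/-- The radial derivative of `r ↦ θ_s((l r)²)`, a multiple of `θ_{1-s}` (see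
`hasDerivAt_profile`). -/
noncomputable def profileDeriv (s l r : ℝ) : ℝ :=
  -(dtnConst s * l ^ (2 * s) * r ^ (2 * s - 1) * profile (1 - s) ((l * r) ^ 2))

/-- The flux `r^{1-2s} ∂_r θ_s((l r)²)`, extended continuously to `r = 0`: a multiple of
`θ_{1-s}((l r)²)`. -/
noncomputable def profileFlux (s l r : ℝ) : ℝ :=
  -(dtnConst s * l ^ (2 * s) * profile (1 - s) ((l * r) ^ 2))

theorem profileDeriv_eq (l r : ℝ) : profileDeriv s l r = r ^ (2 * s - 1) * profileFlux s l r := by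
  unfold profileDeriv profileFlux; ring

theorem hasDerivAt_profile (hs : s ∈ Set.Ioo (0 : ℝ) 1) {l r : ℝ} (hl : 0 ≤ l) (hr : 0 < r) :
    HasDerivAt (fun r => profile s ((l * r) ^ 2)) (profileDeriv s l r) r := by
  -- at frequency `0` the profile is constant
  rcases hl.eq_or_lt with rfl | hl
  · have : profileDeriv s 0 r = 0 := by
      unfold profileDeriv
      rw [Real.zero_rpow (by linarith [hs.1])]; ring
    simpa [this] using hasDerivAt_const r (profile s 0)
  have hq : 0 < (l * r) ^ 2 := by positivity
  have h1 := (hasDerivAt_besselIntegral hs.1 hq).const_mul (Real.Gamma s)⁻¹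
  have h2 : HasDerivAt (fun r : ℝ => (l * r) ^ 2) (2 * (l * r) * l) r := by
    have := ((hasDerivAt_id r).const_mul l).fun_pow 2
    simpa using this
  have h3 := h1.comp r h2
  refine h3.congr_deriv ?_
  have g1 := (Real.Gamma_pos_of_pos hs.1).ne'
  have g2 := (Real.Gamma_pos_of_pos (sub_pos.2 hs.2)).ne'
  have e1 : ((l * r) ^ 2 / 4) ^ (s - 1) =
      l ^ (2 * s) / l ^ 2 * (r ^ (2 * s - 1) / r) * (4 / 2 ^ (2 * s)) := by
    rw [show (l * r) ^ 2 / 4 = (l * r / 2) ^ (2 : ℝ) by norm_cast; ring,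
      ← Real.rpow_mul (by positivity), Real.div_rpow (by positivity) (by norm_num),
      Real.mul_rpow hl.le hr.le, show 2 * (s - 1) = 2 * s - (2 : ℕ) by push_cast; ring,
      Real.rpow_sub_natCast hl.ne', Real.rpow_sub_natCast hr.ne',
      Real.rpow_sub_natCast two_ne_zero, Real.rpow_sub_one hr.ne']
    field_simp
    norm_num
  have e2 : (2 : ℝ) ^ (1 - 2 * s) = 2 / 2 ^ (2 * s) := by
    rw [Real.rpow_sub two_pos, Real.rpow_one]
  simp only [profileDeriv, profile, dtnConst, e1, e2]
  field_simp

/-- The equation of the profile in divergence form, `(r^{1-2s} h')' = l² r^{1-2s} h` for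
`h(r) = θ_s((l r)²)`. Since the flux is a multiple of `θ_{1-s}`, this is the derivative formula at
`1 - s`. -/
theorem hasDerivAt_profileFlux (hs : s ∈ Set.Ioo (0 : ℝ) 1) {l r : ℝ} (hl : 0 ≤ l) (hr : 0 < r) :
    HasDerivAt (profileFlux s l) (l ^ 2 * r ^ (1 - 2 * s) * profile s ((l * r) ^ 2)) r := by
  have hs' : 1 - s ∈ Set.Ioo (0 : ℝ) 1 := ⟨by linarith [hs.2], by linarith [hs.1]⟩
  have h := ((hasDerivAt_profile hs' hl hr).const_mul (dtnConst s * l ^ (2 * s))).neg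
  refine h.congr_deriv ?_
  have e1 : l ^ (2 * s) * l ^ (2 * (1 - s)) = l ^ 2 := by
    rw [← Real.rpow_add_of_nonneg hl (by linarith [hs.1]) (by linarith [hs.2]), ← Real.rpow_natCast]
    congr 1
    push_cast; ring
  have e2 : 2 * (1 - s) - 1 = 1 - 2 * s := by ring
  simp only [profileDeriv, e2, sub_sub_cancel]
  linear_combination (r ^ (1 - 2 * s) * profile s ((l * r) ^ 2)) *
    (dtnConst s * dtnConst (1 - s) * e1 + l ^ 2 * dtnConst_mul hs)

theorem continuous_profileFlux (hs : s ∈ Set.Ioo (0 : ℝ) 1) (l : ℝ) :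
    Continuous (profileFlux s l) := by
  have := (continuous_profile_sq (s := 1 - s) (by linarith [hs.2])).comp (continuous_const_mul l)
  exact (this.const_smul (dtnConst s * l ^ (2 * s))).neg

theorem profileFlux_zero (hs : s ∈ Set.Ioo (0 : ℝ) 1) (l : ℝ) :
    profileFlux s l 0 = -(dtnConst s * l ^ (2 * s)) := by
  simp [profileFlux, profile_zero (sub_pos.2 hs.2)]

theorem tendsto_profile_mul {p l : ℝ} (hp : 0 < p) (hl : 0 < l) :
    Tendsto (fun r => profile p ((l * r) ^ 2)) atTop (𝓝 0) := by
  refine (tendsto_profile hp).comp ?_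
  exact (tendsto_pow_atTop two_ne_zero).comp (tendsto_id.const_mul_atTop hl)

theorem hasDerivAt_flux_mul_profile (hs : s ∈ Set.Ioo (0 : ℝ) 1) {l r : ℝ} (hl : 0 ≤ l)
    (hr : 0 < r) :
    HasDerivAt (fun r => profileFlux s l r * profile s ((l * r) ^ 2))
      (r ^ (1 - 2 * s) * (l ^ 2 * profile s ((l * r) ^ 2) ^ 2 + profileDeriv s l r ^ 2)) r := by
  refine ((hasDerivAt_profileFlux hs hl hr).mul (hasDerivAt_profile hs hl hr)).congr_deriv ?_
  have e : r ^ (1 - 2 * s) * r ^ (2 * s - 1) = 1 := by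
    rw [← Real.rpow_add hr]; norm_num
  have e2 : profileFlux s l r = r ^ (1 - 2 * s) * profileDeriv s l r := by
    rw [profileDeriv_eq, ← mul_assoc, e, one_mul]
  rw [e2]
  ring

/-- The one-dimensional energy identity: integrate the derivative of flux times profile. -/
theorem integral_profile_energy (hs : s ∈ Set.Ioo (0 : ℝ) 1) {l : ℝ} (hl : 0 ≤ l) :
    IntegrableOn (fun r => r ^ (1 - 2 * s) *
      (l ^ 2 * profile s ((l * r) ^ 2) ^ 2 + profileDeriv s l r ^ 2)) (Set.Ioi 0) ∧
    ∫ r in Set.Ioi (0 : ℝ), r ^ (1 - 2 * s) *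
      (l ^ 2 * profile s ((l * r) ^ 2) ^ 2 + profileDeriv s l r ^ 2) =
          dtnConst s * l ^ (2 * s) := by
  rcases hl.eq_or_lt with rfl | hl'
  · have h0 : (0 : ℝ) ^ (2 * s) = 0 := Real.zero_rpow (by linarith [hs.1])
    have : ∀ r, profileDeriv s 0 r = 0 := fun r => by
      unfold profileDeriv; rw [h0]; ring
    simp [this, h0]
  have hc : Continuous (fun r => profileFlux s l r * profile s ((l * r) ^ 2)) :=
    (continuous_profileFlux hs l).mul ((continuous_profile_sq hs.1).comp (continuous_const_mul l))
  have hlim : Tendsto (fun r => profileFlux s l r * profile s ((l * r) ^ 2)) atTop (𝓝 0) := by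
    have h1 := ((tendsto_profile_mul (sub_pos.2 hs.2) hl').const_mul (dtnConst s * l ^ (2 * s))).neg
    have h2 := h1.mul (tendsto_profile_mul hs.1 hl')
    simpa [profileFlux] using h2
  have hd : ∀ r ∈ Set.Ioi (0 : ℝ), HasDerivAt (fun r => profileFlux s l r * profile s ((l * r) ^ 2))
      (r ^ (1 - 2 * s) * (l ^ 2 * profile s ((l * r) ^ 2) ^ 2 + profileDeriv s l r ^ 2)) r :=
    fun r hr => hasDerivAt_flux_mul_profile hs hl hr
  have hpos : ∀ r ∈ Set.Ioi (0 : ℝ), 0 ≤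
      r ^ (1 - 2 * s) * (l ^ 2 * profile s ((l * r) ^ 2) ^ 2 + profileDeriv s l r ^ 2) :=
    fun r hr => by have : (0 : ℝ) < r := hr; positivity
  refine ⟨integrableOn_Ioi_deriv_of_nonneg hc.continuousWithinAt hd hpos hlim, ?_⟩
  rw [integral_Ioi_of_hasDerivAt_of_nonneg hc.continuousWithinAt hd hpos hlim]
  simp [profileFlux_zero hs, profile_zero hs.1]

/-- The one-dimensional weak equation, obtained by integrating the derivative of flux times `η`; the
boundary term at `r = 0` is the value of the flux there. -/
theorem integral_profile_weak (hs : s ∈ Set.Ioo (0 : ℝ) 1) {l : ℝ} (hl : 0 ≤ l) {η : ℝ → ℝ}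
    (hη : ContDiff ℝ 1 η) (hc : HasCompactSupport η) :
    ∫ r in Set.Ioi (0 : ℝ), r ^ (1 - 2 * s) *
      (l ^ 2 * profile s ((l * r) ^ 2) * η r + profileDeriv s l r * deriv η r) =
      dtnConst s * l ^ (2 * s) * η 0 := by
  have hcf := continuous_profileFlux hs l
  have hcp : Continuous (fun r => profile s ((l * r) ^ 2)) :=
    (continuous_profile_sq hs.1).comp (continuous_const_mul l)
  have hd : ∀ r ∈ Set.Ioi (0 : ℝ), HasDerivAt (fun r => profileFlux s l r * η r)
      (l ^ 2 * r ^ (1 - 2 * s) * profile s ((l * r) ^ 2) * η r + profileFlux s l r * deriv η r) r :=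
    fun r hr => (hasDerivAt_profileFlux hs hl hr).mul
      ((hη.differentiable (by norm_num)) r).hasDerivAt
  have hη' : Continuous (deriv η) := hη.continuous_deriv (by norm_num)
  obtain ⟨R, hR, hsub⟩ := hc.isCompact.isBounded.subset_closedBall_lt 0 (0 : ℝ)
  have hzero : ∀ r, R < r → η r = 0 := fun r hr => by
    by_contra h
    have := hsub (subset_tsupport _ h)
    rw [mem_closedBall_zero_iff, Real.norm_eq_abs] at this
    linarith [le_abs_self r]
  have hint1 : IntegrableOn (fun r => l ^ 2 * r ^ (1 - 2 * s) * profile s ((l * r) ^ 2) * η r)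
      (Set.Ioi 0) := by
    have h0 : IntegrableOn (fun r : ℝ => r ^ (1 - 2 * s)) (Set.Ioo 0 (R + 1)) :=
      (intervalIntegral.integrableOn_Ioo_rpow_iff (by linarith)).2 (by linarith [hs.2])
    have h1 : IntegrableOn (fun r : ℝ => r ^ (1 - 2 * s) * (l ^ 2 * profile s ((l * r) ^ 2) * η r))
        (Set.Ioo 0 (R + 1)) := by
      obtain ⟨C, hC⟩ := (hcp.mul hη.continuous).bounded_above_of_compact_support hc.mul_left
      refine Integrable.mul_bdd (c := l ^ 2 * C) h0 ?_ ?_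
      · exact ((hcp.const_smul (l ^ 2)).mul hη.continuous).aestronglyMeasurable
      · filter_upwards with r
        rw [mul_assoc, norm_mul, Real.norm_of_nonneg (sq_nonneg l)]
        exact mul_le_mul_of_nonneg_left (hC r) (sq_nonneg l)
    refine (h1.of_forall_sdiff_eq_zero measurableSet_Ioi ?_).congr_fun (fun r _ =>
        by ring) measurableSet_Ioi
    intro r hr
    have : R < r := by
      by_contra hle
      exact hr.2 ⟨hr.1, by linarith [not_lt.1 hle]⟩
    simp [hzero r this]
  have hint2 : IntegrableOn (fun r => profileFlux s l r * deriv η r) (Set.Ioi 0) :=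
    ((hcf.mul hη').integrable_of_hasCompactSupport hc.deriv.mul_left).integrableOn
  have hlim : Tendsto (fun r => profileFlux s l r * η r) atTop (𝓝 0) := by
    refine tendsto_const_nhds.congr' ?_
    filter_upwards [eventually_gt_atTop R] with r hr
    simp [hzero r hr]
  have key := integral_Ioi_of_hasDerivAt_of_tendsto (hcf.mul hη.continuous).continuousWithinAt hd
    (hint1.add hint2) hlim
  rw [Pi.mul_apply, profileFlux_zero hs] at key
  rw [show dtnConst s * l ^ (2 * s) * η 0 = 0 - -(dtnConst s * l ^ (2 * s)) * η 0 by ring, ← key]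
  refine setIntegral_congr_fun measurableSet_Ioi fun r hr => ?_
  have hr' : (0 : ℝ) < r := hr
  have e : r ^ (1 - 2 * s) * r ^ (2 * s - 1) = 1 := by
    rw [← Real.rpow_add hr']; norm_num
  simp only [profileDeriv_eq]
  linear_combination (profileFlux s l r * deriv η r) * e

end Profile

/-! ### Weighted integrals in the normal variable -/

section Polar

/-- Integration in polar coordinates. -/
theorem integral_eq_integral_sphere {E : Type*} [NormedAddCommGroup E] [NormedSpace ℝ E]
    [FiniteDimensional ℝ E] [Nontrivial E] [MeasurableSpace E] [BorelSpace E] (μ : Measure E)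
    [μ.IsAddHaarMeasure] {f : E → ℝ} (hf : Integrable f μ) :
    ∫ x, f x ∂μ = ∫ e : Metric.sphere (0 : E) 1, (∫ r in Set.Ioi (0 : ℝ),
      r ^ (Module.finrank ℝ E - 1) * f (r • (e : E))) ∂μ.toSphere := by
  set g : Metric.sphere (0 : E) 1 × Set.Ioi (0 : ℝ) → ℝ := fun p => f (p.2.1 • (p.1 : E)) with hg
  have hmp := μ.measurePreserving_homeomorphUnitSphereProd
  have hcomp : ∀ x : ({(0 : E)}ᶜ : Set E), g (homeomorphUnitSphereProd E x) = f x := by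
    intro x
    have := congrArg Subtype.val ((homeomorphUnitSphereProd E).symm_apply_apply x)
    rw [homeomorphUnitSphereProd_symm_apply_coe] at this
    simp only [hg]
    rw [this]
  have hint : Integrable g (μ.toSphere.prod (.volumeIoiPow (Module.finrank ℝ E - 1))) := by
    rw [← hmp.integrable_comp_emb (Homeomorph.measurableEmbedding _)]
    have : (g ∘ homeomorphUnitSphereProd E) = fun x : ({(0 : E)}ᶜ : Set E) => f x :=
      funext hcomp
    rw [this]
    have h2 : IntegrableOn f ({(0 : E)}ᶜ) μ := hf.integrableOn
    exact (integrableOn_iff_comap_subtypeVal (measurableSet_singleton _).compl).1 h2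
  calc ∫ x, f x ∂μ = ∫ x : ({(0 : E)}ᶜ : Set E), f x ∂(μ.comap (↑)) := by
        rw [integral_subtype_comap (measurableSet_singleton _).compl fun x => f x,
          restrict_compl_singleton]
    _ = ∫ x : ({(0 : E)}ᶜ : Set E), g (homeomorphUnitSphereProd E x) ∂(μ.comap (↑)) := by
        simp only [hcomp]
    _ = ∫ p, g p ∂(μ.toSphere.prod (.volumeIoiPow (Module.finrank ℝ E - 1))) :=
        hmp.integral_comp (Homeomorph.measurableEmbedding _) g
    _ = _ := by
        rw [integral_prod _ hint]
        congr 1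
        ext e
        simp only [hg, Measure.volumeIoiPow, ENNReal.ofReal]
        rw [integral_withDensity_eq_integral_smul,
          integral_subtype_comap measurableSet_Ioi
            fun r : ℝ => Real.toNNReal (r ^ (Module.finrank ℝ E - 1)) • f (r • (e : E)),
          setIntegral_congr_fun measurableSet_Ioi fun x hx => ?_]
        · rw [NNReal.smul_def, Real.coe_toNNReal _ (pow_nonneg (le_of_lt hx) _), smul_eq_mul]
        · exact (measurable_subtype_coe.pow_const _).real_toNNReal

end Polar

section Normal

variable {n : ℕ} {a s : ℝ}

theorem nontrivial_euc' (hn : 2 ≤ n) : Nontrivial (Euc n) := nontrivial_euc (by lia)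

theorem sphereArea_eq (hn : 2 ≤ n) :
    sphereArea n = n * (volume : Measure (Euc n)).real (Metric.ball 0 1) := by
  have := nontrivial_euc' hn
  rw [sphereArea, Measure.toSphere_real_apply_univ]
  simp

theorem sphereArea_pos (hn : 2 ≤ n) : 0 < sphereArea n := by
  have := nontrivial_euc' hn
  rw [sphereArea_eq hn]
  have : 0 < (volume : Measure (Euc n)).real (Metric.ball 0 1) :=
    ENNReal.toReal_pos (Metric.measure_ball_pos _ _ one_pos).ne' measure_ball_lt_top.ne
  have : (0 : ℝ) < n := by exact_mod_cast (by lia : 0 < n)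
  positivity

theorem pow_mul_rpow (hn : 2 ≤ n) (han : a + n = 2 - 2 * s) {r : ℝ} (hr : 0 < r) :
    r ^ (n - 1) * r ^ a = r ^ (1 - 2 * s) := by
  rw [← Real.rpow_natCast, ← Real.rpow_add hr, Nat.cast_sub (by lia)]
  congr 1
  push_cast
  linarith

/-- The energy of the profile over `ℝⁿ` with the weight `|y|^a`. -/
theorem lintegral_profile_energy (hn : 2 ≤ n) (hs : s ∈ Set.Ioo (0 : ℝ) 1)
    (han : a + n = 2 - 2 * s) {l : ℝ} (hl : 0 ≤ l) :
    ∫⁻ y : Euc n, ENNReal.ofReal (‖y‖ ^ a *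
      (l ^ 2 * profile s ((l * ‖y‖) ^ 2) ^ 2 + profileDeriv s l ‖y‖ ^ 2)) =
    ENNReal.ofReal (sphereArea n * (dtnConst s * l ^ (2 * s))) := by
  have := nontrivial_euc' hn
  obtain ⟨h1, h2⟩ := integral_profile_energy hs hl
  set f : ℝ → ℝ := fun r => r ^ a *
      (l ^ 2 * profile s ((l * r) ^ 2) ^ 2 + profileDeriv s l r ^ 2) with hf
  have e : ∀ r ∈ Set.Ioi (0 : ℝ), r ^ (1 - 2 * s) *
      (l ^ 2 * profile s ((l * r) ^ 2) ^ 2 + profileDeriv s l r ^ 2) = r ^ (n - 1) • f r := by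
    intro r hr
    rw [← pow_mul_rpow hn han hr, hf, smul_eq_mul]
    ring
  have hint : Integrable (fun y : Euc n => f ‖y‖) := by
    rw [integrable_fun_norm_addHaar (volume : Measure (Euc n)), finrank_euclideanSpace_fin]
    exact h1.congr_fun e measurableSet_Ioi
  have hpos : ∀ y : Euc n, 0 ≤ f ‖y‖ := fun y => by
    simp only [hf]; positivity
  change ∫⁻ y : Euc n, ENNReal.ofReal (f ‖y‖) = _
  rw [← ofReal_integral_eq_lintegral_ofReal hint (Eventually.of_forall hpos),
    integral_fun_norm_addHaar (volume : Measure (Euc n)) f, finrank_euclideanSpace_fin,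
    ← setIntegral_congr_fun measurableSet_Ioi e, h2, sphereArea_eq hn]
  congr 1
  simp only [nsmul_eq_mul, smul_eq_mul]
  ring

theorem abs_profileDeriv_le (hs : s ∈ Set.Ioo (0 : ℝ) 1) {l r : ℝ} (hl : 0 ≤ l) (hr : 0 ≤ r) :
    |profileDeriv s l r| ≤ dtnConst s * l ^ (2 * s) * r ^ (2 * s - 1) := by
  have h1 := profile_nonneg (sub_pos.2 hs.2) ((l * r) ^ 2)
  have h2 := profile_le_one (sub_pos.2 hs.2) (sq_nonneg (l * r))
  have h3 := dtnConst_pos hs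
  rw [profileDeriv, abs_neg, abs_of_nonneg (by positivity)]
  exact mul_le_of_le_one_right (by positivity) h2

theorem measurable_profile_comp (hs : 0 < s) {α : Type*} [MeasurableSpace α] {f : α → ℝ}
    (hf : Measurable f) : Measurable (fun x => profile s (f x ^ 2)) :=
  (continuous_profile_sq hs).measurable.comp hf

theorem measurable_profileDeriv_comp (hs : s ∈ Set.Ioo (0 : ℝ) 1) {α : Type*} [MeasurableSpace α]
    {f g : α → ℝ} (hf : Measurable f) (hg : Measurable g) :
    Measurable (fun x => profileDeriv s (f x) (g x)) := by
  unfold profileDeriv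
  have := measurable_profile_comp (sub_pos.2 hs.2) (hf.mul hg)
  exact (((hf.pow_const _).const_mul _).mul (hg.pow_const _)).mul this |>.neg

theorem norm_inv_smul_le {E : Type*} [NormedAddCommGroup E] [NormedSpace ℝ E] (y : E) :
    ‖‖y‖⁻¹ • y‖ ≤ 1 := by
  rw [norm_smul, norm_inv, norm_norm]
  exact inv_mul_le_one

/-- The weak form of the profile equation in the normal variable: in polar coordinates, the
one-dimensional weak equation holds on each ray through the origin. -/
theorem integral_profile_weak_normal (hn : 2 ≤ n) (hs : s ∈ Set.Ioo (0 : ℝ) 1)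
    (han : a + n = 2 - 2 * s) {l : ℝ} (hl : 0 ≤ l) {η : Euc n → ℝ} (hη : ContDiff ℝ 1 η)
    (hc : HasCompactSupport η) :
    ∫ y : Euc n, ‖y‖ ^ a * (l ^ 2 * profile s ((l * ‖y‖) ^ 2) * η y +
      profileDeriv s l ‖y‖ * fderiv ℝ η y (‖y‖⁻¹ • y)) =
    sphereArea n * (dtnConst s * l ^ (2 * s) * η 0) := by
  have := nontrivial_euc' hn
  have hη' : Continuous (fderiv ℝ η) := hη.continuous_fderiv (by norm_num)
  have hint : Integrable (fun y : Euc n => ‖y‖ ^ a * (l ^ 2 * profile s ((l * ‖y‖) ^ 2) * η y +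
      profileDeriv s l ‖y‖ * fderiv ℝ η y (‖y‖⁻¹ • y))) := by
    obtain ⟨R, hR, hsub⟩ := hc.isCompact.isBounded.subset_ball_lt 0 (0 : Euc n)
    obtain ⟨C, hC⟩ := hη.continuous.bounded_above_of_compact_support hc
    obtain ⟨D, hD⟩ := hη'.bounded_above_of_compact_support (hc.fderiv (𝕜 := ℝ))
    have b1 := integrableOn_norm_rpow_ball (volume : Measure (Euc n)) (p := a)
      (by rw [finrank_euclideanSpace_fin]; linarith [hs.2]) R
    have b2 := integrableOn_norm_rpow_ball (volume : Measure (Euc n)) (p := a + (2 * s - 1))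
      (by rw [finrank_euclideanSpace_fin]; linarith [hs.2]) R
    have b3 := ((b1.const_mul (l ^ 2 * C)).add (b2.const_mul (dtnConst s * l ^ (2 * s) * D)))
    refine ((integrable_indicator_iff measurableSet_ball).2 b3).mono' ?_ ?_
    · have m1 : Measurable (fun y : Euc n => profile s ((l * ‖y‖) ^ 2)) :=
        measurable_profile_comp hs.1 (by fun_prop)
      have m2 : Measurable (fun y : Euc n => profileDeriv s l ‖y‖) :=
        measurable_profileDeriv_comp hs measurable_const measurable_norm
      have m3 : Measurable (fun y : Euc n => fderiv ℝ η y (‖y‖⁻¹ • y)) := by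
        have c1 : Measurable (fun y : Euc n => (fderiv ℝ η y, ‖y‖⁻¹ • y)) :=
          hη'.measurable.prodMk (by fun_prop)
        exact (isBoundedBilinearMap_apply (𝕜 := ℝ) (E := Euc n)
            (F := ℝ)).continuous.measurable.comp c1
      have := hη.continuous.measurable
      exact Measurable.aestronglyMeasurable (by fun_prop)
    · have hne : ∀ᵐ y : Euc n, y ≠ 0 := by simp [ae_iff]
      filter_upwards [hne] with y hy0
      have hpos : 0 < ‖y‖ := norm_pos_iff.2 hy0
      by_cases hy : y ∈ Metric.ball (0 : Euc n) R
      · rw [Set.indicator_of_mem hy, norm_mul, Real.norm_of_nonneg (by positivity)]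
        have p1 := profile_nonneg hs.1 ((l * ‖y‖) ^ 2)
        have p2 := profile_le_one hs.1 (sq_nonneg (l * ‖y‖))
        have p3 := abs_profileDeriv_le hs hl hpos.le
        have p4 : ‖fderiv ℝ η y (‖y‖⁻¹ • y)‖ ≤ D := by
          refine ((fderiv ℝ η y).le_of_opNorm_le_of_le (hD y) (norm_inv_smul_le y)).trans ?_
          simp
        have hD0 : 0 ≤ D := (norm_nonneg _).trans (hD 0)
        have hd := dtnConst_pos hs
        have t1 : ‖l ^ 2 * profile s ((l * ‖y‖) ^ 2) * η y‖ ≤ l ^ 2 * C := by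
          rw [norm_mul, Real.norm_of_nonneg (by positivity)]
          exact mul_le_mul (mul_le_of_le_one_right (sq_nonneg l) p2) (hC y) (norm_nonneg _)
            (sq_nonneg l)
        have t2 : ‖profileDeriv s l ‖y‖ * fderiv ℝ η y (‖y‖⁻¹ • y)‖ ≤
            dtnConst s * l ^ (2 * s) * ‖y‖ ^ (2 * s - 1) * D := by
          rw [norm_mul]
          exact mul_le_mul p3 p4 (norm_nonneg _) (by positivity)
        calc _ ≤ ‖y‖ ^ a * (l ^ 2 * C + dtnConst s * l ^ (2 * s) * ‖y‖ ^ (2 * s - 1) * D) := by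
              gcongr
              exact (norm_add_le _ _).trans (add_le_add t1 t2)
          _ = _ := by
              rw [Pi.add_apply, Real.rpow_add hpos]
              ring
      · have hz : y ∉ tsupport η := fun h => hy (hsub h)
        have hz1 : η y = 0 := image_eq_zero_of_notMem_tsupport hz
        have hz2 : fderiv ℝ η y = 0 := fderiv_of_notMem_tsupport ℝ hz
        rw [Set.indicator_of_notMem hy]
        simp [hz1, hz2]
  -- on the ray through `e` the integrand, with the Jacobian `r^{n-1}`, is that of
  -- `integral_profile_weak` for `η(r e)`
  rw [integral_eq_integral_sphere volume hint, finrank_euclideanSpace_fin]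
  have key : ∀ e : Metric.sphere (0 : Euc n) 1, (∫ r in Set.Ioi (0 : ℝ), r ^ (n - 1) *
      (‖r • (e : Euc n)‖ ^ a *
          (l ^ 2 * profile s ((l * ‖r • (e : Euc n)‖) ^ 2) * η (r • (e : Euc n)) +
      profileDeriv s l ‖r • (e : Euc n)‖ *
        fderiv ℝ η (r • (e : Euc n)) (‖r • (e : Euc n)‖⁻¹ • r • (e : Euc n))))) =
      dtnConst s * l ^ (2 * s) * η 0 := by
    intro e
    have he : ‖(e : Euc n)‖ = 1 := by simp
    have he0 : (e : Euc n) ≠ 0 := by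
      intro h; rw [h, norm_zero] at he; exact zero_ne_one he
    have hlin : ContDiff ℝ 1 (fun r : ℝ => r • (e : Euc n)) := by fun_prop
    have hcs : HasCompactSupport (fun r : ℝ => η (r • (e : Euc n))) :=
      hc.comp_isClosedEmbedding (isClosedEmbedding_smul_left he0)
    have h := integral_profile_weak hs hl (η := fun r => η (r • (e : Euc n))) (hη.comp hlin) hcs
    rw [zero_smul] at h
    rw [← h]
    refine setIntegral_congr_fun measurableSet_Ioi fun r hr => ?_
    have hr' : (0 : ℝ) < r := hr
    have hn1 : ‖r • (e : Euc n)‖ = r := by rw [norm_smul, he, mul_one, Real.norm_of_nonneg hr'.le]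
    have hd : deriv (fun r : ℝ => η (r • (e : Euc n))) r = fderiv ℝ η (r • (e : Euc n)) e := by
      have h1 : HasDerivAt (fun r : ℝ => r • (e : Euc n)) (e : Euc n) r := by
        simpa using (hasDerivAt_id r).smul_const (e : Euc n)
      have h2 := ((hη.differentiable (by norm_num)) (r • (e : Euc n))).hasFDerivAt
      exact (h2.comp_hasDerivAt r h1).deriv
    simp only [hn1, hd, inv_smul_smul₀ hr'.ne', ← mul_assoc, pow_mul_rpow hn han hr']
  simp only [key, integral_const, smul_eq_mul]
  rfl

end Normal

section Weight

variable {m n : ℕ} {a s : ℝ}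

/-- The weighted measure `|y|^a dy` on `ℝⁿ`. -/
noncomputable def normalWeight (n : ℕ) (a : ℝ) : Measure (Euc n) :=
  (volume : Measure (Euc n)).withDensity (fun y => ENNReal.ofReal (‖y‖ ^ a))

theorem weightedVolume_eq_prod :
    weightedVolume m n a = (volume : Measure (Euc m)).prod (normalWeight n a) := by
  have h : Measurable (fun y : Euc n => ENNReal.ofReal (‖y‖ ^ a)) := by fun_prop
  rw [normalWeight, prod_withDensity_right h]
  rfl

theorem measurable_weight : Measurable (fun z : Euc m × Euc n => ENNReal.ofReal (‖z.2‖ ^ a)) := by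
  fun_prop

theorem weightedVolume_ac : weightedVolume m n a ≪ volume := withDensity_absolutelyContinuous _ _

theorem ae_snd_ne_zero (hn : 2 ≤ n) : ∀ᵐ z : Euc m × Euc n, z.2 ≠ 0 := by
  have := nontrivial_euc' hn
  have h : ∀ᵐ y : Euc n, y ≠ 0 := by simp [ae_iff]
  exact (Measure.quasiMeasurePreserving_snd (μ := (volume : Measure (Euc m)))).ae h

theorem volume_ac_weightedVolume (hn : 2 ≤ n) :
    (volume : Measure (Euc m × Euc n)) ≪ weightedVolume m n a := by
  refine withDensity_absolutelyContinuous' measurable_weight.aemeasurable ?_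
  filter_upwards [ae_snd_ne_zero hn] with z hz
  have : 0 < ‖z.2‖ ^ a := Real.rpow_pos_of_pos (norm_pos_iff.2 hz) _
  simpa using this

/-- Tonelli's theorem for the weighted measure, with the normal variable outside. -/
theorem lintegral_weightedVolume {f : Euc m × Euc n → ENNReal} (hf : AEMeasurable f volume) :
    ∫⁻ z, f z ∂(weightedVolume m n a) =
      ∫⁻ y : Euc n, ENNReal.ofReal (‖y‖ ^ a) * ∫⁻ x : Euc m, f (x, y) := by
  rw [weightedVolume, lintegral_withDensity_eq_lintegral_mul₀ measurable_weight.aemeasurable hf,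
    Measure.volume_eq_prod, lintegral_prod_symm]
  · refine lintegral_congr fun y => ?_
    simp only [Pi.mul_apply]
    rw [lintegral_const_mul' _ _ ENNReal.ofReal_ne_top]
  · exact measurable_weight.aemeasurable.mul hf

theorem integral_weightedVolume (f : Euc m × Euc n → ℝ) :
    ∫ z, f z ∂(weightedVolume m n a) = ∫ z, ‖z.2‖ ^ a * f z := by
  have h : Measurable (fun z : Euc m × Euc n => (‖z.2‖ ^ a).toNNReal) := by fun_prop
  have e := integral_withDensity_eq_integral_smul (μ := (volume : Measure (Euc m × Euc n))) h f
  refine e.trans (integral_congr_ae (Eventually.of_forall fun z => ?_))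
  simp only [NNReal.smul_def, smul_eq_mul]
  rw [Real.coe_toNNReal _ (by positivity)]

theorem isLocallyFiniteMeasure_normalWeight (hn : 2 ≤ n) (ha : -(n : ℝ) < a) :
    IsLocallyFiniteMeasure (normalWeight n a) := by
  have := nontrivial_euc' hn
  refine ⟨fun y => ⟨Metric.ball 0 (‖y‖ + 1), Metric.isOpen_ball.mem_nhds (by simp), ?_⟩⟩
  have h := integrableOn_norm_rpow_ball (volume : Measure (Euc n)) (p := a)
    (by rw [finrank_euclideanSpace_fin]; exact ha) (‖y‖ + 1)
  rw [normalWeight, withDensity_apply _ measurableSet_ball]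
  have h2 := h.2
  rw [hasFiniteIntegral_iff_ofReal (Eventually.of_forall fun y => by positivity)] at h2
  exact h2

theorem isLocallyFiniteMeasure_weightedVolume (hn : 2 ≤ n) (ha : -(n : ℝ) < a) :
    IsLocallyFiniteMeasure (weightedVolume m n a) := by
  have := isLocallyFiniteMeasure_normalWeight hn ha
  rw [weightedVolume_eq_prod]
  infer_instance

end Weight

/-! ### Fields synthesized from Fourier multipliers -/

section Symbols

variable {m n : ℕ} {a s : ℝ}

theorem eLpNorm_two_sq {α E : Type*} [MeasurableSpace α] {μ : Measure α} [NormedAddCommGroup E]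
    (f : α → E) : eLpNorm f 2 μ ^ 2 = ∫⁻ x, ‖f x‖ₑ ^ 2 ∂μ := by
  rw [eLpNorm_eq_lintegral_rpow_enorm_toReal (by norm_num) (by norm_num), ← ENNReal.rpow_natCast,
    ← ENNReal.rpow_mul]
  norm_num

/-- A family of Hermitian symbols of polynomial growth in `ξ ∈ ℝ^m`, indexed by `y ∈ ℝⁿ`. Bounds are
required only off the null set `y = 0`, where the radial derivative of the profile may be singular;
the exponent is the growth `2` allowed in `IsMultiplier`, plus one for the factor `ξ_j` of a
tangential derivative. -/
structure IsSymbol (A : Euc m → Euc n → ℂ) : Prop where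
  meas : Measurable (fun p : Euc m × Euc n => A p.1 p.2)
  symm : ∀ y, IsHermitianSymm (fun ξ => A ξ y)
  bound : ∀ y, y ≠ 0 → ∃ C, ∀ ξ, ‖A ξ y‖ ≤ C * (1 + ‖ξ‖) ^ 3

/-- The function of `(x, y)` whose Fourier transform in `x` is `A(ξ, y) φ̂(ξ)`. -/
noncomputable def synth (φ : Euc m → ℝ) (A : Euc m → Euc n → ℂ) (z : Euc m × Euc n) : ℝ :=
  (𝓕⁻ (fun ξ => A ξ z.2 * specHat φ ξ) z.1).re

theorem IsSymbol.measurable_section {A : Euc m → Euc n → ℂ} (hA : IsSymbol A) (y : Euc n) :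
    Measurable (fun ξ => A ξ y) :=
  hA.meas.comp (measurable_id.prodMk measurable_const)

theorem IsSymbol.integrable {A : Euc m → Euc n → ℂ} (hA : IsSymbol A) {φ : Euc m → ℝ}
    (hφ : IsTest φ) {y : Euc n} (hy : y ≠ 0) : Integrable (fun ξ => A ξ y * specHat φ ξ) := by
  obtain ⟨C, hC⟩ := hA.bound y hy
  exact hφ.integrable_mul_specHat (hA.measurable_section y).aestronglyMeasurable hC

theorem IsSymbol.memLp {A : Euc m → Euc n → ℂ} (hA : IsSymbol A) {φ : Euc m → ℝ}
    (hφ : IsTest φ) {y : Euc n} (hy : y ≠ 0) : MemLp (fun ξ => A ξ y * specHat φ ξ) 2 volume := by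
  obtain ⟨C, hC⟩ := hA.bound y hy
  exact hφ.memLp_mul_specHat (hA.measurable_section y).aestronglyMeasurable hC

theorem IsSymbol.lintegral_synth_sq {A : Euc m → Euc n → ℂ} (hA : IsSymbol A) {φ : Euc m → ℝ}
    (hφ : IsTest φ) {y : Euc n} (hy : y ≠ 0) :
    ∫⁻ x, ‖synth φ A (x, y)‖ₑ ^ 2 = ∫⁻ ξ, ‖specHat φ ξ‖ₑ ^ 2 * ‖A ξ y‖ₑ ^ 2 := by
  simp only [synth]
  rw [(isHermitianSymm_mul_specHat φ (hA.symm y)).lintegral_re_fourierInv_sq (hA.integrable hφ hy)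
    (hA.memLp hφ hy)]
  refine lintegral_congr fun ξ => ?_
  rw [enorm_mul, mul_pow, mul_comm]

theorem IsSymbol.measurable_synth {A : Euc m → Euc n → ℂ} (hA : IsSymbol A) {φ : Euc m → ℝ}
    (hφ : IsTest φ) : Measurable (synth φ A) := by
  unfold synth
  simp only [Real.fourierInv_eq']
  have h : StronglyMeasurable (Function.uncurry fun (z : Euc m × Euc n) (v : Euc m) =>
      Complex.exp (((2 * Real.pi * inner ℝ v z.1 : ℝ) : ℂ) * Complex.I) •
          (A v z.2 * specHat φ v)) := by
    have h1 : Measurable (fun p : (Euc m × Euc n) × Euc m => A p.2 p.1.2) :=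
      hA.meas.comp (measurable_snd.prodMk (measurable_snd.comp measurable_fst))
    have h2 : Measurable (fun p : (Euc m × Euc n) × Euc m => specHat φ p.2) :=
      hφ.continuous_specHat.measurable.comp measurable_snd
    have h3 : Continuous (fun p : (Euc m × Euc n) × Euc m =>
        Complex.exp (((2 * Real.pi * inner ℝ p.2 p.1.1 : ℝ) : ℂ) * Complex.I)) := by fun_prop
    exact (h3.measurable.smul (h1.mul h2)).stronglyMeasurable
  exact Complex.measurable_re.comp h.integral_prod_right.measurable

theorem IsSymbol.synth_sub {A B : Euc m → Euc n → ℂ} (hA : IsSymbol A) (hB : IsSymbol B)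
    {φ : Euc m → ℝ} (hφ : IsTest φ) {z : Euc m × Euc n} (hz : z.2 ≠ 0) :
    synth φ (fun ξ y => A ξ y - B ξ y) z = synth φ A z - synth φ B z := by
  have e1 := (Real.fourierIntegral_convergent_iff (-z.1)).2 (hA.integrable hφ hz)
  have e2 := (Real.fourierIntegral_convergent_iff (-z.1)).2 (hB.integrable hφ hz)
  simp only [synth, Real.fourierInv_eq_fourier_neg, Real.fourier_eq]
  rw [← Complex.sub_re, ← integral_sub e1 e2]
  simp only [sub_mul, smul_sub]

theorem IsSymbol.lintegral_synth_sq_weighted (hn : 2 ≤ n) {A : Euc m → Euc n → ℂ} (hA : IsSymbol A)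
    {φ : Euc m → ℝ} (hφ : IsTest φ) :
    ∫⁻ z, ‖synth φ A z‖ₑ ^ 2 ∂(weightedVolume m n a) =
      ∫⁻ ξ, ‖specHat φ ξ‖ₑ ^ 2 * ∫⁻ y : Euc n, ENNReal.ofReal (‖y‖ ^ a) * ‖A ξ y‖ₑ ^ 2 := by
  have := nontrivial_euc' hn
  have hne : ∀ᵐ y : Euc n, y ≠ 0 := by simp [ae_iff]
  have hm : Measurable (fun p : Euc n × Euc m => ‖A p.2 p.1‖ₑ) :=
    (hA.meas.comp measurable_swap).enorm
  have hsp : Measurable (fun ξ => ‖specHat φ ξ‖ₑ ^ 2) :=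
      hφ.continuous_specHat.enorm.measurable.pow_const _
  rw [lintegral_weightedVolume ((hA.measurable_synth hφ).enorm.pow_const 2).aemeasurable]
  calc _ = ∫⁻ y : Euc n, ∫⁻ ξ : Euc m, ENNReal.ofReal (‖y‖ ^ a) *
        (‖specHat φ ξ‖ₑ ^ 2 * ‖A ξ y‖ₑ ^ 2) := by
        apply lintegral_congr_ae
        filter_upwards [hne] with y hy
        rw [hA.lintegral_synth_sq hφ hy, lintegral_const_mul' _ _ ENNReal.ofReal_ne_top]
    _ = ∫⁻ ξ : Euc m, ∫⁻ y : Euc n, ENNReal.ofReal (‖y‖ ^ a) *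
        (‖specHat φ ξ‖ₑ ^ 2 * ‖A ξ y‖ₑ ^ 2) := by
        refine lintegral_lintegral_swap (Measurable.aemeasurable ?_)
        have h1 : Measurable (fun p : Euc n × Euc m => ‖specHat φ p.2‖ₑ ^ 2) :=
          hsp.comp measurable_snd
        have h2 : Measurable (fun p : Euc n × Euc m => ENNReal.ofReal (‖p.1‖ ^ a)) := by fun_prop
        exact h2.mul (h1.mul (hm.pow_const 2))
    _ = _ := by
        refine lintegral_congr fun ξ => ?_
        rw [← lintegral_const_mul' _ _ (ENNReal.pow_ne_top enorm_ne_top)]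
        refine lintegral_congr fun y => ?_
        ring

/-- Radial real multipliers `α(|ξ|, y)` of at most quadratic growth in `|ξ|`. The radial derivative
of the profile grows like `|ξ|^{2s}`, and `2s < 2`. -/
structure IsMultiplier (α : ℝ → Euc n → ℝ) : Prop where
  meas : Measurable (fun p : ℝ × Euc n => α p.1 p.2)
  bound : ∀ y, y ≠ 0 → ∃ C, ∀ l, 0 ≤ l → |α l y| ≤ C * (1 + l) ^ 2

theorem IsMultiplier.sub {α β : ℝ → Euc n → ℝ} (hα : IsMultiplier α) (hβ : IsMultiplier β) :
    IsMultiplier (fun l y => α l y - β l y) where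
  meas := hα.meas.sub hβ.meas
  bound y hy := by
    obtain ⟨C, hC⟩ := hα.bound y hy
    obtain ⟨D, hD⟩ := hβ.bound y hy
    refine ⟨C + D, fun l hl => (abs_sub _ _).trans ?_⟩
    rw [add_mul]
    exact add_le_add (hC l hl) (hD l hl)

/-- The symbol `α(|ξ|, y)` itself. -/
noncomputable def symN (α : ℝ → Euc n → ℝ) (ξ : Euc m) (y : Euc n) : ℂ := (α ‖ξ‖ y : ℂ)

/-- The symbol `2πi ξ_j α(|ξ|, y)` of the `j`-th tangential derivative. -/
noncomputable def symX (α : ℝ → Euc n → ℝ) (j : Fin m) (ξ : Euc m) (y : Euc n) : ℂ :=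
  ((2 * Real.pi * ξ j * α ‖ξ‖ y : ℝ) : ℂ) * Complex.I

theorem IsMultiplier.isSymbol_symN {α : ℝ → Euc n → ℝ} (hα : IsMultiplier α) :
    IsSymbol (symN α : Euc m → Euc n → ℂ) where
  meas := Complex.measurable_ofReal.comp (hα.meas.comp (measurable_fst.norm.prodMk measurable_snd))
  symm y ξ := by simp [symN]
  bound y hy := by
    obtain ⟨C, hC⟩ := hα.bound y hy
    refine ⟨|C|, fun ξ => ?_⟩
    have h1 : 1 ≤ 1 + ‖ξ‖ := by linarith [norm_nonneg ξ]
    rw [symN, Complex.norm_real, Real.norm_eq_abs]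
    calc _ ≤ C * (1 + ‖ξ‖) ^ 2 := hC _ (norm_nonneg _)
      _ ≤ |C| * (1 + ‖ξ‖) ^ 3 := mul_le_mul (le_abs_self C)
          (pow_le_pow_right₀ h1 (by norm_num)) (by positivity) (abs_nonneg C)

theorem IsMultiplier.isSymbol_symX {α : ℝ → Euc n → ℝ} (hα : IsMultiplier α) (j : Fin m) :
    IsSymbol (symX α j) where
  meas := by
    have h1 : Measurable (fun p : Euc m × Euc n => α ‖p.1‖ p.2) :=
      hα.meas.comp (measurable_fst.norm.prodMk measurable_snd)
    have h2 : Measurable (fun p : Euc m × Euc n => p.1 j) := by fun_prop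
    exact (Complex.measurable_ofReal.comp ((h2.const_mul _).mul h1)).mul_const _
  symm y ξ := by simp [symX, Complex.conj_ofNat]
  bound y hy := by
    obtain ⟨C, hC⟩ := hα.bound y hy
    refine ⟨2 * Real.pi * |C|, fun ξ => ?_⟩
    have h1 : ‖ξ j‖ ≤ 1 + ‖ξ‖ := (PiLp.norm_apply_le ξ j).trans (by linarith)
    rw [symX, norm_mul, Complex.norm_I, mul_one, Complex.norm_real, norm_mul, norm_mul,
      Real.norm_of_nonneg (by positivity : 0 ≤ 2 * Real.pi)]
    calc _ ≤ 2 * Real.pi * (1 + ‖ξ‖) * (|C| * (1 + ‖ξ‖) ^ 2) := by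
          gcongr
          exact (hC _ (norm_nonneg _)).trans (by gcongr; exact le_abs_self C)
      _ = _ := by ring

/-- The field with tangential part `∇_x` of the synthesis of `α` and with radial part the synthesis
of `β` in the direction `y/|y|`. On the null set `y = 0` the radial part is zero. -/
noncomputable def multField (φ : Euc m → ℝ) (α β : ℝ → Euc n → ℝ) (z : Euc m × Euc n) :
    WithLp 2 (Euc m × Euc n) :=
  WithLp.toLp 2 (WithLp.toLp 2 (fun j => synth φ (symX α j) z),
    synth φ (symN β) z • (‖z.2‖⁻¹ • z.2))

theorem measurable_multField {φ : Euc m → ℝ} (hφ : IsTest φ) {α β : ℝ → Euc n → ℝ}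
    (hα : IsMultiplier α) (hβ : IsMultiplier β) : Measurable (multField φ α β) := by
  have h1 : ∀ j, Measurable (synth φ (symX α j)) :=
      fun j => (hα.isSymbol_symX j).measurable_synth hφ
  have h2 : Measurable (synth φ (symN β) : Euc m × Euc n → ℝ) :=
      hβ.isSymbol_symN.measurable_synth hφ
  have h3 : Measurable (fun z : Euc m × Euc n =>
      (WithLp.toLp 2 (fun j => synth φ (symX α j) z) : Euc m)) :=
    (PiLp.continuous_toLp 2 _).measurable.comp (measurable_pi_lambda _ h1)
  have h4 : Measurable (fun z : Euc m × Euc n => synth φ (symN β) z • (‖z.2‖⁻¹ • z.2)) := by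
    fun_prop
  exact (WithLp.prod_continuous_toLp 2 (Euc m) (Euc n)).measurable.comp (h3.prodMk h4)

theorem enorm_multField_sq (φ : Euc m → ℝ) (α β : ℝ → Euc n → ℝ) {z : Euc m × Euc n}
    (hz : z.2 ≠ 0) : ‖multField φ α β z‖ₑ ^ 2 =
      ∑ j, ‖synth φ (symX α j) z‖ₑ ^ 2 + ‖synth φ (symN β) z‖ₑ ^ 2 := by
  have h : ‖multField φ α β z‖ ^ 2 =
      ∑ j, ‖synth φ (symX α j) z‖ ^ 2 + ‖synth φ (symN β) z‖ ^ 2 := by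
    rw [WithLp.prod_norm_sq_eq_of_L2, EuclideanSpace.norm_sq_eq]
    congr 1
    change ‖synth φ (symN β) z • (‖z.2‖⁻¹ • z.2)‖ ^ 2 = _
    rw [norm_smul, norm_smul, norm_inv, norm_norm, inv_mul_cancel₀ (norm_ne_zero_iff.2 hz), mul_one]
  simp only [← ofReal_norm]
  simp only [← ENNReal.ofReal_pow (norm_nonneg _)]
  rw [h, ENNReal.ofReal_add (Finset.sum_nonneg fun j _ => by positivity) (by positivity),
    ENNReal.ofReal_sum_of_nonneg (fun j _ => by positivity)]

/-- The weighted energy of a synthesized field, computed by Plancherel's theorem in `x`. -/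
theorem lintegral_multField_sq (hn : 2 ≤ n) {φ : Euc m → ℝ} (hφ : IsTest φ) {α β : ℝ → Euc n → ℝ}
    (hα : IsMultiplier α) (hβ : IsMultiplier β) :
    ∫⁻ z, ‖multField φ α β z‖ₑ ^ 2 ∂(weightedVolume m n a) =
      ∫⁻ ξ, ‖specHat φ ξ‖ₑ ^ 2 * ∫⁻ y : Euc n, ENNReal.ofReal (‖y‖ ^ a *
        ((2 * Real.pi * ‖ξ‖) ^ 2 * α ‖ξ‖ y ^ 2 + β ‖ξ‖ y ^ 2)) := by
  have hX := fun j : Fin m => hα.isSymbol_symX j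
  have hN : IsSymbol (symN β : Euc m → Euc n → ℂ) := hβ.isSymbol_symN
  have hwy : Measurable (fun y : Euc n => ENNReal.ofReal (‖y‖ ^ a)) := by fun_prop
  have hsec : ∀ {A : Euc m → Euc n → ℂ}, IsSymbol A → ∀ ξ, Measurable fun y =>
      ENNReal.ofReal (‖y‖ ^ a) * ‖A ξ y‖ₑ ^ 2 := fun hA ξ =>
    hwy.mul ((hA.meas.comp (measurable_const.prodMk measurable_id)).enorm.pow_const 2)
  have hout : ∀ {A : Euc m → Euc n → ℂ}, IsSymbol A → Measurable fun ξ =>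
      ‖specHat φ ξ‖ₑ ^ 2 * ∫⁻ y, ENNReal.ofReal (‖y‖ ^ a) * ‖A ξ y‖ₑ ^ 2 := fun {A} hA => by
    have h1 : Measurable (fun p : Euc m × Euc n => ENNReal.ofReal (‖p.2‖ ^ a) * ‖A p.1 p.2‖ₑ ^ 2) :=
      (hwy.comp measurable_snd).mul (hA.meas.enorm.pow_const 2)
    exact (hφ.continuous_specHat.enorm.measurable.pow_const _).mul h1.lintegral_prod_right'
  calc _ = ∫⁻ z, (∑ j, ‖synth φ (symX α j) z‖ₑ ^ 2 + ‖synth φ (symN β) z‖ₑ ^ 2)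
        ∂(weightedVolume m n a) := by
        apply lintegral_congr_ae
        filter_upwards [weightedVolume_ac (ae_snd_ne_zero hn)] with z hz
        exact enorm_multField_sq φ α β hz
    _ = ∑ j, (∫⁻ z, ‖synth φ (symX α j) z‖ₑ ^ 2 ∂(weightedVolume m n a)) +
        ∫⁻ z, ‖synth φ (symN β) z‖ₑ ^ 2 ∂(weightedVolume m n a) := by
        rw [lintegral_add_left, lintegral_finsetSum]
        · exact fun j _ => ((hX j).measurable_synth hφ).enorm.pow_const 2
        · exact Finset.measurable_fun_sum _ fun j _ =>
              ((hX j).measurable_synth hφ).enorm.pow_const 2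
    _ = ∫⁻ ξ, (∑ j, ‖specHat φ ξ‖ₑ ^ 2 * ∫⁻ y, ENNReal.ofReal (‖y‖ ^ a) * ‖symX α j ξ y‖ₑ ^ 2) +
        ‖specHat φ ξ‖ₑ ^ 2 * ∫⁻ y, ENNReal.ofReal (‖y‖ ^ a) * ‖(symN β ξ y : ℂ)‖ₑ ^ 2 := by
        rw [lintegral_add_left, lintegral_finsetSum]
        · simp only [(hX _).lintegral_synth_sq_weighted hn hφ, hN.lintegral_synth_sq_weighted hn hφ]
        · exact fun j _ => hout (hX j)
        · exact Finset.measurable_fun_sum _ fun j _ => hout (hX j)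
    _ = _ := by
        refine lintegral_congr fun ξ => ?_
        rw [← Finset.mul_sum, ← mul_add, ← lintegral_finsetSum _ (fun j _ => hsec (hX j) ξ),
          ← lintegral_add_left (Finset.measurable_fun_sum _ fun j _ => hsec (hX j) ξ)]
        congr 1
        refine lintegral_congr fun y => ?_
        rw [← Finset.mul_sum, ← mul_add, ENNReal.ofReal_mul (by positivity)]
        congr 1
        simp only [← ofReal_norm, ← ENNReal.ofReal_pow (norm_nonneg _)]
        rw [← ENNReal.ofReal_sum_of_nonneg (fun j _ => by positivity),
          ← ENNReal.ofReal_add (Finset.sum_nonneg fun j _ => by positivity) (by positivity)]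
        congr 2
        · simp only [symX, norm_mul, Complex.norm_I, mul_one, Complex.norm_real, mul_pow,
            EuclideanSpace.norm_sq_eq ξ, Real.norm_eq_abs, sq_abs, abs_of_nonneg Real.pi_pos.le]
          rw [← Finset.sum_mul, ← Finset.mul_sum]
        · simp [symN]

theorem multField_sub {φ : Euc m → ℝ} (hφ : IsTest φ) {α β α' β' : ℝ → Euc n → ℝ}
    (hα : IsMultiplier α) (hβ : IsMultiplier β) (hα' : IsMultiplier α') (hβ' : IsMultiplier β')
    {z : Euc m × Euc n} (hz : z.2 ≠ 0) :
    multField φ α β z - multField φ α' β' z =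
      multField φ (fun l y => α l y - α' l y) (fun l y => β l y - β' l y) z := by
  have h1 : ∀ j, synth φ (symX (fun l y => α l y - α' l y) j) z =
      synth φ (symX α j) z - synth φ (symX α' j) z := fun j => by
    rw [← (hα.isSymbol_symX j).synth_sub (hα'.isSymbol_symX j) hφ hz]
    congr 1
    ext ξ y
    simp only [symX, ← sub_mul]
    push_cast
    ring
  have h2 : synth φ (symN (fun l y => β l y - β' l y)) z =
      synth φ (symN β) z - synth φ (symN β') z := by
    rw [← (hβ.isSymbol_symN).synth_sub (hβ'.isSymbol_symN) hφ hz]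
    congr 1
    ext ξ y
    simp only [symN]
    push_cast
    ring
  unfold multField
  rw [h2]
  simp only [h1, sub_smul]
  rfl

end Symbols

section HarmonicField

variable {m n : ℕ} {a s : ℝ}

/-- The multiplier of the Poisson extension itself, in the variables `l = |ξ|` and `y`. -/
noncomputable def profMult (n : ℕ) (s : ℝ) (l : ℝ) (y : Euc n) : ℝ :=
  profile s ((2 * Real.pi * l * ‖y‖) ^ 2)

/-- The multiplier of the radial derivative `∂_{|y|}` of the Poisson extension. -/
noncomputable def profDerivMult (n : ℕ) (s : ℝ) (l : ℝ) (y : Euc n) : ℝ :=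
  profileDeriv s (2 * Real.pi * l) ‖y‖

theorem isMultiplier_profMult (hs : s ∈ Set.Ioo (0 : ℝ) 1) : IsMultiplier (profMult n s) where
  meas := measurable_profile_comp hs.1 (by fun_prop)
  bound y hy := ⟨1, fun l hl => by
    rw [profMult, abs_of_nonneg (profile_nonneg hs.1 _), one_mul]
    exact (profile_le_one hs.1 (sq_nonneg _)).trans (one_le_pow₀ (by linarith))⟩

theorem isMultiplier_profDerivMult (hs : s ∈ Set.Ioo (0 : ℝ) 1) :
    IsMultiplier (profDerivMult n s) where
  meas := measurable_profileDeriv_comp hs (by fun_prop) (by fun_prop)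
  bound y hy := by
    refine ⟨dtnConst s * (2 * Real.pi) ^ (2 * s) * ‖y‖ ^ (2 * s - 1), fun l hl => ?_⟩
    refine (abs_profileDeriv_le hs (by positivity) (norm_nonneg y)).trans ?_
    have := two_pi_mul_rpow_le (p := 2 * s) (by linarith [hs.1]) (by linarith [hs.2]) hl
    have hd := dtnConst_pos hs
    calc _ ≤ dtnConst s * ((2 * Real.pi) ^ (2 * s) * (1 + l) ^ 2) * ‖y‖ ^ (2 * s - 1) := by gcongr
      _ = _ := by ring

/-- The gradient of the Poisson extension of a test function, given by its Fourier transform in `x`.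
That it is the energy gradient of `poissonExtension n s φ` is shown in
`IsTest.exists_tendstoD1a`. -/
noncomputable def extField (n : ℕ) (s : ℝ) (φ : Euc m → ℝ) :
    Euc m × Euc n → WithLp 2 (Euc m × Euc n) :=
  multField φ (profMult n s) (profDerivMult n s)

/-- The factor between the energy of the extension and that of the trace; it equals
`|S^{n-1}| d_{a,n}` (see `energyConst_eq`). -/
noncomputable def energyConst (n : ℕ) (s : ℝ) : ℝ := sphereArea n * dtnConst s

theorem energyConst_pos (hn : 2 ≤ n) (hs : s ∈ Set.Ioo (0 : ℝ) 1) : 0 < energyConst n s :=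
  mul_pos (sphereArea_pos hn) (dtnConst_pos hs)

/-- The energy identity for test functions: Plancherel's identity in `x` and, at each frequency, the
energy of the profile. -/
theorem lintegral_extField_sq (hn : 2 ≤ n) (hs : s ∈ Set.Ioo (0 : ℝ) 1) (han : a + n = 2 - 2 * s)
    {φ : Euc m → ℝ} (hφ : IsTest φ) :
    ∫⁻ z, ‖extField n s φ z‖ₑ ^ 2 ∂(weightedVolume m n a) =
      ENNReal.ofReal (energyConst n s) * eLpNorm (fracLaplacian (s / 2) φ) 2 volume ^ 2 := by
  rw [extField, lintegral_multField_sq hn hφ (isMultiplier_profMult hs)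
    (isMultiplier_profDerivMult hs), hφ.eLpNorm_fracLaplacian hs, eLpNorm_two_sq,
    ← lintegral_const_mul' _ _ ENNReal.ofReal_ne_top]
  refine lintegral_congr fun ξ => ?_
  have hc := energyConst_pos hn hs
  simp only [profMult, profDerivMult]
  rw [lintegral_profile_energy hn hs han (by positivity : 0 ≤ 2 * Real.pi * ‖ξ‖), ← mul_assoc,
    ← energyConst, ENNReal.ofReal_mul hc.le, halfAmp, enorm_mul, mul_pow]
  have : ‖(((2 * Real.pi * ‖ξ‖) ^ s : ℝ) : ℂ)‖ₑ ^ 2 =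
      ENNReal.ofReal ((2 * Real.pi * ‖ξ‖) ^ (2 * s)) := by
    rw [← ofReal_norm, Complex.norm_real, Real.norm_of_nonneg (by positivity),
      ← ENNReal.ofReal_pow (by positivity), mul_comm 2 s, Real.rpow_mul (by positivity)]
    norm_cast
  rw [this]
  ring

theorem memLp_extField (hn : 2 ≤ n) (hs : s ∈ Set.Ioo (0 : ℝ) 1) (han : a + n = 2 - 2 * s)
    {φ : Euc m → ℝ} (hφ : IsTest φ) : MemLp (extField n s φ) 2 (weightedVolume m n a) := by
  refine ⟨(measurable_multField hφ (isMultiplier_profMult hs)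
    (isMultiplier_profDerivMult hs)).aestronglyMeasurable, ?_⟩
  have h := lintegral_extField_sq hn hs han hφ
  rw [← eLpNorm_two_sq] at h
  have h2 : eLpNorm (extField n s φ) 2 (weightedVolume m n a) ^ 2 < ⊤ := by
    rw [h]
    exact ENNReal.mul_lt_top ENNReal.ofReal_lt_top
      (ENNReal.pow_lt_top (hφ.memLp_fracLaplacian hs).2)
  exact (ENNReal.pow_lt_top_iff).1 h2 |>.resolve_right two_ne_zero

end HarmonicField

/-! ### Gradients on a product -/

section Slices

variable {m n : ℕ}

instance isAddHaarMeasure_volume_prod :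
    (volume : Measure (Euc m × Euc n)).IsAddHaarMeasure :=
  Measure.prod.instIsAddHaarMeasure volume volume

theorem IsTest.slice_left {ψ : Euc m × Euc n → ℝ} (h : IsTest ψ) (y : Euc n) :
    IsTest (fun x => ψ (x, y)) :=
  ⟨h.1.comp (by fun_prop), h.2.comp_isClosedEmbedding (Isometry.isClosedEmbedding (f := fun x => (x, y))
    (Isometry.of_dist_eq fun x x' => by simp [Prod.dist_eq]))⟩

theorem IsTest.slice_right {ψ : Euc m × Euc n → ℝ} (h : IsTest ψ) (x : Euc m) :
    IsTest (fun y => ψ (x, y)) :=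
  ⟨h.1.comp (by fun_prop), h.2.comp_isClosedEmbedding (Isometry.isClosedEmbedding (f := fun y => (x, y))
    (Isometry.of_dist_eq fun y y' => by simp [Prod.dist_eq]))⟩

theorem fderiv_slice_left {ψ : Euc m × Euc n → ℝ} {z : Euc m × Euc n} (h : DifferentiableAt ℝ ψ z)
    (v : Euc m) : fderiv ℝ (fun x => ψ (x, z.2)) z.1 v = fderiv ℝ ψ z (v, 0) := by
  have h1 : HasFDerivAt (fun x : Euc m => (x, z.2))
      (ContinuousLinearMap.inl ℝ (Euc m) (Euc n)) z.1 :=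
    hasFDerivAt_prodMk_left _ _
  have h2 : HasFDerivAt ψ (fderiv ℝ ψ z) (z.1, z.2) := h.hasFDerivAt
  have h3 : HasFDerivAt (fun x => ψ (x, z.2))
      ((fderiv ℝ ψ z).comp (ContinuousLinearMap.inl ℝ (Euc m) (Euc n))) z.1 := h2.comp z.1 h1
  rw [h3.fderiv]
  rfl

theorem fderiv_slice_right {ψ : Euc m × Euc n → ℝ} {z : Euc m × Euc n} (h : DifferentiableAt ℝ ψ z)
    (v : Euc n) : fderiv ℝ (fun y => ψ (z.1, y)) z.2 v = fderiv ℝ ψ z (0, v) := by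
  have h1 : HasFDerivAt (fun y : Euc n => (z.1, y))
      (ContinuousLinearMap.inr ℝ (Euc m) (Euc n)) z.2 :=
    hasFDerivAt_prodMk_right _ _
  have h2 : HasFDerivAt ψ (fderiv ℝ ψ z) (z.1, z.2) := h.hasFDerivAt
  have h3 : HasFDerivAt (fun y => ψ (z.1, y))
      ((fderiv ℝ ψ z).comp (ContinuousLinearMap.inr ℝ (Euc m) (Euc n))) z.2 := h2.comp z.2 h1
  rw [h3.fderiv]
  rfl

theorem inner_grad {ψ : Euc m × Euc n → ℝ} {z : Euc m × Euc n} (h : DifferentiableAt ℝ ψ z)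
    (w : WithLp 2 (Euc m × Euc n)) : inner ℝ w (grad ψ z) = fderiv ℝ ψ z w.ofLp := by
  rw [WithLp.prod_inner_apply]
  simp only [grad]
  rw [inner_gradient_right, inner_gradient_right, fderiv_slice_left h, fderiv_slice_right h,
    conj_trivial, conj_trivial, ← map_add, Prod.mk_add_mk, add_zero, zero_add]

end Slices

/-! ### Plane waves and integration by parts -/

section PlaneWave

variable {m n : ℕ} {a s : ℝ}

/-- The plane wave `e^{2πi ξ·x}`. -/
noncomputable def planeWave (ξ x : Euc m) : ℂ :=
  Complex.exp (((2 * Real.pi * inner ℝ ξ x : ℝ) : ℂ) * Complex.I)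

theorem norm_planeWave (ξ x : Euc m) : ‖planeWave ξ x‖ = 1 := Complex.norm_exp_ofReal_mul_I _

theorem continuous_planeWave : Continuous (fun p : Euc m × Euc m => planeWave p.1 p.2) := by
  unfold planeWave; fun_prop

theorem fourierInv_eq_planeWave (f : Euc m → ℂ) (x : Euc m) :
    𝓕⁻ f x = ∫ ξ, planeWave ξ x * f ξ := by
  rw [Real.fourierInv_eq']; rfl

theorem hasFDerivAt_planeWave (ξ x : Euc m) :
    HasFDerivAt (planeWave ξ)
      ((planeWave ξ x * (2 * Real.pi * Complex.I)) •
        (Complex.ofRealCLM.comp (innerSL ℝ ξ))) x := by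
  have h1 : HasFDerivAt (fun x => (((2 * Real.pi * inner ℝ ξ x : ℝ) : ℂ) * Complex.I))
      ((2 * Real.pi * Complex.I) • (Complex.ofRealCLM.comp (innerSL ℝ ξ))) x := by
    have h2 : HasFDerivAt (fun x : Euc m => (((innerSL ℝ ξ) x : ℝ) : ℂ))
      (Complex.ofRealCLM.comp (innerSL ℝ ξ)) x :=
      (Complex.ofRealCLM.comp (innerSL ℝ ξ)).hasFDerivAt
    refine (h2.const_mul (2 * Real.pi * Complex.I)).congr_of_eventuallyEq ?_
    filter_upwards with x
    simp only [innerSL_apply_apply]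
    push_cast
    ring
  refine h1.cexp.congr_fderiv ?_
  rw [smul_smul]
  rfl

/-- Integration by parts against a plane wave. -/
theorem integral_planeWave_mul_fderiv {f : Euc m → ℝ} (hf : IsTest f) (ξ : Euc m) :
    ∫ x, planeWave ξ x * (((2 * Real.pi * fderiv ℝ f x ξ : ℝ) : ℂ) * Complex.I) =
      (((2 * Real.pi * ‖ξ‖) ^ 2 : ℝ) : ℂ) * ∫ x, planeWave ξ x * (f x : ℂ) := by
  have hF : ContDiff ℝ ∞ (fun x => (f x : ℂ)) := Complex.ofRealCLM.contDiff.comp hf.1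
  have hFs : HasCompactSupport (fun x => (f x : ℂ)) :=
      hf.2.comp_left (g := fun r : ℝ => (r : ℂ)) rfl
  have hpc : Continuous (planeWave ξ) :=
    continuous_planeWave.comp (continuous_const.prodMk continuous_id)
  have hFd : ∀ x, fderiv ℝ (fun x => (f x : ℂ)) x ξ = ((fderiv ℝ f x ξ : ℝ) : ℂ) := fun x => by
    have h := ((hf.1.differentiable (by norm_num)) x).hasFDerivAt
    have h' : HasFDerivAt (fun x => (f x : ℂ)) (Complex.ofRealCLM.comp (fderiv ℝ f x)) x :=
      Complex.ofRealCLM.hasFDerivAt.comp x h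
    rw [h'.fderiv]
    rfl
  have hpd : ∀ x, fderiv ℝ (planeWave ξ) x ξ =
      planeWave ξ x * (2 * Real.pi * Complex.I) * ((‖ξ‖ ^ 2 : ℝ) : ℂ) := fun x => by
    rw [(hasFDerivAt_planeWave ξ x).fderiv]
    simp
  have hcd : Continuous (fun x => fderiv ℝ (fun x => (f x : ℂ)) x ξ) :=
    (hF.continuous_fderiv (by norm_num)).clm_apply continuous_const
  -- the derivative of the plane wave in the direction `ξ` produces the factor `2πi|ξ|²`
  have key := integral_mul_fderiv_eq_neg_fderiv_mul_of_integrable (μ := (volume : Measure (Euc m)))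
    (f := planeWave ξ) (g := fun x => (f x : ℂ)) (v := ξ) ?_ ?_ ?_
    (fun x _ => (hasFDerivAt_planeWave ξ x).differentiableAt)
    (fun x _ => (hF.differentiable (by norm_num)) x)
  · simp only [hFd, hpd] at key
    have e1 : ∫ x, planeWave ξ x * (((2 * Real.pi * fderiv ℝ f x ξ : ℝ) : ℂ) * Complex.I) =
        (2 * Real.pi * Complex.I) * ∫ x, planeWave ξ x * ((fderiv ℝ f x ξ : ℝ) : ℂ) := by
      rw [← integral_const_mul]
      congr 1; ext x; push_cast; ring
    have e2 : ∫ x, planeWave ξ x * (2 * Real.pi * Complex.I) * ((‖ξ‖ ^ 2 : ℝ) : ℂ) * (f x : ℂ) =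
        (2 * Real.pi * Complex.I) * ((‖ξ‖ ^ 2 : ℝ) : ℂ) * ∫ x, planeWave ξ x * (f x : ℂ) := by
      rw [← integral_const_mul]
      congr 1; ext x; ring
    rw [e1, key, e2]
    push_cast
    linear_combination (-(4 * (Real.pi : ℂ) ^ 2 * (‖ξ‖ : ℂ) ^ 2 * ∫ x, planeWave ξ x * (f x : ℂ))) *
      Complex.I_sq
  · refine Continuous.integrable_of_hasCompactSupport ?_ hFs.mul_left
    simp only [hpd]
    exact ((hpc.mul continuous_const).mul continuous_const).mul hF.continuous
  · exact (hpc.mul hcd).integrable_of_hasCompactSupport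
      ((hFs.fderiv_apply (𝕜 := ℝ) ξ).mul_left)
  · exact (hpc.mul hF.continuous).integrable_of_hasCompactSupport hFs.mul_left

theorem conj_specHat (f : Euc m → ℝ) (ξ : Euc m) :
    (starRingEnd ℂ) (specHat f ξ) = ∫ x, planeWave ξ x * (f x : ℂ) := by
  rw [← specHat_neg, specHat, Real.fourier_eq']
  congr 1
  ext x
  rw [planeWave, inner_neg_right, real_inner_comm]
  simp

end PlaneWave

/-! ### The weak equation for the extension of a test function -/

section Weak

variable {m n : ℕ} {a s : ℝ}

/-- An integrable function dominating, up to a factor depending on the frequency, the energy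
densities on the ball of radius `R`: the tangential part contributes `|y|^a`, the radial part
`|y|^{a+2s-1}`. -/
noncomputable def weightFn (a s R : ℝ) (z : Euc m × Euc n) : ℝ :=
  (Metric.ball (0 : Euc m) R).indicator 1 z.1 *
    (Metric.ball (0 : Euc n) R).indicator (fun y => ‖y‖ ^ a + ‖y‖ ^ (a + (2 * s - 1))) z.2

theorem integrable_weightFn (hn : 2 ≤ n) (hs : s ∈ Set.Ioo (0 : ℝ) 1) (han : a + n = 2 - 2 * s)
    (R : ℝ) : Integrable (weightFn a s R : Euc m × Euc n → ℝ) := by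
  have := nontrivial_euc' hn
  have b1 := integrableOn_norm_rpow_ball (volume : Measure (Euc n)) (p := a)
    (by rw [finrank_euclideanSpace_fin]; linarith [hs.2]) R
  have b2 := integrableOn_norm_rpow_ball (volume : Measure (Euc n)) (p := a + (2 * s - 1))
    (by rw [finrank_euclideanSpace_fin]; linarith [hs.2]) R
  have h1 := (integrable_indicator_iff measurableSet_ball).2 (b1.add b2)
  have h2 : Integrable ((Metric.ball (0 : Euc m) R).indicator (1 : Euc m → ℝ)) :=
    (integrable_indicator_iff measurableSet_ball).2
      (integrableOn_const (C := (1 : ℝ)) measure_ball_lt_top.ne)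
  exact h2.mul_prod h1

theorem weightFn_of_mem {R : ℝ} {z : Euc m × Euc n} (hz : z ∈ Metric.ball 0 R) :
    weightFn a s R z = ‖z.2‖ ^ a + ‖z.2‖ ^ (a + (2 * s - 1)) := by
  rw [mem_ball_zero_iff, Prod.norm_def, max_lt_iff] at hz
  rw [weightFn, Set.indicator_of_mem
      (by simpa using hz.1), Set.indicator_of_mem (by simpa using hz.2)]
  simp

theorem weightFn_nonneg (R : ℝ) (z : Euc m × Euc n) : 0 ≤ weightFn a s R z :=
  mul_nonneg (Set.indicator_nonneg (fun _ _ => zero_le_one) _)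
    (Set.indicator_nonneg (fun _ _ => by positivity) _)

theorem continuous_fderiv_pair {ψ : Euc m × Euc n → ℝ} (h : IsTest ψ) :
    Continuous (fun p : (Euc m × Euc n) × (Euc m × Euc n) => fderiv ℝ ψ p.1 p.2) :=
  ((h.1.continuous_fderiv (by norm_num)).comp continuous_fst).clm_apply continuous_snd

/-- The density, at frequency `ξ`, of the pairing of the extension field with `∇ψ`, without the
factor `e^{2πi ξ·x} φ̂(ξ)`. -/
noncomputable def pairKernel (s : ℝ) (ψ : Euc m × Euc n → ℝ) (ξ : Euc m) (z : Euc m × Euc n) : ℂ :=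
  ((2 * Real.pi * profMult n s ‖ξ‖ z.2 * fderiv ℝ ψ z (ξ, 0) : ℝ) : ℂ) * Complex.I +
    ((profDerivMult n s ‖ξ‖ z.2 * fderiv ℝ ψ z (0, ‖z.2‖⁻¹ • z.2) : ℝ) : ℂ)

theorem IsMultiplier.measurable_comp {α : ℝ → Euc n → ℝ} (hα : IsMultiplier α) {Ω : Type*}
    [MeasurableSpace Ω] {f : Ω → ℝ} {g : Ω → Euc n} (hf : Measurable f) (hg : Measurable g) :
    Measurable (fun x => α (f x) (g x)) :=
  hα.meas.comp (hf.prodMk hg)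

theorem measurable_tangential (hs : s ∈ Set.Ioo (0 : ℝ) 1) {ψ : Euc m × Euc n → ℝ}
    (h : IsTest ψ) : Measurable (fun p : (Euc m × Euc n) × Euc m =>
      2 * Real.pi * profMult n s ‖p.2‖ p.1.2 * fderiv ℝ ψ p.1 (p.2, 0)) := by
  have h1 : Measurable (fun p : (Euc m × Euc n) × Euc m => profMult n s ‖p.2‖ p.1.2) :=
    (isMultiplier_profMult hs).measurable_comp measurable_snd.norm
        (measurable_snd.comp measurable_fst)
  have h2 : Continuous (fun p : (Euc m × Euc n) × Euc m => fderiv ℝ ψ p.1 (p.2, 0)) :=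
    (continuous_fderiv_pair h).comp
      (continuous_fst.prodMk (continuous_snd.prodMk continuous_const))
  exact (h1.const_mul _).mul h2.measurable

theorem measurable_radial (hs : s ∈ Set.Ioo (0 : ℝ) 1) {ψ : Euc m × Euc n → ℝ}
    (h : IsTest ψ) : Measurable (fun p : (Euc m × Euc n) × Euc m =>
      profDerivMult n s ‖p.2‖ p.1.2 * fderiv ℝ ψ p.1 (0, ‖p.1.2‖⁻¹ • p.1.2)) := by
  have h1 : Measurable (fun p : (Euc m × Euc n) × Euc m => profDerivMult n s ‖p.2‖ p.1.2) :=
    (isMultiplier_profDerivMult hs).measurable_comp measurable_snd.norm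
      (measurable_snd.comp measurable_fst)
  have h2 : Measurable (fun p : (Euc m × Euc n) × Euc m =>
      (p.1, ((0 : Euc m), ‖p.1.2‖⁻¹ • p.1.2))) := by fun_prop
  exact h1.mul ((continuous_fderiv_pair h).measurable.comp h2)

/-- Domination of the tangential and of the radial part of the pairing density, and of the term into
which integration by parts in `x` transforms the tangential one. -/
theorem exists_pair_bound (hs : s ∈ Set.Ioo (0 : ℝ) 1) {ψ : Euc m × Euc n → ℝ} (h : IsTest ψ) :
    ∃ C R : ℝ, 0 ≤ C ∧ ∀ ξ : Euc m, ∀ z : Euc m × Euc n, z.2 ≠ 0 →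
      ‖z.2‖ ^ a * |2 * Real.pi * profMult n s ‖ξ‖ z.2 * fderiv ℝ ψ z (ξ, 0)| ≤
        C * (1 + ‖ξ‖) ^ 2 * weightFn a s R z ∧
      ‖z.2‖ ^ a * |profDerivMult n s ‖ξ‖ z.2 * fderiv ℝ ψ z (0, ‖z.2‖⁻¹ • z.2)| ≤
        C * (1 + ‖ξ‖) ^ 2 * weightFn a s R z ∧
      ‖z.2‖ ^ a * |(2 * Real.pi * ‖ξ‖) ^ 2 * profMult n s ‖ξ‖ z.2 * ψ z| ≤
        C * (1 + ‖ξ‖) ^ 2 * weightFn a s R z := by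
  obtain ⟨R, hR, hsub⟩ := h.2.isCompact.isBounded.subset_ball_lt 0 (0 : Euc m × Euc n)
  have hd' : Continuous (fderiv ℝ ψ) := h.1.continuous_fderiv (by norm_num)
  obtain ⟨D, hD⟩ := hd'.bounded_above_of_compact_support (h.2.fderiv (𝕜 := ℝ))
  obtain ⟨M, hM⟩ := h.continuous.bounded_above_of_compact_support h.2
  have hD0 : 0 ≤ D := (norm_nonneg _).trans (hD 0)
  have hM0 : 0 ≤ M := (norm_nonneg _).trans (hM 0)
  have hdt := dtnConst_pos hs
  set K : ℝ := 2 * Real.pi * D + dtnConst s * (2 * Real.pi) ^ (2 * s) * D +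
      (2 * Real.pi) ^ 2 * M with hK
  have k1 : 2 * Real.pi * D ≤ K := by
    have : 0 ≤ dtnConst s * (2 * Real.pi) ^ (2 * s) * D + (2 * Real.pi) ^ 2 * M := by positivity
    linarith
  have k2 : dtnConst s * (2 * Real.pi) ^ (2 * s) * D ≤ K := by
    have : 0 ≤ 2 * Real.pi * D + (2 * Real.pi) ^ 2 * M := by positivity
    linarith
  have k3 : (2 * Real.pi) ^ 2 * M ≤ K := by
    have : 0 ≤ 2 * Real.pi * D + dtnConst s * (2 * Real.pi) ^ (2 * s) * D := by positivity
    linarith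
  have hK0 : 0 ≤ K := by positivity
  refine ⟨K, R, hK0, fun ξ z hz => ?_⟩
  have hpos : 0 < ‖z.2‖ := norm_pos_iff.2 hz
  by_cases hzR : z ∈ Metric.ball (0 : Euc m × Euc n) R
  · have hx : 0 ≤ ‖ξ‖ := norm_nonneg ξ
    have hw := weightFn_of_mem (a := a) (s := s) hzR
    have w0 : ‖z.2‖ ^ a * ‖z.2‖ ^ (2 * s - 1) = ‖z.2‖ ^ (a + (2 * s - 1)) :=
        (Real.rpow_add hpos _ _).symm
    have w1 : ‖z.2‖ ^ a ≤ weightFn a s R z := by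
      rw [hw]; have : 0 ≤ ‖z.2‖ ^ (a + (2 * s - 1)) := by positivity
      linarith
    have w2 : ‖z.2‖ ^ (a + (2 * s - 1)) ≤ weightFn a s R z := by
      rw [hw]; have : 0 ≤ ‖z.2‖ ^ a := by positivity
      linarith
    have p1 : |profMult n s ‖ξ‖ z.2| ≤ 1 := by
      rw [profMult, abs_of_nonneg (profile_nonneg hs.1 _)]
      exact profile_le_one hs.1 (sq_nonneg _)
    have p2 : |profDerivMult n s ‖ξ‖ z.2| ≤
        dtnConst s * ((2 * Real.pi) ^ (2 * s) * (1 + ‖ξ‖) ^ 2) * ‖z.2‖ ^ (2 * s - 1) := by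
      refine (abs_profileDeriv_le hs (by positivity) hpos.le).trans ?_
      gcongr
      exact two_pi_mul_rpow_le (by linarith [hs.1]) (by linarith [hs.2]) hx
    have q1 : |fderiv ℝ ψ z (ξ, 0)| ≤ D * ‖ξ‖ := by
      refine ((fderiv ℝ ψ z).le_of_opNorm_le (hD z) _).trans ?_
      simp [Prod.norm_def]
    have q2 : |fderiv ℝ ψ z (0, ‖z.2‖⁻¹ • z.2)| ≤ D := by
      refine ((fderiv ℝ ψ z).le_of_opNorm_le (hD z) _).trans ?_
      refine mul_le_of_le_one_right hD0 ?_
      rw [Prod.norm_def, norm_zero]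
      exact max_le zero_le_one (norm_inv_smul_le _)
    have hx1 : ‖ξ‖ ≤ (1 + ‖ξ‖) ^ 2 := by nlinarith
    have hx2 : ‖ξ‖ ^ 2 ≤ (1 + ‖ξ‖) ^ 2 := by nlinarith
    refine ⟨?_, ?_, ?_⟩
    · have t : |2 * Real.pi * profMult n s ‖ξ‖ z.2 * fderiv ℝ ψ z (ξ, 0)| ≤ K * (1 + ‖ξ‖) ^ 2 := by
        rw [abs_mul, abs_mul, abs_of_pos Real.two_pi_pos]
        calc _ ≤ 2 * Real.pi * 1 * (D * ‖ξ‖) := by gcongr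
          _ = 2 * Real.pi * D * ‖ξ‖ := by ring
          _ ≤ _ := by gcongr
      calc _ ≤ weightFn a s R z * (K * (1 + ‖ξ‖) ^ 2) := by gcongr; exact weightFn_nonneg _ _
        _ = _ := by ring
    · rw [abs_mul]
      calc _ ≤ ‖z.2‖ ^ a * (dtnConst s * ((2 * Real.pi) ^ (2 * s) * (1 + ‖ξ‖) ^ 2) *
            ‖z.2‖ ^ (2 * s - 1) * D) := by gcongr
        _ = (dtnConst s * (2 * Real.pi) ^ (2 * s) * D) * (1 + ‖ξ‖) ^ 2 *
            ‖z.2‖ ^ (a + (2 * s - 1)) := by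
            rw [← w0]; ring
        _ ≤ _ := by gcongr
    · have t : |(2 * Real.pi * ‖ξ‖) ^ 2 * profMult n s ‖ξ‖ z.2 * ψ z| ≤ K * (1 + ‖ξ‖) ^ 2 := by
        rw [abs_mul, abs_mul, abs_of_nonneg (by positivity : 0 ≤ (2 * Real.pi * ‖ξ‖) ^ 2)]
        calc _ ≤ (2 * Real.pi * ‖ξ‖) ^ 2 * 1 * M := by gcongr; exact hM z
          _ = (2 * Real.pi) ^ 2 * M * ‖ξ‖ ^ 2 := by ring
          _ ≤ _ := by gcongr
      calc _ ≤ weightFn a s R z * (K * (1 + ‖ξ‖) ^ 2) := by gcongr; exact weightFn_nonneg _ _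
        _ = _ := by ring
  · have hz' : z ∉ tsupport ψ := fun h => hzR (hsub h)
    have h1 : fderiv ℝ ψ z = 0 := fderiv_of_notMem_tsupport ℝ hz'
    have h2 : ψ z = 0 := image_eq_zero_of_notMem_tsupport hz'
    have h3 := weightFn_nonneg (a := a) (s := s) R z
    have : 0 ≤ K * (1 + ‖ξ‖) ^ 2 * weightFn a s R z := by positivity
    simp [h1, h2, this]

/-- A linear form applied to a synthesized field, on the Fourier side. -/
theorem apply_multField {α β : ℝ → Euc n → ℝ} (hα : IsMultiplier α) (hβ : IsMultiplier β)
    {φ : Euc m → ℝ} (hφ : IsTest φ) (L : (Euc m × Euc n) →L[ℝ] ℝ) {z : Euc m × Euc n}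
    (hz : z.2 ≠ 0) :
    L (multField φ α β z).ofLp =
      (∫ ξ, planeWave ξ z.1 * ((((2 * Real.pi * α ‖ξ‖ z.2 * L (ξ, 0) : ℝ) : ℂ) * Complex.I +
        ((β ‖ξ‖ z.2 * L (0, ‖z.2‖⁻¹ • z.2) : ℝ) : ℂ)) * specHat φ ξ)).re := by
  have iX := fun j : Fin m => ((hα.isSymbol_symX j).integrable hφ hz)
  have iN := (hβ.isSymbol_symN (m := m)).integrable hφ hz
  have hpw : AEStronglyMeasurable (fun ξ => planeWave ξ z.1) volume :=
    (continuous_planeWave.comp (continuous_id.prodMk continuous_const)).aestronglyMeasurable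
  have wv : ∀ {f : Euc m → ℂ},
      Integrable f → Integrable (fun ξ => planeWave ξ z.1 * f ξ) := fun hf =>
    hf.bdd_mul (c := 1) hpw (Eventually.of_forall fun ξ => (norm_planeWave ξ _).le)
  set p : Fin m → ℝ := fun j => L (EuclideanSpace.single j 1, 0) with hp
  set q : ℝ := L (0, ‖z.2‖⁻¹ • z.2) with hq
  have hsum : ∀ v : Euc m, L (v, 0) = ∑ j, v j * p j := by
    intro v
    have hv : v = ∑ j, v j • (EuclideanSpace.single j (1 : ℝ) : Euc m) := by
      ext i
      simp [Finset.sum_apply, Pi.single_apply]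
    have e : (v, (0 : Euc n)) = ContinuousLinearMap.inl ℝ (Euc m) (Euc n) v := rfl
    conv_lhs => rw [e, hv]
    rw [map_sum, map_sum]
    refine Finset.sum_congr rfl fun j _ => ?_
    rw [map_smul, map_smul, smul_eq_mul]
    rfl
  have e1 : L (multField φ α β z).ofLp =
      ∑ j, synth φ (symX α j) z * p j + synth φ (symN β) z * q := by
    have : (multField φ α β z).ofLp =
        ((WithLp.toLp 2 (fun j => synth φ (symX α j) z) : Euc m), (0 : Euc n)) +
        synth φ (symN β) z • ((0 : Euc m), ‖z.2‖⁻¹ • z.2) := by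
      simp [multField]
    rw [this, map_add, map_smul, hsum]
    rfl
  have e2 : (fun ξ => planeWave ξ z.1 *
      ((((2 * Real.pi * α ‖ξ‖ z.2 * L (ξ, 0) : ℝ) : ℂ) * Complex.I +
        ((β ‖ξ‖ z.2 * L (0, ‖z.2‖⁻¹ • z.2) : ℝ) : ℂ)) * specHat φ ξ)) = fun ξ =>
      (∑ j, (p j : ℂ) * (planeWave ξ z.1 * (symX α j ξ z.2 * specHat φ ξ))) +
      (q : ℂ) * (planeWave ξ z.1 * (symN β ξ z.2 * specHat φ ξ)) := by
    ext ξ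
    rw [hsum, ← hq]
    have : ∑ j, (p j : ℂ) * (planeWave ξ z.1 * (symX α j ξ z.2 * specHat φ ξ)) =
        planeWave ξ z.1 * specHat φ ξ * (((2 * Real.pi * α ‖ξ‖ z.2 *
          ∑ j, ξ j * p j : ℝ) : ℂ) * Complex.I) := by
      push_cast
      rw [Finset.mul_sum, Finset.sum_mul, Finset.mul_sum]
      refine Finset.sum_congr rfl fun j _ => ?_
      simp only [symX]
      push_cast
      ring
    rw [this]
    simp only [symN]
    push_cast
    ring
  rw [e1, e2, integral_add (integrable_finsetSum _ fun j _ => (wv (iX j)).const_mul _)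
    ((wv iN).const_mul _), integral_finsetSum _ fun j _ => (wv (iX j)).const_mul _]
  simp only [integral_const_mul, Complex.add_re, Complex.re_sum, Complex.re_ofReal_mul, synth,
    fourierInv_eq_planeWave]
  congr 1
  · exact Finset.sum_congr rfl fun j _ => mul_comm _ _
  · exact mul_comm _ _

theorem inner_extField_grad (hs : s ∈ Set.Ioo (0 : ℝ) 1) {φ : Euc m → ℝ} (hφ : IsTest φ)
    {ψ : Euc m × Euc n → ℝ} (hψ : IsTest ψ) {z : Euc m × Euc n} (hz : z.2 ≠ 0) :
    inner ℝ (extField n s φ z) (grad ψ z) =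
      (∫ ξ, planeWave ξ z.1 * (pairKernel s ψ ξ z * specHat φ ξ)).re := by
  rw [inner_grad ((hψ.1.differentiable (by norm_num)) z)]
  exact apply_multField (isMultiplier_profMult hs) (isMultiplier_profDerivMult hs) hφ _ hz

end Weak

section WeakForm

variable {m n : ℕ} {a s : ℝ}

theorem measurable_slice_tangential (hs : s ∈ Set.Ioo (0 : ℝ) 1) {ψ : Euc m × Euc n → ℝ}
    (h : IsTest ψ) (ξ : Euc m) : Measurable (fun z : Euc m × Euc n =>
      2 * Real.pi * profMult n s ‖ξ‖ z.2 * fderiv ℝ ψ z (ξ, 0)) := by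
  have h1 : Measurable (fun z : Euc m × Euc n => profMult n s ‖ξ‖ z.2) :=
    (isMultiplier_profMult hs).measurable_comp measurable_const measurable_snd
  have h2 : Continuous (fun z : Euc m × Euc n => fderiv ℝ ψ z (ξ, 0)) :=
    (continuous_fderiv_pair h).comp (continuous_id.prodMk continuous_const)
  exact (h1.const_mul _).mul h2.measurable

theorem measurable_slice_radial (hs : s ∈ Set.Ioo (0 : ℝ) 1) {ψ : Euc m × Euc n → ℝ}
    (h : IsTest ψ) (ξ : Euc m) : Measurable (fun z : Euc m × Euc n =>
      profDerivMult n s ‖ξ‖ z.2 * fderiv ℝ ψ z (0, ‖z.2‖⁻¹ • z.2)) := by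
  have h1 : Measurable (fun z : Euc m × Euc n => profDerivMult n s ‖ξ‖ z.2) :=
    (isMultiplier_profDerivMult hs).measurable_comp measurable_const measurable_snd
  have h2 : Measurable (fun z : Euc m × Euc n => (z, ((0 : Euc m), ‖z.2‖⁻¹ • z.2))) := by fun_prop
  exact h1.mul ((continuous_fderiv_pair h).measurable.comp h2)

theorem measurable_slice_value (hs : s ∈ Set.Ioo (0 : ℝ) 1) {ψ : Euc m × Euc n → ℝ}
    (h : IsTest ψ) (ξ : Euc m) : Measurable (fun z : Euc m × Euc n =>
      (2 * Real.pi * ‖ξ‖) ^ 2 * profMult n s ‖ξ‖ z.2 * ψ z) := by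
  have h1 : Measurable (fun z : Euc m × Euc n => profMult n s ‖ξ‖ z.2) :=
    (isMultiplier_profMult hs).measurable_comp measurable_const measurable_snd
  exact (h1.const_mul _).mul h.continuous.measurable

theorem integrable_weight_mul_planeWave (hn : 2 ≤ n) (hs : s ∈ Set.Ioo (0 : ℝ) 1)
    (han : a + n = 2 - 2 * s) {K R : ℝ} {f : Euc m × Euc n → ℝ} (hf : Measurable f) (ξ : Euc m)
    {c : ℂ} (hc : ‖c‖ = 1) (hb : ∀ z : Euc m × Euc n, z.2 ≠ 0 →
      ‖z.2‖ ^ a * |f z| ≤ K * weightFn a s R z) :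
    Integrable (fun z => ((‖z.2‖ ^ a : ℝ) : ℂ) * (planeWave ξ z.1 * ((f z : ℂ) * c))) := by
  have hpw : Continuous (fun z : Euc m × Euc n => planeWave ξ z.1) :=
    continuous_planeWave.comp (continuous_const.prodMk continuous_fst)
  have hwt : Measurable (fun z : Euc m × Euc n => ((‖z.2‖ ^ a : ℝ) : ℂ)) :=
    Complex.measurable_ofReal.comp (measurable_snd.norm.pow_const a)
  refine ((integrable_weightFn hn hs han R).const_mul K).mono' (hwt.mul (hpw.measurable.mul
    ((Complex.measurable_ofReal.comp hf).mul_const c))).aestronglyMeasurable ?_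
  filter_upwards [ae_snd_ne_zero (m := m) hn] with z hz
  rw [norm_mul, norm_mul, norm_mul, norm_planeWave, one_mul, hc, mul_one, Complex.norm_real,
    Complex.norm_real, Real.norm_of_nonneg (by positivity)]
  exact hb z hz

/-- The tangential part of the pairing at a fixed frequency, integrated by parts in `x`. -/
theorem integral_tangential {ψ : Euc m × Euc n → ℝ} (hψ : IsTest ψ) (ξ : Euc m)
    (i1 : Integrable (fun z : Euc m × Euc n => ((‖z.2‖ ^ a : ℝ) : ℂ) * (planeWave ξ z.1 *
      (((2 * Real.pi * profMult n s ‖ξ‖ z.2 * fderiv ℝ ψ z (ξ, 0) : ℝ) : ℂ) * Complex.I))))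
    (i3 : Integrable (fun z : Euc m × Euc n => ((‖z.2‖ ^ a : ℝ) : ℂ) * (planeWave ξ z.1 *
      ((((2 * Real.pi * ‖ξ‖) ^ 2 * profMult n s ‖ξ‖ z.2 * ψ z : ℝ) : ℂ) * 1)))) :
    ∫ z : Euc m × Euc n, ((‖z.2‖ ^ a : ℝ) : ℂ) * (planeWave ξ z.1 *
      (((2 * Real.pi * profMult n s ‖ξ‖ z.2 * fderiv ℝ ψ z (ξ, 0) : ℝ) : ℂ) * Complex.I)) =
    ∫ z : Euc m × Euc n, ((‖z.2‖ ^ a : ℝ) : ℂ) * (planeWave ξ z.1 *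
      ((((2 * Real.pi * ‖ξ‖) ^ 2 * profMult n s ‖ξ‖ z.2 * ψ z : ℝ) : ℂ) * 1)) := by
  rw [Measure.volume_eq_prod] at i1 i3 ⊢
  rw [integral_prod_symm _ i1, integral_prod_symm _ i3]
  congr 1
  ext y
  have h := integral_planeWave_mul_fderiv (hψ.slice_left y) ξ
  have hd : ∀ x, fderiv ℝ (fun x => ψ (x, y)) x ξ = fderiv ℝ ψ (x, y) (ξ, 0) := fun x =>
    fderiv_slice_left (z := (x, y)) ((hψ.1.differentiable (by norm_num)) _) ξ
  simp only [hd] at h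
  calc _ = ∫ x, (((‖y‖ ^ a * profMult n s ‖ξ‖ y : ℝ) : ℂ)) * (planeWave ξ x *
        (((2 * Real.pi * fderiv ℝ ψ (x, y) (ξ, 0) : ℝ) : ℂ) * Complex.I)) := by
        congr 1; ext x; push_cast; ring
    _ = ∫ x, (((‖y‖ ^ a * profMult n s ‖ξ‖ y : ℝ) : ℂ)) * ((((2 * Real.pi * ‖ξ‖) ^ 2 : ℝ) : ℂ) *
        (planeWave ξ x * (ψ (x, y) : ℂ))) := by
        rw [integral_const_mul, h, integral_const_mul, integral_const_mul]
    _ = _ := by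
        congr 1; ext x; push_cast; ring

/-- The pairing at a fixed frequency. Integrating by parts in `x` replaces the tangential part by
`|2πξ|² θ_s ψ`; together with the radial part this is the weak equation of the profile in `y`. -/
theorem integral_pairKernel (hn : 2 ≤ n) (hs : s ∈ Set.Ioo (0 : ℝ) 1) (han : a + n = 2 - 2 * s)
    {ψ : Euc m × Euc n → ℝ} (hψ : IsTest ψ) (ξ : Euc m) :
    ∫ z, ((‖z.2‖ ^ a : ℝ) : ℂ) * (planeWave ξ z.1 * pairKernel s ψ ξ z) =
      ((energyConst n s * (2 * Real.pi * ‖ξ‖) ^ (2 * s) : ℝ) : ℂ) *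
        ∫ x, planeWave ξ x * (ψ (x, 0) : ℂ) := by
  obtain ⟨C, R, -, hb⟩ := exists_pair_bound (a := a) hs hψ
  have i1 := integrable_weight_mul_planeWave hn hs han (measurable_slice_tangential hs hψ ξ) ξ
    Complex.norm_I (fun z hz => (hb ξ z hz).1)
  have i2 := integrable_weight_mul_planeWave hn hs han (measurable_slice_radial hs hψ ξ) ξ
    norm_one (fun z hz => (hb ξ z hz).2.1)
  have i3 := integrable_weight_mul_planeWave hn hs han (measurable_slice_value hs hψ ξ) ξ
    norm_one (fun z hz => (hb ξ z hz).2.2)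
  have e13 := integral_tangential hψ ξ i1 i3
  have i32 := i3.add i2
  have e0 := (integral_add i1 i2).trans
      ((congrArg₂ (· + ·) e13 rfl).trans (integral_add i3 i2).symm)
  have hpt : ∀ z : Euc m × Euc n, ((‖z.2‖ ^ a : ℝ) : ℂ) * (planeWave ξ z.1 * pairKernel s ψ ξ z) =
      ((‖z.2‖ ^ a : ℝ) : ℂ) * (planeWave ξ z.1 *
        (((2 * Real.pi * profMult n s ‖ξ‖ z.2 * fderiv ℝ ψ z (ξ, 0) : ℝ) : ℂ) * Complex.I)) +
      ((‖z.2‖ ^ a : ℝ) : ℂ) * (planeWave ξ z.1 *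
        (((profDerivMult n s ‖ξ‖ z.2 * fderiv ℝ ψ z (0, ‖z.2‖⁻¹ • z.2) : ℝ) : ℂ) * 1)) := by
    intro z
    rw [pairKernel, mul_add, mul_add, mul_one]
  refine (integral_congr_ae (Eventually.of_forall hpt)).trans (e0.trans ?_)
  rw [← integral_const_mul]
  rw [Measure.volume_eq_prod] at i32 ⊢
  refine (integral_prod _ i32).trans ?_
  congr 1
  ext x
  have hk := integral_profile_weak_normal hn hs han (by positivity : 0 ≤ 2 * Real.pi * ‖ξ‖)
    ((hψ.slice_right x).1.of_le (by norm_cast)) (hψ.slice_right x).2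
  have hd : ∀ y v, fderiv ℝ (fun y => ψ (x, y)) y v = fderiv ℝ ψ (x, y) (0, v) := fun y v =>
    fderiv_slice_right (z := (x, y)) ((hψ.1.differentiable (by norm_num)) _) v
  simp only [hd] at hk
  calc _ = ∫ y, planeWave ξ x * (((‖y‖ ^ a * ((2 * Real.pi * ‖ξ‖) ^ 2 *
        profile s ((2 * Real.pi * ‖ξ‖ * ‖y‖) ^ 2) * ψ (x, y) +
        profileDeriv s (2 * Real.pi * ‖ξ‖) ‖y‖ * fderiv ℝ ψ (x, y) (0, ‖y‖⁻¹ • y)) : ℝ)) : ℂ) := by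
        congr 1; ext y
        simp only [Pi.add_apply, profMult, profDerivMult]
        generalize profile s ((2 * Real.pi * ‖ξ‖ * ‖y‖) ^ 2) = p
        generalize profileDeriv s (2 * Real.pi * ‖ξ‖) ‖y‖ = q
        push_cast; ring
    _ = _ := by
        rw [integral_const_mul, integral_complex_ofReal, hk, energyConst]
        push_cast
        ring

/-- The weak form of the extension problem for test functions: the pairing of the extension field
with `∇ψ` is the pairing of the traces in `𝓓^s`. -/
theorem integral_inner_extField (hn : 2 ≤ n) (hs : s ∈ Set.Ioo (0 : ℝ) 1)
    (han : a + n = 2 - 2 * s) {φ : Euc m → ℝ} (hφ : IsTest φ) {ψ : Euc m × Euc n → ℝ}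
    (hψ : IsTest ψ) :
    ∫ z, inner ℝ (extField n s φ z) (grad ψ z) ∂(weightedVolume m n a) =
      energyConst n s *
        ∫ x, fracLaplacian (s / 2) φ x * fracLaplacian (s / 2) (fun t => ψ (t, 0)) x := by
  obtain ⟨C, R, hC0, hb⟩ := exists_pair_bound (a := a) hs hψ
  set J : Euc m × Euc n → Euc m → ℂ := fun z ξ =>
    ((‖z.2‖ ^ a : ℝ) : ℂ) * (planeWave ξ z.1 * pairKernel s ψ ξ z) * specHat φ ξ with hJ
  have hne := ae_snd_ne_zero (m := m) hn
  -- the double integral of `J` over `z` and `ξ` is the pairing; the order of integration is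
  -- exchanged
  have hJm : Measurable (Function.uncurry J) := by
    have h1 := measurable_tangential hs hψ
    have h2 := measurable_radial hs hψ
    have hk : Measurable (fun p : (Euc m × Euc n) × Euc m => pairKernel s ψ p.2 p.1) :=
      ((Complex.measurable_ofReal.comp h1).mul_const Complex.I).add
          (Complex.measurable_ofReal.comp h2)
    have hp : Continuous (fun p : (Euc m × Euc n) × Euc m => planeWave p.2 p.1.1) :=
      continuous_planeWave.comp (continuous_snd.prodMk (continuous_fst.comp continuous_fst))
    have hwt : Measurable (fun p : (Euc m × Euc n) × Euc m => ((‖p.1.2‖ ^ a : ℝ) : ℂ)) :=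
      Complex.measurable_ofReal.comp ((measurable_snd.comp measurable_fst).norm.pow_const a)
    exact (hwt.mul (hp.measurable.mul hk)).mul
        (hφ.continuous_specHat.measurable.comp measurable_snd)
  have hJi : Integrable (Function.uncurry J) ((volume : Measure (Euc m × Euc n)).prod volume) := by
    have hw := ((integrable_weightFn (m := m) hn hs han R).const_mul (2 * C)).mul_prod
      (hφ.integrable_pow_mul_specHat 2)
    refine hw.mono' hJm.aestronglyMeasurable ?_
    filter_upwards [Measure.quasiMeasurePreserving_fst.ae hne] with p hp
    obtain ⟨b1, b2, -⟩ := hb p.2 p.1 hp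
    simp only [Function.uncurry, hJ, norm_mul, norm_planeWave, one_mul, Complex.norm_real]
    rw [Real.norm_of_nonneg (by positivity)]
    have hk : ‖p.1.2‖ ^ a * ‖pairKernel s ψ p.2 p.1‖ ≤
        2 * C * weightFn a s R p.1 * (1 + ‖p.2‖) ^ 2 := by
      calc _ ≤ ‖p.1.2‖ ^ a * (|2 * Real.pi * profMult n s ‖p.2‖ p.1.2 * fderiv ℝ ψ p.1 (p.2, 0)| +
            |profDerivMult n s ‖p.2‖ p.1.2 * fderiv ℝ ψ p.1 (0, ‖p.1.2‖⁻¹ • p.1.2)|) := by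
            gcongr
            refine (norm_add_le _ _).trans (le_of_eq ?_)
            rw [norm_mul, Complex.norm_I, mul_one, Complex.norm_real, Complex.norm_real]
            rfl
        _ ≤ _ := by rw [mul_add]; linarith
    calc _ ≤ 2 * C * weightFn a s R p.1 * (1 + ‖p.2‖) ^ 2 * ‖specHat φ p.2‖ := by gcongr
      _ = _ := by ring
  have e1 : ∫ z, inner ℝ (extField n s φ z) (grad ψ z) ∂(weightedVolume m n a) =
      ∫ z, (∫ ξ, J z ξ).re := by
    rw [integral_weightedVolume]
    apply integral_congr_ae
    filter_upwards [hne] with z hz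
    rw [inner_extField_grad hs hφ hψ hz, ← Complex.re_ofReal_mul, ← integral_const_mul]
    congr 2
    ext ξ
    simp only [hJ]
    ring
  have e2 : ∫ z, (∫ ξ, J z ξ).re = (∫ z, ∫ ξ, J z ξ).re :=
    integral_re hJi.integral_prod_left
  have e3 : ∫ z, ∫ ξ, J z ξ = ∫ ξ, ∫ z, J z ξ := integral_integral_swap hJi
  rw [e1, e2, e3]
  have hψ0 := hψ.slice_left (0 : Euc n)
  have e4 : ∀ x, fracLaplacian (s / 2) φ x * fracLaplacian (s / 2) (fun t => ψ (t, 0)) x =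
      fracLaplacian (s / 2) (fun t => ψ (t, 0)) x * fracLaplacian (s / 2) φ x :=
          fun x => mul_comm _ _
  simp only [e4]
  rw [hψ0.integral_fracLaplacian_mul hφ hs, mul_comm, ← Complex.re_mul_ofReal, ← integral_mul_const]
  congr 2
  ext ξ
  simp only [hJ]
  rw [integral_mul_const, integral_pairKernel hn hs han hψ, ← conj_specHat (fun x => ψ (x, 0))]
  have hpow : (2 * Real.pi * ‖ξ‖) ^ (2 * s) =
      (2 * Real.pi * ‖ξ‖) ^ s * (2 * Real.pi * ‖ξ‖) ^ s := by
    rw [← Real.rpow_add_of_nonneg (by positivity) hs.1.le hs.1.le, two_mul s]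
  rw [hpow, RCLike.inner_apply]
  simp only [halfAmp, map_mul, Complex.conj_ofReal]
  push_cast
  ring

end WeakForm

/-! ### Energies and the trace inequality -/

section HilbertNorm

variable {α E : Type*} [MeasurableSpace α] {μ : Measure α} [NormedAddCommGroup E]

theorem ofReal_integral_norm_sq {f : α → E} (hf : MemLp f 2 μ) :
    ENNReal.ofReal (∫ x, ‖f x‖ ^ 2 ∂μ) = eLpNorm f 2 μ ^ 2 := by
  rw [eLpNorm_two_sq, ofReal_integral_eq_lintegral_ofReal (hf.integrable_norm_pow two_ne_zero)
    (Eventually.of_forall fun x => by positivity)]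
  refine lintegral_congr fun x => ?_
  rw [ENNReal.ofReal_pow (norm_nonneg _), ofReal_norm]

theorem integral_norm_sq_eq {f : α → E} (hf : MemLp f 2 μ) :
    ∫ x, ‖f x‖ ^ 2 ∂μ = (eLpNorm f 2 μ).toReal ^ 2 := by
  rw [← ENNReal.toReal_pow, ← ofReal_integral_norm_sq hf, ENNReal.toReal_ofReal]
  exact integral_nonneg fun x => by positivity

variable [InnerProductSpace ℝ E]

theorem integrable_inner {f g : α → E} (hf : MemLp f 2 μ) (hg : MemLp g 2 μ) :
    Integrable (fun x => inner ℝ (f x) (g x)) μ :=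
  (hf.norm.integrable_mul hg.norm).mono' (hf.1.inner hg.1)
    (Eventually.of_forall fun _ => norm_inner_le_norm _ _)

theorem integral_norm_sub_sq {f g : α → E} (hf : MemLp f 2 μ) (hg : MemLp g 2 μ) :
    ∫ x, ‖(f - g) x‖ ^ 2 ∂μ =
      ∫ x, ‖f x‖ ^ 2 ∂μ - 2 * ∫ x, inner ℝ (f x) (g x) ∂μ + ∫ x, ‖g x‖ ^ 2 ∂μ := by
  have i1 : Integrable (fun x => ‖f x‖ ^ 2) μ := hf.integrable_norm_pow two_ne_zero
  have i2 : Integrable (fun x => ‖g x‖ ^ 2) μ := hg.integrable_norm_pow two_ne_zero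
  have i3 : Integrable (fun x => 2 * inner ℝ (f x) (g x)) μ := (integrable_inner hf hg).const_mul 2
  have e := integral_add (i1.sub i3) i2
  rw [integral_sub' i1 i3] at e
  rw [← integral_const_mul, ← e]
  congr 1
  ext x
  exact norm_sub_sq_real _ _

/-- Continuity of the `L²` pairing along an `L²`-convergent sequence. -/
theorem tendsto_integral_inner {f : α → E} {g : ℕ → α → E} {g' : α → E} (hf : MemLp f 2 μ)
    (hg : ∀ k, MemLp (g k) 2 μ) (hg' : MemLp g' 2 μ)
    (h : Tendsto (fun k => eLpNorm (g k - g') 2 μ) atTop (𝓝 0)) :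
    Tendsto (fun k => ∫ x, inner ℝ (f x) (g k x) ∂μ) atTop (𝓝 (∫ x, inner ℝ (f x) (g' x) ∂μ)) := by
  rw [tendsto_iff_edist_tendsto_0]
  have hb : ∀ k, edist (∫ x, inner ℝ (f x) (g k x) ∂μ) (∫ x, inner ℝ (f x) (g' x) ∂μ) ≤
      eLpNorm f 2 μ * eLpNorm (g k - g') 2 μ := fun k => by
    rw [edist_eq_enorm_sub, ← integral_sub (integrable_inner hf (hg k)) (integrable_inner hf hg')]
    refine (enorm_integral_le_lintegral_enorm _).trans ?_
    refine le_trans (lintegral_mono fun x => ?_)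
      (lintegral_enorm_mul_le_eLpNorm_two hf.1 ((hg k).sub hg').1)
    rw [← inner_sub_right, ← ofReal_norm, ← ofReal_norm, ← ofReal_norm,
      ← ENNReal.ofReal_mul (norm_nonneg _)]
    exact ENNReal.ofReal_le_ofReal (norm_inner_le_norm _ _)
  refine tendsto_of_tendsto_of_tendsto_of_le_of_le tendsto_const_nhds ?_ (fun _ => zero_le) hb
  simpa using ENNReal.Tendsto.const_mul h (Or.inr hf.2.ne)

end HilbertNorm

section TraceInequality

variable {m n : ℕ} {a s : ℝ}

/-- The vector of `ℝ^m × ℝ^n`, with the Euclidean inner product, representing a linear form;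
`grad ψ z` is the vector of `fderiv ℝ ψ z` (see `grad_eq_rieszPair`). The space `Euc m × Euc n`
itself carries the maximum norm. -/
noncomputable def rieszPair (L : (Euc m × Euc n) →L[ℝ] ℝ) : WithLp 2 (Euc m × Euc n) :=
  WithLp.toLp 2 ((InnerProductSpace.toDual ℝ (Euc m)).symm (L.comp (.inl ℝ (Euc m) (Euc n))),
    (InnerProductSpace.toDual ℝ (Euc n)).symm (L.comp (.inr ℝ (Euc m) (Euc n))))

theorem inner_rieszPair (L : (Euc m × Euc n) →L[ℝ] ℝ) (w : WithLp 2 (Euc m × Euc n)) :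
    inner ℝ w (rieszPair L) = L w.ofLp := by
  rw [WithLp.prod_inner_apply, real_inner_comm, real_inner_comm _ (WithLp.ofLp w).2]
  simp only [rieszPair, InnerProductSpace.toDual_symm_apply]
  simp [← map_add]
  rfl

theorem continuous_rieszPair : Continuous (rieszPair : ((Euc m × Euc n) →L[ℝ] ℝ) → _) := by
  refine (WithLp.prod_continuous_toLp 2 (Euc m) (Euc n)).comp (Continuous.prodMk ?_ ?_)
  · exact (LinearIsometryEquiv.continuous _).comp (continuous_id.clm_comp continuous_const)
  · exact (LinearIsometryEquiv.continuous _).comp (continuous_id.clm_comp continuous_const)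

theorem grad_eq_rieszPair {ψ : Euc m × Euc n → ℝ} {z : Euc m × Euc n} (h : DifferentiableAt ℝ ψ z) :
    grad ψ z = rieszPair (fderiv ℝ ψ z) :=
  ext_inner_left ℝ fun w => by rw [inner_grad h, inner_rieszPair]

theorem rieszPair_zero : rieszPair (0 : (Euc m × Euc n) →L[ℝ] ℝ) = 0 :=
  ext_inner_left ℝ fun w => by rw [inner_rieszPair]; simp

theorem norm_rieszPair_le (L : (Euc m × Euc n) →L[ℝ] ℝ) : ‖rieszPair L‖ ≤ ‖L‖ := by
  have h : ‖rieszPair L‖ * ‖rieszPair L‖ ≤ ‖L‖ * ‖rieszPair L‖ := by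
    rw [← real_inner_self_eq_norm_mul_norm, inner_rieszPair]
    refine (le_abs_self _).trans ((L.le_opNorm _).trans ?_)
    gcongr
    rw [Prod.norm_def]
    refine max_le ?_ ?_
    · exact WithLp.norm_fst_le _ _
    · exact WithLp.norm_snd_le _ _
  rcases (norm_nonneg (rieszPair L)).eq_or_lt with h0 | h0
  · rw [← h0]; exact norm_nonneg _
  · exact le_of_mul_le_mul_right h h0

theorem IsTest.differentiable {X : Type*} [NormedAddCommGroup X] [NormedSpace ℝ X] {φ : X → ℝ}
    (h : IsTest φ) : Differentiable ℝ φ :=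
  h.1.differentiable (by norm_num)

theorem IsTest.grad_eq {ψ : Euc m × Euc n → ℝ} (hψ : IsTest ψ) :
    grad ψ = fun z => rieszPair (fderiv ℝ ψ z) :=
  funext fun z => grad_eq_rieszPair (hψ.differentiable z)

theorem continuous_grad {ψ : Euc m × Euc n → ℝ} (hψ : IsTest ψ) : Continuous (grad ψ) := by
  rw [hψ.grad_eq]
  exact continuous_rieszPair.comp (hψ.1.continuous_fderiv (by norm_num))

theorem hasCompactSupport_grad {ψ : Euc m × Euc n → ℝ} (hψ : IsTest ψ) :
    HasCompactSupport (grad ψ) := by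
  rw [hψ.grad_eq]
  exact (hψ.2.fderiv (𝕜 := ℝ)).comp_left rieszPair_zero

theorem memLp_grad (hn : 2 ≤ n) (ha : -(n : ℝ) < a) {ψ : Euc m × Euc n → ℝ} (hψ : IsTest ψ) :
    MemLp (grad ψ) 2 (weightedVolume m n a) := by
  have := isLocallyFiniteMeasure_weightedVolume (m := m) hn ha
  exact (continuous_grad hψ).memLp_of_hasCompactSupport (hasCompactSupport_grad hψ)

theorem grad_sub {φ ψ : Euc m × Euc n → ℝ} (hφ : IsTest φ) (hψ : IsTest ψ) :
    grad (φ - ψ) = grad φ - grad ψ := by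
  ext1 z
  refine ext_inner_left ℝ fun w => ?_
  rw [inner_grad ((hφ.differentiable z).sub (hψ.differentiable z)),
    fderiv_sub (hφ.differentiable z) (hψ.differentiable z), Pi.sub_apply, inner_sub_right,
    inner_grad (hφ.differentiable z), inner_grad (hψ.differentiable z)]
  rfl

/-- The energy identity, with real integrals. -/
theorem integral_extField_sq (hn : 2 ≤ n) (hs : s ∈ Set.Ioo (0 : ℝ) 1) (han : a + n = 2 - 2 * s)
    {φ : Euc m → ℝ} (hφ : IsTest φ) :
    ∫ z, ‖extField n s φ z‖ ^ 2 ∂(weightedVolume m n a) =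
      energyConst n s * ∫ x, ‖fracLaplacian (s / 2) φ x‖ ^ 2 := by
  have h := lintegral_extField_sq hn hs han hφ
  rw [← eLpNorm_two_sq, ← ofReal_integral_norm_sq (memLp_extField hn hs han hφ),
    ← ofReal_integral_norm_sq (hφ.memLp_fracLaplacian hs),
    ← ENNReal.ofReal_mul (energyConst_pos hn hs).le] at h
  have h0 := (energyConst_pos hn hs).le
  exact (ENNReal.ofReal_eq_ofReal_iff (by positivity) (by positivity)).1 h

/-- The distance of the traces in `𝓓^s` is controlled by that of the gradient of `ψ` to the
extension field of `φ`. For `φ = 0` this is the trace inequality. -/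
theorem trace_le (hn : 2 ≤ n) (hs : s ∈ Set.Ioo (0 : ℝ) 1) (han : a + n = 2 - 2 * s)
    {φ : Euc m → ℝ} (hφ : IsTest φ) {ψ : Euc m × Euc n → ℝ} (hψ : IsTest ψ) :
    energyConst n s * ∫ x, ‖(fracLaplacian (s / 2) (fun t => ψ (t, 0)) -
        fracLaplacian (s / 2) φ) x‖ ^ 2 ≤
      ∫ z, ‖(grad ψ - extField n s φ) z‖ ^ 2 ∂(weightedVolume m n a) := by
  have ha : -(n : ℝ) < a := by linarith [hs.2]
  have hψ0 := hψ.slice_left (0 : Euc n)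
  -- expand the square; the cross term is given by the weak equation
  have key : ∀ {η : Euc m → ℝ}, IsTest η →
      ∫ z, ‖(grad ψ - extField n s η) z‖ ^ 2 ∂(weightedVolume m n a) =
        ∫ z, ‖grad ψ z‖ ^ 2 ∂(weightedVolume m n a) - 2 * (energyConst n s *
          ∫ x, inner ℝ (fracLaplacian (s / 2) (fun t => ψ (t, 0)) x) (fracLaplacian (s / 2) η x)) +
        energyConst n s * ∫ x, ‖fracLaplacian (s / 2) η x‖ ^ 2 := fun {η} hη => by
    rw [integral_norm_sub_sq (memLp_grad hn ha hψ) (memLp_extField hn hs han hη),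
      integral_extField_sq hn hs han hη]
    simp_rw [real_inner_comm (extField n s η _)]
    rw [integral_inner_extField hn hs han hη hψ]
    rfl
  have h1 := key hψ0
  simp_rw [real_inner_self_eq_norm_sq] at h1
  -- for the extension of the trace of `ψ` itself, nonnegativity of the square is the trace
  -- inequality
  have h0 : 0 ≤ ∫ z, ‖(grad ψ - extField n s (fun t => ψ (t, 0))) z‖ ^ 2
      ∂(weightedVolume m n a) := by
    positivity
  rw [key hφ, integral_norm_sub_sq (hψ0.memLp_fracLaplacian hs) (hφ.memLp_fracLaplacian hs)]
  linarith

/-- The trace estimate of `trace_le` in terms of `L²` norms. -/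
theorem eLpNorm_trace_le (hn : 2 ≤ n) (hs : s ∈ Set.Ioo (0 : ℝ) 1) (han : a + n = 2 - 2 * s)
    {φ : Euc m → ℝ} (hφ : IsTest φ) {ψ : Euc m × Euc n → ℝ} (hψ : IsTest ψ) :
    ENNReal.ofReal (energyConst n s) * eLpNorm (fracLaplacian (s / 2) (fun t => ψ (t, 0)) -
        fracLaplacian (s / 2) φ) 2 volume ^ 2 ≤
      eLpNorm (grad ψ - extField n s φ) 2 (weightedVolume m n a) ^ 2 := by
  have ha : -(n : ℝ) < a := by linarith [hs.2]
  have hψ0 := hψ.slice_left (0 : Euc n)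
  rw [← ofReal_integral_norm_sq ((hψ0.memLp_fracLaplacian hs).sub (hφ.memLp_fracLaplacian hs)),
    ← ofReal_integral_norm_sq ((memLp_grad hn ha hψ).sub (memLp_extField hn hs han hφ)),
    ← ENNReal.ofReal_mul (energyConst_pos hn hs).le]
  exact ENNReal.ofReal_le_ofReal (trace_le hn hs han hφ hψ)

/-- The extension field depends linearly on the trace. -/
theorem extField_sub (hs : s ∈ Set.Ioo (0 : ℝ) 1) {φ ψ : Euc m → ℝ} (hφ : IsTest φ)
    (hψ : IsTest ψ) {z : Euc m × Euc n} (hz : z.2 ≠ 0) :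
    extField n s (φ - ψ) z = extField n s φ z - extField n s ψ z := by
  have key : ∀ {A : Euc m → Euc n → ℂ}, IsSymbol A →
      synth (φ - ψ) A z = synth φ A z - synth ψ A z := fun hA => by
    have e1 := (Real.fourierIntegral_convergent_iff (-z.1)).2 (hA.integrable hφ hz)
    have e2 := (Real.fourierIntegral_convergent_iff (-z.1)).2 (hA.integrable hψ hz)
    simp only [synth, Real.fourierInv_eq_fourier_neg, Real.fourier_eq]
    rw [← Complex.sub_re, ← integral_sub e1 e2]
    simp only [specHat_sub hφ.integrable hψ.integrable, Pi.sub_apply, mul_sub, smul_sub]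
  have hX := fun j : Fin m => key ((isMultiplier_profMult (n := n) hs).isSymbol_symX j)
  have hN := key ((isMultiplier_profDerivMult (n := n) hs).isSymbol_symN)
  unfold extField multField
  rw [hN]
  simp only [hX, sub_smul]
  rfl

end TraceInequality

/-! ### The Poisson kernel -/

section Kernel

variable {m n : ℕ} {s : ℝ}

/-- The Poisson kernel at height `r = |y|`, as a function of `x ∈ ℝ^m`. -/
noncomputable def radialKernel (s r : ℝ) (x : Euc m) : ℝ :=
  Real.Gamma (((m : ℝ) + 2 * s) / 2) / (Real.pi ^ ((m : ℝ) / 2) * Real.Gamma s) *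
    (r ^ (2 * s) / (‖x‖ ^ 2 + r ^ 2) ^ (((m : ℝ) + 2 * s) / 2))

theorem poissonKernel_eq (s : ℝ) (x : Euc m) (y : Euc n) :
    poissonKernel s x y = radialKernel s ‖y‖ x := rfl

/-- The inverse Fourier transform of a Gaussian times `φ̂` is the convolution of `φ` with a
Gaussian. -/
theorem integral_planeWave_gaussian {φ : Euc m → ℝ} (hφ : IsTest φ) {b : ℝ} (hb : 0 < b)
    (x : Euc m) :
    ∫ ξ, planeWave ξ x * (((Real.exp (-b * ‖ξ‖ ^ 2) : ℝ) : ℂ) * specHat φ ξ) =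
      ((∫ t, φ t * ((Real.pi / b) ^ ((m : ℝ) / 2) * Real.exp (-Real.pi ^ 2 * ‖x - t‖ ^ 2 / b)) :
          ℝ) : ℂ) := by
  set f : Euc m → ℂ := fun v => Complex.exp
      (-(b : ℂ) * ‖v‖ ^ 2 + 2 * Real.pi * Complex.I * (inner ℝ x v : ℝ))
  have hre : 0 < (b : ℂ).re := by simpa using hb
  have hf : Integrable f := by
    have := GaussianFourier.integrable_cexp_neg_mul_sq_norm_add (V := Euc m) hre
        (2 * Real.pi * Complex.I) x
    simpa [f] using this
  have hF := fourier_gaussian_innerProductSpace' (V := Euc m) hre x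
  have flip := VectorFourier.integral_fourierIntegral_smul_eq_flip (𝕜 := ℝ) (e := Real.fourierChar)
    (μ := (volume : Measure (Euc m))) (ν := (volume : Measure (Euc m))) (L := innerₗ (Euc m))
    Real.continuous_fourierChar (by simpa using continuous_inner) (f := fun t => (φ t : ℂ)) (g := f)
    hφ.integrable.ofReal hf
  have e1 : ∀ ξ, planeWave ξ x * (((Real.exp (-b * ‖ξ‖ ^ 2) : ℝ) : ℂ) * specHat φ ξ) =
      specHat φ ξ • f ξ := fun ξ => by
    simp only [planeWave, f, smul_eq_mul, Complex.exp_add, real_inner_comm]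
    push_cast
    ring_nf
  simp only [e1]
  refine Eq.trans flip ?_
  rw [← integral_complex_ofReal]
  congr 1
  ext t
  have e2 : VectorFourier.fourierIntegral Real.fourierChar volume (innerₗ (Euc m)).flip f t =
      𝓕 f t := by
    rw [Real.fourier_eq, VectorFourier.fourierIntegral]
    simp [real_inner_comm]
  rw [e2, hF t, smul_eq_mul, finrank_euclideanSpace_fin]
  push_cast
  rw [Complex.ofReal_cpow (by positivity)]
  push_cast
  rfl

/-- The subordination formula: the Poisson kernel is a superposition of Gaussians. -/
theorem integral_gaussian_eq_radialKernel (hs : 0 < s) {r : ℝ} (hr : 0 < r) (x : Euc m) :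
    (Real.Gamma s)⁻¹ * ∫ τ in Set.Ioi (0 : ℝ), τ ^ (s - 1) * Real.exp (-τ) *
      ((Real.pi / (Real.pi ^ 2 * r ^ 2 / τ)) ^ ((m : ℝ) / 2) *
        Real.exp (-Real.pi ^ 2 * ‖x‖ ^ 2 / (Real.pi ^ 2 * r ^ 2 / τ))) = radialKernel s r x := by
  have hpi := Real.pi_pos
  have hp : 0 < ((m : ℝ) + 2 * s) / 2 := by positivity
  have hc : 0 < (‖x‖ ^ 2 + r ^ 2) / r ^ 2 := by positivity
  have e : ∀ τ ∈ Set.Ioi (0 : ℝ), τ ^ (s - 1) * Real.exp (-τ) *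
      ((Real.pi / (Real.pi ^ 2 * r ^ 2 / τ)) ^ ((m : ℝ) / 2) *
        Real.exp (-Real.pi ^ 2 * ‖x‖ ^ 2 / (Real.pi ^ 2 * r ^ 2 / τ))) =
      (Real.pi ^ ((m : ℝ) / 2) * r ^ (m : ℝ))⁻¹ *
        (τ ^ (((m : ℝ) + 2 * s) / 2 - 1) * Real.exp (-((‖x‖ ^ 2 + r ^ 2) / r ^ 2 * τ))) := by
    intro τ hτ
    have hτ : 0 < τ := hτ
    have h1 : Real.pi / (Real.pi ^ 2 * r ^ 2 / τ) = τ / (Real.pi * r ^ 2) := by field_simp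
    have h2 : (r ^ 2) ^ ((m : ℝ) / 2) = r ^ (m : ℝ) := by
      rw [← Real.rpow_natCast r 2, ← Real.rpow_mul hr.le]
      congr 1; push_cast; ring
    have h3 : τ ^ (((m : ℝ) + 2 * s) / 2 - 1) = τ ^ (s - 1) * τ ^ ((m : ℝ) / 2) := by
      rw [← Real.rpow_add hτ]; congr 1; ring
    have h4 : Real.exp (-((‖x‖ ^ 2 + r ^ 2) / r ^ 2 * τ)) =
        Real.exp (-τ) * Real.exp (-Real.pi ^ 2 * ‖x‖ ^ 2 / (Real.pi ^ 2 * r ^ 2 / τ)) := by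
      rw [← Real.exp_add]; congr 1; field_simp; ring
    rw [h1, Real.div_rpow hτ.le (by positivity), Real.mul_rpow hpi.le (by positivity), h2, h3, h4]
    field_simp
  rw [setIntegral_congr_fun measurableSet_Ioi e, integral_const_mul,
    Real.integral_rpow_mul_exp_neg_mul_Ioi hp hc, radialKernel, one_div, inv_div,
    Real.div_rpow (by positivity) (by positivity)]
  have h2 : (r ^ 2) ^ (((m : ℝ) + 2 * s) / 2) = r ^ (m : ℝ) * r ^ (2 * s) := by
    rw [← Real.rpow_natCast r 2, ← Real.rpow_mul hr.le, ← Real.rpow_add hr]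
    congr 1; push_cast; ring
  have hG := Real.Gamma_pos_of_pos hs
  have hrm : 0 < r ^ (m : ℝ) := by positivity
  rw [h2]
  field_simp

/-- The Fourier multiplier `θ_s((2π|ξ|r)²)` is the convolution with the Poisson kernel: both are
superpositions, over `τ > 0` with the weight `τ^{s-1} e^{-τ}`, of a Gaussian multiplier and its
kernel. -/
theorem fourierInv_profile (hs : s ∈ Set.Ioo (0 : ℝ) 1) {φ : Euc m → ℝ} (hφ : IsTest φ) {r : ℝ}
    (hr : 0 < r)
    (x : Euc m) :
    𝓕⁻ (fun ξ => ((profile s ((2 * Real.pi * ‖ξ‖ * r) ^ 2) : ℝ) : ℂ) * specHat φ ξ) x =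
      ((∫ t, φ t * radialKernel s r (x - t) : ℝ) : ℂ) := by
  have hpi := Real.pi_pos
  set B : ℝ → ℝ := fun τ => Real.pi ^ 2 * r ^ 2 / τ with hB
  have hBp : ∀ τ, 0 < τ → 0 < B τ := fun τ hτ => by simp only [hB]; positivity
  have hφ0 := hφ.integrable_pow_mul_specHat 0
  simp only [pow_zero, one_mul] at hφ0
  -- the Fourier side as a double integral over `ξ` and the subordination parameter
  set F : Euc m → ℝ → ℂ := fun ξ τ => ((τ ^ (s - 1) * Real.exp (-τ) : ℝ) : ℂ) *
    (planeWave ξ x * (((Real.exp (-B τ * ‖ξ‖ ^ 2) : ℝ) : ℂ) * specHat φ ξ)) with hF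
  have hγ := integrableOn_gamma hs.1
  have hFm : Measurable (Function.uncurry F) := by
    have h1 : Measurable (fun p : Euc m × ℝ => ((p.2 ^ (s - 1) * Real.exp (-p.2) : ℝ) : ℂ)) := by
      fun_prop
    have h2 : Measurable (fun p : Euc m × ℝ => planeWave p.1 x) :=
      (continuous_planeWave.comp (continuous_fst.prodMk continuous_const)).measurable
    have h3 : Measurable (fun p : Euc m × ℝ => ((Real.exp (-B p.2 * ‖p.1‖ ^ 2) : ℝ) : ℂ)) := by
      simp only [hB]; fun_prop
    exact h1.mul (h2.mul (h3.mul (hφ.continuous_specHat.measurable.comp measurable_fst)))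
  have hFi : Integrable (Function.uncurry F)
      ((volume : Measure (Euc m)).prod (volume.restrict (Set.Ioi (0 : ℝ)))) := by
    refine (hφ0.mul_prod hγ).mono' hFm.aestronglyMeasurable ?_
    have : ∀ᵐ p ∂((volume : Measure (Euc m)).prod (volume.restrict (Set.Ioi (0 : ℝ)))),
        p.2 ∈ Set.Ioi (0 : ℝ) :=
      Measure.quasiMeasurePreserving_snd.ae (ae_restrict_mem measurableSet_Ioi)
    filter_upwards [this] with p hp
    have hp : 0 < p.2 := hp
    have hb := hBp p.2 hp
    simp only [Function.uncurry, hF, norm_mul, norm_planeWave, one_mul, Complex.norm_real]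
    rw [Real.norm_of_nonneg (Real.rpow_nonneg hp.le _), Real.norm_of_nonneg (Real.exp_pos _).le,
      Real.norm_of_nonneg (Real.exp_pos _).le, mul_comm]
    have : Real.exp (-B p.2 * ‖p.1‖ ^ 2) ≤ 1 := Real.exp_le_one_iff.2 (by
      rw [neg_mul]; exact neg_nonpos.2 (by positivity))
    calc _ ≤ 1 * ‖specHat φ p.1‖ * (p.2 ^ (s - 1) * Real.exp (-p.2)) := by gcongr
      _ = _ := by ring
  -- the physical side
  set H : ℝ → Euc m → ℝ := fun τ t => τ ^ (s - 1) * Real.exp (-τ) *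
    (φ t * ((Real.pi / B τ) ^ ((m : ℝ) / 2) * Real.exp (-Real.pi ^ 2 * ‖x - t‖ ^ 2 / B τ))) with hH
  have hγ' := integrableOn_gamma (s := s + (m : ℝ) / 2) (by have := hs.1; positivity)
  have hHi : Integrable (Function.uncurry H)
      ((volume.restrict (Set.Ioi (0 : ℝ))).prod (volume : Measure (Euc m))) := by
    have hm' : Measurable (Function.uncurry H) := by
      have h1 : Measurable (fun p : ℝ × Euc m => p.1 ^ (s - 1) * Real.exp (-p.1)) := by fun_prop
      have h2 : Measurable (fun p : ℝ × Euc m => (Real.pi / B p.1) ^ ((m : ℝ) / 2) *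
          Real.exp (-Real.pi ^ 2 * ‖x - p.2‖ ^ 2 / B p.1)) := by
        simp only [hB]; fun_prop
      exact h1.mul ((hφ.continuous.measurable.comp measurable_snd).mul h2)
    refine ((hγ'.const_mul ((Real.pi * r ^ 2) ^ ((m : ℝ) / 2))⁻¹).mul_prod hφ.integrable.norm).mono'
      hm'.aestronglyMeasurable ?_
    have : ∀ᵐ p ∂((volume.restrict (Set.Ioi (0 : ℝ))).prod (volume : Measure (Euc m))),
        p.1 ∈ Set.Ioi (0 : ℝ) :=
      Measure.quasiMeasurePreserving_fst.ae (ae_restrict_mem measurableSet_Ioi)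
    filter_upwards [this] with p hp
    have hp : 0 < p.1 := hp
    have hb := hBp p.1 hp
    have e1 : (Real.pi / B p.1) ^ ((m : ℝ) / 2) =
        ((Real.pi * r ^ 2) ^ ((m : ℝ) / 2))⁻¹ * p.1 ^ ((m : ℝ) / 2) := by
      have : Real.pi / B p.1 = p.1 / (Real.pi * r ^ 2) := by simp only [hB]; field_simp
      rw [this, Real.div_rpow hp.le (by positivity)]
      field_simp
    have e2 : p.1 ^ (s + (m : ℝ) / 2 - 1) = p.1 ^ (s - 1) * p.1 ^ ((m : ℝ) / 2) := by
      rw [← Real.rpow_add hp]; congr 1; ring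
    have e3 : Real.exp (-Real.pi ^ 2 * ‖x - p.2‖ ^ 2 / B p.1) ≤ 1 := Real.exp_le_one_iff.2 (by
      rw [neg_mul, neg_div]; exact neg_nonpos.2 (by positivity))
    simp only [Function.uncurry, hH, norm_mul]
    rw [e1, e2, Real.norm_of_nonneg (Real.rpow_nonneg hp.le (s - 1)),
        Real.norm_of_nonneg (Real.exp_pos _).le,
      Real.norm_of_nonneg (Real.exp_pos (-Real.pi ^ 2 * ‖x - p.2‖ ^ 2 / B p.1)).le,
      Real.norm_of_nonneg (mul_nonneg (inv_nonneg.2 (Real.rpow_nonneg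
        (by positivity : 0 ≤ Real.pi * r ^ 2) _)) (Real.rpow_nonneg hp.le ((m : ℝ) / 2)))]
    calc _ ≤ p.1 ^ (s - 1) * Real.exp (-p.1) * (‖φ p.2‖ *
          (((Real.pi * r ^ 2) ^ ((m : ℝ) / 2))⁻¹ * p.1 ^ ((m : ℝ) / 2) * 1)) := by gcongr
      _ = _ := by ring
  have hprof : ∀ ξ : Euc m, planeWave ξ x *
      (((profile s ((2 * Real.pi * ‖ξ‖ * r) ^ 2) : ℝ) : ℂ) * specHat φ ξ) =
      (((Real.Gamma s)⁻¹ : ℝ) : ℂ) * ∫ τ in Set.Ioi (0 : ℝ), F ξ τ := fun ξ => by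
    have : ∫ τ in Set.Ioi (0 : ℝ), F ξ τ =
        ((besselIntegral s ((2 * Real.pi * ‖ξ‖ * r) ^ 2) : ℝ) : ℂ) *
        (planeWave ξ x * specHat φ ξ) := by
      rw [besselIntegral, ← integral_complex_ofReal, ← integral_mul_const]
      refine setIntegral_congr_fun measurableSet_Ioi fun τ hτ => ?_
      have hτ : 0 < τ := hτ
      have : Real.exp (-τ - (2 * Real.pi * ‖ξ‖ * r) ^ 2 / (4 * τ)) =
          Real.exp (-τ) * Real.exp (-B τ * ‖ξ‖ ^ 2) := by
        rw [← Real.exp_add]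
        congr 1
        simp only [hB]
        field_simp
        ring
      simp only [hF, this]
      push_cast
      ring
    rw [this, profile]
    push_cast
    ring
  rw [fourierInv_eq_planeWave]
  simp only [hprof]
  rw [integral_const_mul, integral_integral_swap hFi]
  have hτF : ∫ τ in Set.Ioi (0 : ℝ), ∫ ξ, F ξ τ =
      ((∫ τ in Set.Ioi (0 : ℝ), ∫ t, H τ t : ℝ) : ℂ) := by
    rw [← integral_complex_ofReal]
    refine setIntegral_congr_fun measurableSet_Ioi fun τ hτ => ?_
    simp only [hF, hH]
    rw [integral_const_mul, integral_planeWave_gaussian hφ (hBp τ hτ), integral_const_mul]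
    push_cast
    rfl
  rw [hτF, integral_integral_swap hHi, ← Complex.ofReal_mul, ← integral_const_mul]
  congr 1
  refine integral_congr_ae (Eventually.of_forall fun t => ?_)
  simp only
  rw [← integral_gaussian_eq_radialKernel hs.1 hr (x - t), mul_left_comm,
      ← integral_const_mul (φ t)]
  congr 2
  ext τ
  simp only [hH, hB]
  ring

theorem radialKernel_nonneg (hs : 0 < s) {r : ℝ} (hr : 0 ≤ r) (x : Euc m) :
    0 ≤ radialKernel s r x := by
  have h1 := Real.Gamma_pos_of_pos hs
  have h2 := Real.Gamma_pos_of_pos (by positivity : 0 < ((m : ℝ) + 2 * s) / 2)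
  unfold radialKernel
  positivity

theorem contDiffAt_radialKernel {p : Euc m × ℝ} (hp : 0 < p.2) :
    ContDiffAt ℝ ∞ (fun p : Euc m × ℝ => radialKernel s p.2 p.1) p := by
  unfold radialKernel
  have h0 : 0 < ‖p.1‖ ^ 2 + p.2 ^ 2 := by positivity
  have h1 : ContDiffAt ℝ ∞ (fun p : Euc m × ℝ => p.2 ^ (2 * s)) p :=
    contDiffAt_snd.rpow_const_of_ne hp.ne'
  have h2 : ContDiffAt ℝ ∞ (fun p : Euc m × ℝ => ‖p.1‖ ^ 2 + p.2 ^ 2) p :=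
    ((contDiff_fst.norm_sq ℝ).add (contDiff_snd.pow 2)).contDiffAt
  exact contDiffAt_const.mul (h1.div (h2.rpow_const_of_ne h0.ne') (by positivity))

theorem continuous_radialKernel {r : ℝ} (hr : 0 < r) :
    Continuous (radialKernel s r : Euc m → ℝ) := by
  rw [continuous_iff_continuousAt]
  intro x
  exact ((contDiffAt_radialKernel (s := s) (p := (x, r)) hr).continuousAt).comp
    (f := fun x : Euc m => (x, r)) (by fun_prop)

theorem exists_radialKernel_le (hs : 0 < s) {r : ℝ} (hr : 0 < r) :
    ∃ C, 0 ≤ C ∧ ∀ x : Euc m,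
        radialKernel s r x ≤ C * (1 + ‖x‖ ^ 2) ^ (-((m : ℝ) + 2 * s) / 2) := by
  have h1 := Real.Gamma_pos_of_pos hs
  have hp : 0 < ((m : ℝ) + 2 * s) / 2 := by positivity
  have h2 := Real.Gamma_pos_of_pos hp
  have hc : 0 < min 1 (r ^ 2) := lt_min one_pos (by positivity)
  refine ⟨Real.Gamma (((m : ℝ) + 2 * s) / 2) / (Real.pi ^ ((m : ℝ) / 2) * Real.Gamma s) *
    (r ^ (2 * s) / (min 1 (r ^ 2)) ^ (((m : ℝ) + 2 * s) / 2)), by positivity, fun x => ?_⟩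
  unfold radialKernel
  rw [mul_assoc]
  gcongr
  rw [neg_div, Real.rpow_neg (by positivity), ← div_eq_mul_inv, div_div,
    ← Real.mul_rpow hc.le (by positivity)]
  gcongr
  have h3 : min 1 (r ^ 2) ≤ 1 := min_le_left _ _
  have h4 : min 1 (r ^ 2) ≤ r ^ 2 := min_le_right _ _
  nlinarith [sq_nonneg ‖x‖]

theorem integrable_radialKernel (hs : 0 < s) {r : ℝ} (hr : 0 < r) :
    Integrable (radialKernel s r : Euc m → ℝ) := by
  obtain ⟨C, -, hC⟩ := exists_radialKernel_le (m := m) hs hr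
  refine ((integrable_rpow_neg_one_add_norm_sq (E := Euc m) (μ := volume)
    (r := (m : ℝ) + 2 * s) (by simpa using hs)).const_mul C).mono'
    (continuous_radialKernel hr).aestronglyMeasurable (Eventually.of_forall fun x => ?_)
  rw [Real.norm_of_nonneg (radialKernel_nonneg hs hr.le x)]
  exact hC x

theorem memLp_radialKernel (hs : 0 < s) {r : ℝ} (hr : 0 < r) :
    MemLp (radialKernel s r : Euc m → ℝ) 2 volume := by
  obtain ⟨C, hC0, hC⟩ := exists_radialKernel_le (m := m) hs hr
  rw [memLp_two_iff_integrable_sq (continuous_radialKernel hr).aestronglyMeasurable]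
  refine ((integrable_radialKernel hs hr).const_mul C).mono'
    ((continuous_radialKernel hr).pow 2).aestronglyMeasurable (Eventually.of_forall fun x => ?_)
  have h0 := radialKernel_nonneg hs hr.le x
  rw [Real.norm_of_nonneg (by positivity), pow_two]
  gcongr
  refine (hC x).trans (mul_le_of_le_one_right hC0 ?_)
  exact Real.rpow_le_one_of_one_le_of_nonpos (by nlinarith [sq_nonneg ‖x‖])
    (by rw [neg_div]; exact neg_nonpos.2 (by positivity))

end Kernel

/-! ### Smooth regularization of the Poisson extension of a test function -/

section Regularization

variable {m n : ℕ} {s ε : ℝ}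

/-- The regularized height `√(|y|² + ε²)`. For `ε > 0` it is smooth in `y` and bounded below by `ε`,
so that the Poisson kernel is smooth there, and it dominates `|y|`, so that the profile only
decreases. -/
noncomputable def regHeight (ε : ℝ) (y : Euc n) : ℝ := √(‖y‖ ^ 2 + ε ^ 2)

theorem norm_le_regHeight (ε : ℝ) (y : Euc n) : ‖y‖ ≤ regHeight ε y :=
  Real.le_sqrt_of_sq_le (by nlinarith [sq_nonneg ε])

theorem regHeight_zero (y : Euc n) : regHeight 0 y = ‖y‖ := by
  simp [regHeight, Real.sqrt_sq (norm_nonneg y)]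

theorem le_regHeight (ε : ℝ) (y : Euc n) : ε ≤ regHeight ε y :=
  Real.le_sqrt_of_sq_le (by nlinarith [sq_nonneg ‖y‖])

theorem regHeight_pos (hε : 0 < ε) (y : Euc n) : 0 < regHeight ε y :=
  hε.trans_le (le_regHeight ε y)

theorem continuous_regHeight : Continuous (fun p : ℝ × Euc n => regHeight p.1 p.2) := by
  unfold regHeight; fun_prop

theorem contDiff_regHeight (hε : 0 < ε) : ContDiff ℝ ∞ (regHeight ε : Euc n → ℝ) := by
  refine ContDiff.sqrt ((contDiff_id.norm_sq ℝ).add contDiff_const) fun y => ?_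
  have : 0 < ‖y‖ ^ 2 + ε ^ 2 := by positivity
  exact this.ne'

/-- The extension evaluated at the regularized height: `∫ φ(t) P(x - t, √(|y|² + ε²)) dt`. -/
noncomputable def regExt (s ε : ℝ) (φ : Euc m → ℝ) (z : Euc m × Euc n) : ℝ :=
  ∫ t, φ t * radialKernel s (regHeight ε z.2) (z.1 - t)

theorem regExt_zero (φ : Euc m → ℝ) : regExt s 0 φ = poissonExtension n s φ := by
  ext z
  simp only [regExt, poissonExtension, poissonKernel_eq, regHeight_zero]

/-- The multiplier of the regularized extension. -/
noncomputable def regMult (n : ℕ) (s ε l : ℝ) (y : Euc n) : ℝ :=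
  profile s ((2 * Real.pi * l * regHeight ε y) ^ 2)

/-- The multiplier of the radial derivative of the regularized extension; the factor
`|y|/√(|y|² + ε²)` is the derivative of the height. -/
noncomputable def regDerivMult (n : ℕ) (s ε l : ℝ) (y : Euc n) : ℝ :=
  profileDeriv s (2 * Real.pi * l) (regHeight ε y) * (‖y‖ / regHeight ε y)

theorem regMult_nonneg (hs : 0 < s) (l : ℝ) (y : Euc n) : 0 ≤ regMult n s ε l y :=
    profile_nonneg hs _

theorem regMult_le_profMult (hs : 0 < s) {l : ℝ} (hl : 0 ≤ l) (y : Euc n) :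
    regMult n s ε l y ≤ profMult n s l y := by
  refine profile_antitone hs (sq_nonneg _) ?_
  have := norm_le_regHeight ε y
  gcongr

/-- With `h = √(|y|² + ε²)` the factor `h^{2s-1} |y|/h = h^{2s-2} |y|` is at most `|y|^{2s-1}`,
whatever the sign of `2s - 1`. -/
theorem abs_regDerivMult_le (hs : s ∈ Set.Ioo (0 : ℝ) 1) {l : ℝ} (hl : 0 ≤ l) {y : Euc n}
    (hy : y ≠ 0) : |regDerivMult n s ε l y| ≤ |profDerivMult n s l y| := by
  have h0 := norm_pos_iff.2 hy
  have h1 := norm_le_regHeight ε y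
  have h2 : 0 < regHeight ε y := h0.trans_le h1
  have hs' : 0 < 1 - s := sub_pos.2 hs.2
  have hd := dtnConst_pos hs
  rw [regDerivMult, profDerivMult, profileDeriv, profileDeriv, neg_mul, abs_neg, abs_neg,
    abs_of_nonneg, abs_of_nonneg]
  · have e1 : ∀ r : ℝ, 0 < r → r ^ (2 * s - 1) = r ^ (2 * s - 2) * r := fun r hr => by
      rw [← Real.rpow_add_one hr.ne']; congr 1; ring
    rw [e1 _ h0, e1 _ h2]
    have e2 : regHeight ε y ^ (2 * s - 2) ≤ ‖y‖ ^ (2 * s - 2) :=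
      Real.rpow_le_rpow_of_nonpos h0 h1 (by linarith [hs.2])
    have e3 : profile (1 - s) ((2 * Real.pi * l * regHeight ε y) ^ 2) ≤
        profile (1 - s) ((2 * Real.pi * l * ‖y‖) ^ 2) := by
      refine profile_antitone hs' (sq_nonneg _) ?_
      gcongr
    calc _ = dtnConst s * (2 * Real.pi * l) ^ (2 * s) * (regHeight ε y ^ (2 * s - 2) * ‖y‖) *
          profile (1 - s) ((2 * Real.pi * l * regHeight ε y) ^ 2) := by field_simp
      _ ≤ _ := by
          gcongr
          exact profile_nonneg hs' _
  · have := profile_nonneg hs' ((2 * Real.pi * l * ‖y‖) ^ 2)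
    positivity
  · have := profile_nonneg hs' ((2 * Real.pi * l * regHeight ε y) ^ 2)
    positivity

theorem isMultiplier_regMult (hs : s ∈ Set.Ioo (0 : ℝ) 1) : IsMultiplier (regMult n s ε) where
  meas := measurable_profile_comp hs.1 (by unfold regHeight; fun_prop)
  bound y hy := by
    obtain ⟨C, hC⟩ := (isMultiplier_profMult hs).bound y hy
    refine ⟨C, fun l hl => le_trans ?_ (hC l hl)⟩
    rw [abs_of_nonneg (regMult_nonneg hs.1 l y)]
    exact (regMult_le_profMult hs.1 hl y).trans (le_abs_self _)

theorem isMultiplier_regDerivMult (hs : s ∈ Set.Ioo (0 : ℝ) 1) :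
    IsMultiplier (regDerivMult n s ε) where
  meas := by
    have h : Measurable (fun p : ℝ × Euc n => regHeight ε p.2) := by unfold regHeight; fun_prop
    exact (measurable_profileDeriv_comp hs (by fun_prop) h).mul (measurable_snd.norm.div h)
  bound y hy := by
    obtain ⟨C, hC⟩ := (isMultiplier_profDerivMult hs).bound y hy
    exact ⟨C, fun l hl => (abs_regDerivMult_le hs hl hy).trans (hC l hl)⟩

theorem fourierInv_regMult (hs : s ∈ Set.Ioo (0 : ℝ) 1) {φ : Euc m → ℝ} (hφ : IsTest φ)
    {z : Euc m × Euc n} (hz : 0 < regHeight ε z.2) :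
    ∫ ξ, planeWave ξ z.1 * ((regMult n s ε ‖ξ‖ z.2 : ℂ) * specHat φ ξ) = (regExt s ε φ z : ℂ) := by
  rw [regExt, ← fourierInv_profile hs hφ hz, fourierInv_eq_planeWave]
  rfl

theorem regExt_eq_synth (hs : s ∈ Set.Ioo (0 : ℝ) 1) {φ : Euc m → ℝ} (hφ : IsTest φ)
    {z : Euc m × Euc n} (hz : 0 < regHeight ε z.2) :
    regExt s ε φ z = synth φ (symN (regMult n s ε)) z := by
  rw [synth, fourierInv_eq_planeWave]
  simp only [symN]
  rw [fourierInv_regMult hs hφ hz, Complex.ofReal_re]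

/-- The regularized extension is smooth, since the kernel is smooth at positive heights. It is
written as the convolution of the constant `1` with the integrand, a family of compactly supported
functions depending on the parameter `z`. -/
theorem contDiff_regExt (hε : 0 < ε) {φ : Euc m → ℝ} (hφ : IsTest φ) :
    ContDiff ℝ ∞ (regExt s ε φ : Euc m × Euc n → ℝ) := by
  -- the reflection `t ↦ -t` makes the integral a convolution evaluated at `0`
  set g : Euc m × Euc n → Euc m → ℝ := fun z t =>
    φ (-t) * radialKernel s (regHeight ε z.2) (z.1 + t) with hg
  have hgc : ContDiff ℝ ∞ (fun p : (Euc m × Euc n) × Euc m => g p.1 p.2) := by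
    have h1 : ContDiff ℝ ∞ (fun p : (Euc m × Euc n) × Euc m => φ (-p.2)) :=
      hφ.1.comp contDiff_snd.neg
    have h2 : ContDiff ℝ ∞ (fun p : (Euc m × Euc n) × Euc m =>
        (p.1.1 + p.2, regHeight ε p.1.2)) :=
      (contDiff_fst.fst.add contDiff_snd).prodMk ((contDiff_regHeight hε).comp contDiff_fst.snd)
    have h3 : ContDiff ℝ ∞ ((fun q : Euc m × ℝ => radialKernel s q.2 q.1) ∘
        fun p : (Euc m × Euc n) × Euc m => (p.1.1 + p.2, regHeight ε p.1.2)) :=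
      contDiff_iff_contDiffAt.2 fun p => (contDiffAt_radialKernel
        (regHeight_pos hε _)).comp p h2.contDiffAt
    exact h1.mul h3
  have key := contDiffOn_convolution_right_with_param_comp (𝕜 := ℝ) (n := ⊤) (μ := volume)
    (ContinuousLinearMap.mul ℝ ℝ) (s := (Set.univ : Set (Euc m × Euc n)))
        (v := fun _ => (0 : Euc m))
    contDiffOn_const (f := fun _ : Euc m => (1 : ℝ)) (g := g) (k := -tsupport φ) isOpen_univ
    hφ.2.isCompact.neg (fun p t _ ht => by
      have : -t ∉ tsupport φ := fun h => ht (by simpa using h)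
      simp [hg, image_eq_zero_of_notMem_tsupport this]) (locallyIntegrable_const _) hgc.contDiffOn
  rw [contDiffOn_univ] at key
  refine (congrArg (ContDiff ℝ ∞) (funext fun z => ?_)).mpr key
  simp [convolution, regExt, hg, sub_eq_add_neg]

theorem hasDerivAt_regHeight (hε : 0 < ε) (y v : Euc n) (t : ℝ) :
    HasDerivAt (fun t : ℝ => regHeight ε (y + t • v))
      (inner ℝ (y + t • v) v / regHeight ε (y + t • v)) t := by
  have h1 : HasDerivAt (fun t : ℝ => y + t • v) v t := by
    simpa using ((hasDerivAt_id t).smul_const v).const_add y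
  have h2 : HasDerivAt (fun t : ℝ => ‖y + t • v‖ ^ 2 + ε ^ 2) (2 * inner ℝ (y + t • v) v) t :=
    h1.norm_sq.add_const _
  have h3 := h2.sqrt (by positivity)
  refine h3.congr_deriv ?_
  rw [regHeight, mul_div_mul_left _ _ two_ne_zero]

theorem regHeight_le (hε : 0 ≤ ε) (y : Euc n) : regHeight ε y ≤ ‖y‖ + ε :=
  Real.sqrt_le_iff.2 ⟨by positivity, by nlinarith [norm_nonneg y, mul_nonneg (norm_nonneg y) hε]⟩

/-- The directional derivatives of the regularized extension, computed on the Fourier side. -/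
theorem hasDerivAt_regExt (hs : s ∈ Set.Ioo (0 : ℝ) 1) (hε : 0 < ε) {φ : Euc m → ℝ}
    (hφ : IsTest φ) (z w : Euc m × Euc n) :
    HasDerivAt (fun t : ℝ => (regExt s ε φ (z + t • w) : ℂ))
      (∫ ξ, planeWave ξ z.1 * ((((2 * Real.pi * regMult n s ε ‖ξ‖ z.2 * inner ℝ ξ w.1 : ℝ) : ℂ) *
        Complex.I + ((profileDeriv s (2 * Real.pi * ‖ξ‖) (regHeight ε z.2) *
          (inner ℝ z.2 w.2 / regHeight ε z.2) : ℝ) : ℂ)) * specHat φ ξ)) 0 := by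
  have hsp := hφ.continuous_specHat
  have hd := dtnConst_pos hs
  set F : ℝ → Euc m → ℂ := fun t ξ =>
    planeWave ξ (z.1 + t • w.1) * ((regMult n s ε ‖ξ‖ (z.2 + t • w.2) : ℂ) * specHat φ ξ) with hF
  set F' : ℝ → Euc m → ℂ := fun t ξ => planeWave ξ (z.1 + t • w.1) *
    ((((2 * Real.pi * regMult n s ε ‖ξ‖ (z.2 + t • w.2) * inner ℝ ξ w.1 : ℝ) : ℂ) *
        Complex.I + ((profileDeriv s (2 * Real.pi * ‖ξ‖) (regHeight ε (z.2 + t • w.2)) *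
          (inner ℝ (z.2 + t • w.2) w.2 / regHeight ε (z.2 + t • w.2)) : ℝ) : ℂ)) *
              specHat φ ξ) with hF'
  have hrm : ∀ y : Euc n, Measurable (fun ξ : Euc m => regMult n s ε ‖ξ‖ y) := fun y =>
    (isMultiplier_regMult hs).measurable_comp measurable_norm measurable_const
  have hpwm : ∀ x : Euc m, Measurable (fun ξ : Euc m => planeWave ξ x) := fun x =>
    (continuous_planeWave.comp (continuous_id.prodMk continuous_const)).measurable
  have hFm : ∀ t, AEStronglyMeasurable (F t) volume := fun t =>
    ((hpwm _).mul ((Complex.measurable_ofReal.comp (hrm _)).mul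
        hsp.measurable)).aestronglyMeasurable
  have hφ0 := hφ.integrable_pow_mul_specHat 0
  have hφ2 := hφ.integrable_pow_mul_specHat 2
  simp only [pow_zero, one_mul] at hφ0
  have habs : ∀ l : ℝ, ∀ y : Euc n, |regMult n s ε l y| ≤ 1 := fun l y => by
    rw [abs_of_nonneg (regMult_nonneg hs.1 l y)]
    exact profile_le_one hs.1 (sq_nonneg _)
  have hF0 : Integrable (F 0) := by
    refine hφ0.mono' (hFm 0) (Eventually.of_forall fun ξ => ?_)
    simp only [hF, norm_mul, norm_planeWave, one_mul, Complex.norm_real]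
    exact mul_le_of_le_one_left (norm_nonneg _) (habs _ _)
  have hF'm : AEStronglyMeasurable (F' 0) volume := by
    have h1 : Measurable (fun ξ : Euc m => profileDeriv s (2 * Real.pi * ‖ξ‖)
        (regHeight ε (z.2 + (0 : ℝ) • w.2))) :=
      measurable_profileDeriv_comp hs (by fun_prop) (by fun_prop)
    have h2 : Measurable (fun ξ : Euc m => inner ℝ ξ w.1) := by fun_prop
    exact ((hpwm _).mul ((((Complex.measurable_ofReal.comp
        (((hrm _).const_mul _).mul h2)).mul_const _).add
      (Complex.measurable_ofReal.comp (h1.mul_const _))).mul hsp.measurable)).aestronglyMeasurable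
  -- for `|t| < 1` the regularized height is at most `H`, and the derivatives of the integrand are
  -- bounded by `C (1 + |ξ|)² |φ̂(ξ)|`
  set H : ℝ := ‖z.2‖ + ‖w.2‖ + ε with hH
  have hH0 : 0 < H := by positivity
  set C : ℝ := 2 * Real.pi * ‖w.1‖ +
    dtnConst s * (2 * Real.pi) ^ (2 * s) * ((1 + H) ^ 2 / ε) * ‖w.2‖ with hC
  have key := hasDerivAt_integral_of_dominated_loc_of_deriv_le (μ := (volume : Measure (Euc m)))
    (F := F) (F' := F') (x₀ := (0 : ℝ)) (s := Metric.ball 0 1)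
        (bound := fun ξ => C * ((1 + ‖ξ‖) ^ 2 * ‖specHat φ ξ‖))
    (Metric.ball_mem_nhds 0 one_pos) (Eventually.of_forall hFm) hF0 hF'm ?_ (hφ2.const_mul C) ?_
  · have h1 := key.2
    have e1 : (fun t : ℝ => (regExt s ε φ (z + t • w) : ℂ)) = fun t => ∫ ξ, F t ξ := by
      ext t
      rw [← fourierInv_regMult hs hφ (regHeight_pos hε _)]
      rfl
    rw [e1]
    refine h1.congr_deriv ?_
    simp only [hF', zero_smul, add_zero]
  · refine Eventually.of_forall fun ξ t ht => ?_
    have ht1 : |t| < 1 := by simpa using ht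
    set y : Euc n := z.2 + t • w.2 with hy
    have hyn : ‖y‖ ≤ ‖z.2‖ + ‖w.2‖ := by
      refine (norm_add_le _ _).trans ?_
      rw [norm_smul, Real.norm_eq_abs]
      gcongr
      exact mul_le_of_le_one_left (norm_nonneg _) ht1.le
    have hh := regHeight_pos hε y
    have hhH : regHeight ε y ≤ H := (regHeight_le hε.le y).trans (by linarith)
    have b1 : |inner ℝ y w.2 / regHeight ε y| ≤ ‖w.2‖ := by
      rw [abs_div, abs_of_pos hh, div_le_iff₀ hh]
      refine (abs_real_inner_le_norm _ _).trans ?_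
      rw [mul_comm]
      gcongr
      exact norm_le_regHeight ε y
    have b2 : |profileDeriv s (2 * Real.pi * ‖ξ‖) (regHeight ε y)| ≤
        dtnConst s * ((2 * Real.pi) ^ (2 * s) * (1 + ‖ξ‖) ^ 2) * ((1 + H) ^ 2 / ε) := by
      refine (abs_profileDeriv_le hs (by positivity) hh.le).trans ?_
      have c1 := two_pi_mul_rpow_le (p := 2 * s)
          (by linarith [hs.1]) (by linarith [hs.2]) (norm_nonneg ξ)
      have c2 : regHeight ε y ^ (2 * s - 1) ≤ (1 + H) ^ 2 / ε := by
        rw [Real.rpow_sub_one hh.ne']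
        gcongr
        · calc _ ≤ (1 + regHeight ε y) ^ 2 :=
                rpow_le_one_add_sq hh.le (by linarith [hs.1]) (by linarith [hs.2])
            _ ≤ _ := by gcongr
        · exact le_regHeight ε y
      gcongr
    have b3 : |inner ℝ ξ w.1| ≤ ‖ξ‖ * ‖w.1‖ := abs_real_inner_le_norm _ _
    have hx1 : ‖ξ‖ ≤ (1 + ‖ξ‖) ^ 2 := by nlinarith [norm_nonneg ξ]
    simp only [hF', norm_mul, norm_planeWave, one_mul, ← hy]
    rw [← mul_assoc]
    gcongr
    refine (norm_add_le _ _).trans ?_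
    rw [norm_mul, Complex.norm_I, mul_one, Complex.norm_real, Complex.norm_real, Real.norm_eq_abs,
      Real.norm_eq_abs, abs_mul, abs_mul (2 * Real.pi), abs_mul (profileDeriv _ _ _),
      abs_of_pos Real.two_pi_pos]
    calc _ ≤ 2 * Real.pi * 1 * ((1 + ‖ξ‖) ^ 2 * ‖w.1‖) +
          dtnConst s * ((2 * Real.pi) ^ (2 * s) * (1 + ‖ξ‖) ^ 2) * ((1 + H) ^ 2 / ε) * ‖w.2‖ := by
          gcongr
          · exact habs _ _
          · exact b3.trans (by gcongr)
      _ = _ := by rw [hC]; ring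
  · refine Eventually.of_forall fun ξ t _ => ?_
    set y : Euc n := z.2 + t • w.2 with hy
    have hh := regHeight_pos hε y
    have d1 : HasDerivAt (fun t : ℝ => planeWave ξ (z.1 + t • w.1))
        (planeWave ξ (z.1 + t • w.1) * (2 * Real.pi * Complex.I) *
            ((inner ℝ ξ w.1 : ℝ) : ℂ)) t := by
      have hl : HasDerivAt (fun t : ℝ => z.1 + t • w.1) w.1 t := by
        simpa using ((hasDerivAt_id t).smul_const w.1).const_add z.1
      refine ((hasFDerivAt_planeWave ξ (z.1 + t • w.1)).comp_hasDerivAt t hl).congr_deriv ?_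
      simp
    have d2 : HasDerivAt (fun t : ℝ => regMult n s ε ‖ξ‖ (z.2 + t • w.2))
        (profileDeriv s (2 * Real.pi * ‖ξ‖) (regHeight ε y) *
            (inner ℝ y w.2 / regHeight ε y)) t := by
      have := (hasDerivAt_profile hs (by positivity : 0 ≤ 2 * Real.pi * ‖ξ‖) hh).comp
        (h := fun t : ℝ => regHeight ε (z.2 + t • w.2)) t (hasDerivAt_regHeight hε z.2 w.2 t)
      exact this
    refine (d1.mul (d2.ofReal_comp.mul_const (specHat φ ξ))).congr_deriv ?_
    simp only [hF', ← hy]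
    push_cast
    ring

/-- The gradient of the regularized extension is a field synthesized from multipliers. -/
theorem grad_regExt (hs : s ∈ Set.Ioo (0 : ℝ) 1) (hε : 0 < ε) {φ : Euc m → ℝ}
    (hφ : IsTest φ) {z : Euc m × Euc n} (hz : z.2 ≠ 0) :
    grad (regExt s ε φ) z = multField φ (regMult n s ε) (regDerivMult n s ε) z := by
  have hdiff : DifferentiableAt ℝ (regExt s ε φ : Euc m × Euc n → ℝ) z :=
    (contDiff_regExt hε hφ).differentiable (by norm_num) z
  refine ext_inner_left ℝ fun w => ?_
  rw [inner_grad hdiff]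
  -- the linear form represented by `w`, in order to apply `apply_multField`
  set L : (Euc m × Euc n) →L[ℝ] ℝ :=
    (innerSL ℝ w).comp (WithLp.prodContinuousLinearEquiv 2 ℝ (Euc m)
        (Euc n)).symm.toContinuousLinearMap with hL
  have hLv : ∀ v : Euc m × Euc n, L v = inner ℝ w.ofLp.1 v.1 + inner ℝ w.ofLp.2 v.2 := fun v => by
    simp only [hL, ContinuousLinearMap.comp_apply, innerSL_apply_apply]
    rw [WithLp.prod_inner_apply]
    rfl
  have h1 : HasDerivAt (fun t : ℝ => regExt s ε φ (z + t • w.ofLp))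
      (fderiv ℝ (regExt s ε φ) z w.ofLp) 0 := by
    have hl : HasDerivAt (fun t : ℝ => z + t • w.ofLp) w.ofLp 0 := by
      simpa using ((hasDerivAt_id (0 : ℝ)).smul_const w.ofLp).const_add z
    have hd : HasFDerivAt (regExt s ε φ) (fderiv ℝ (regExt s ε φ) z) (z + (0 : ℝ) • w.ofLp) := by
      simpa using hdiff.hasFDerivAt
    exact hd.comp_hasDerivAt (0 : ℝ) hl
  have h2 := h1.ofReal_comp.unique (hasDerivAt_regExt hs hε hφ z w.ofLp)
  have h3 : inner ℝ w (multField φ (regMult n s ε) (regDerivMult n s ε) z) =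
      L (multField φ (regMult n s ε) (regDerivMult n s ε) z).ofLp := rfl
  rw [h3, apply_multField (isMultiplier_regMult hs) (isMultiplier_regDerivMult hs) hφ L hz,
    ← Complex.ofReal_re (fderiv ℝ (regExt s ε φ) z w.ofLp), h2]
  congr 2
  ext ξ
  have h0 := norm_pos_iff.2 hz
  have hh := regHeight_pos hε z.2
  have e : regDerivMult n s ε ‖ξ‖ z.2 * L (0, ‖z.2‖⁻¹ • z.2) =
      profileDeriv s (2 * Real.pi * ‖ξ‖) (regHeight ε z.2) *
          (inner ℝ z.2 w.ofLp.2 / regHeight ε z.2) := by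
    rw [hLv, regDerivMult, inner_zero_right, zero_add, inner_smul_right, real_inner_comm z.2]
    field_simp
  rw [e, hLv, inner_zero_right, add_zero, real_inner_comm ξ]

end Regularization

/-! ### Test functions approximating the Poisson extension -/

section Approximation

variable {m n : ℕ} {a s : ℝ}

theorem tendsto_regHeight {ε : ℕ → ℝ} (hε : Tendsto ε atTop (𝓝 0)) (y : Euc n) :
    Tendsto (fun k => regHeight (ε k) y) atTop (𝓝 ‖y‖) := by
  rw [← regHeight_zero y]
  exact Tendsto.comp (g := fun p : ℝ × Euc n => regHeight p.1 p.2) (f := fun k => (ε k, y))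
    (continuous_regHeight.tendsto (0, y)) (hε.prodMk_nhds tendsto_const_nhds)

theorem tendsto_regMult (hs : 0 < s) {ε : ℕ → ℝ} (hε : Tendsto ε atTop (𝓝 0)) (l : ℝ) (y : Euc n) :
    Tendsto (fun k => regMult n s (ε k) l y) atTop (𝓝 (profMult n s l y)) := by
  have h := (tendsto_regHeight hε y).const_mul (2 * Real.pi * l)
  have h2 := ((continuous_profile_sq hs).tendsto (2 * Real.pi * l * ‖y‖)).comp h
  unfold regMult profMult
  exact h2

theorem tendsto_regDerivMult (hs : s ∈ Set.Ioo (0 : ℝ) 1) {ε : ℕ → ℝ}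
    (hε : Tendsto ε atTop (𝓝 0)) (l : ℝ) {y : Euc n} (hy : y ≠ 0) :
    Tendsto (fun k => regDerivMult n s (ε k) l y) atTop (𝓝 (profDerivMult n s l y)) := by
  have h0 := norm_pos_iff.2 hy
  have h := tendsto_regHeight hε y
  have h1 : Tendsto (fun k => profileDeriv s (2 * Real.pi * l) (regHeight (ε k) y)) atTop
      (𝓝 (profDerivMult n s l y)) := by
    rw [profDerivMult, profileDeriv_eq]
    simp only [profileDeriv_eq]
    exact (h.rpow_const (Or.inl h0.ne')).mul (((continuous_profileFlux hs _).tendsto _).comp h)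
  have h2 : Tendsto (fun k => ‖y‖ / regHeight (ε k) y) atTop (𝓝 1) := by
    rw [← div_self h0.ne']
    exact tendsto_const_nhds.div h h0.ne'
  have h3 := h1.mul h2
  rw [mul_one] at h3
  exact h3

/-- Convergence of synthesized fields in the energy norm when the multipliers converge pointwise and
are dominated by the limits. -/
theorem tendsto_lintegral_multField_sub (hn : 2 ≤ n) {φ : Euc m → ℝ} (hφ : IsTest φ)
    {α β : ℕ → ℝ → Euc n → ℝ} {α' β' : ℝ → Euc n → ℝ} (hα : ∀ k, IsMultiplier (α k))
    (hβ : ∀ k, IsMultiplier (β k)) (hα' : IsMultiplier α') (hβ' : IsMultiplier β')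
    (hαle : ∀ k l, 0 ≤ l → ∀ y, y ≠ 0 → |α k l y| ≤ |α' l y|)
    (hβle : ∀ k l, 0 ≤ l → ∀ y, y ≠ 0 → |β k l y| ≤ |β' l y|)
    (hαt : ∀ l y, y ≠ 0 → Tendsto (fun k => α k l y) atTop (𝓝 (α' l y)))
    (hβt : ∀ l y, y ≠ 0 → Tendsto (fun k => β k l y) atTop (𝓝 (β' l y)))
    (hfin : ∀ l, 0 ≤ l → ∫⁻ y : Euc n, ENNReal.ofReal (‖y‖ ^ a *
      ((2 * Real.pi * l) ^ 2 * α' l y ^ 2 + β' l y ^ 2)) ≠ ⊤)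
    (htot : MemLp (multField φ α' β') 2 (weightedVolume m n a)) :
    Tendsto (fun k => ∫⁻ z, ‖multField φ (α k) (β k) z - multField φ α' β' z‖ₑ ^ 2
      ∂(weightedVolume m n a)) atTop (𝓝 0) := by
  have := nontrivial_euc' hn
  have hne : ∀ᵐ y : Euc n, y ≠ 0 := by simp [ae_iff]
  have hαs := fun k => (hα k).sub hα'
  have hβs := fun k => (hβ k).sub hβ'
  -- dominated convergence in `y` at each frequency, then in `ξ`
  set J : ℕ → Euc m → Euc n → ENNReal := fun k ξ y => ENNReal.ofReal (‖y‖ ^ a *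
    ((2 * Real.pi * ‖ξ‖) ^ 2 * (α k ‖ξ‖ y - α' ‖ξ‖ y) ^ 2 + (β k ‖ξ‖ y - β' ‖ξ‖ y) ^ 2)) with hJ
  set J0 : Euc m → Euc n → ENNReal := fun ξ y => ENNReal.ofReal (‖y‖ ^ a *
    ((2 * Real.pi * ‖ξ‖) ^ 2 * α' ‖ξ‖ y ^ 2 + β' ‖ξ‖ y ^ 2)) with hJ0
  have hJm : ∀ k, Measurable (fun p : Euc m × Euc n => J k p.1 p.2) := fun k => by
    have h1 := (hαs k).measurable_comp (measurable_fst (α := Euc m) (β := Euc n)).norm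
        measurable_snd
    have h2 := (hβs k).measurable_comp (measurable_fst (α := Euc m) (β := Euc n)).norm
        measurable_snd
    have h3 : Measurable (fun p : Euc m × Euc n => ‖p.2‖ ^ a) := by fun_prop
    have h4 : Measurable (fun p : Euc m × Euc n => (2 * Real.pi * ‖p.1‖) ^ 2) := by fun_prop
    exact (h3.mul ((h4.mul (h1.pow_const 2)).add (h2.pow_const 2))).ennreal_ofReal
  have hsq : ∀ {p q : ℝ}, |p| ≤ |q| → (p - q) ^ 2 ≤ 4 * q ^ 2 := fun {p q} h => by
    have := sq_le_sq.2 h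
    nlinarith [sq_nonneg (p + q)]
  have hle : ∀ k ξ, ∀ᵐ y, J k ξ y ≤ 4 * J0 ξ y := fun k ξ => by
    filter_upwards [hne] with y hy
    have e4 : (4 : ENNReal) = ENNReal.ofReal 4 := by norm_num
    simp only [hJ, hJ0]
    rw [e4, ← ENNReal.ofReal_mul (by norm_num)]
    apply ENNReal.ofReal_le_ofReal
    have d1 := hsq (hαle k _ (norm_nonneg ξ) y hy)
    have d2 := hsq (hβle k _ (norm_nonneg ξ) y hy)
    calc _ ≤ ‖y‖ ^ a * ((2 * Real.pi * ‖ξ‖) ^ 2 * (4 * α' ‖ξ‖ y ^ 2) + 4 *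
              β' ‖ξ‖ y ^ 2) := by gcongr
      _ = _ := by ring
  have hfin' : ∀ ξ, ∫⁻ y, 4 * J0 ξ y ≠ ⊤ := fun ξ => by
    rw [lintegral_const_mul' _ _ (by norm_num)]
    exact ENNReal.mul_ne_top (by norm_num) (hfin _ (norm_nonneg ξ))
  have hinner : ∀ ξ, Tendsto (fun k => ∫⁻ y, J k ξ y) atTop (𝓝 0) := fun ξ => by
    have h := tendsto_lintegral_of_dominated_convergence (μ := (volume : Measure (Euc n)))
      (F := fun k y => J k ξ y) (f := fun _ => 0) (fun y => 4 * J0 ξ y)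
      (fun k => (hJm k).of_uncurry_left) (fun k => hle k ξ) (hfin' ξ) ?_
    · simpa using h
    · filter_upwards [hne] with y hy
      have t1 := (hαt ‖ξ‖ y hy).sub_const (α' ‖ξ‖ y)
      have t2 := (hβt ‖ξ‖ y hy).sub_const (β' ‖ξ‖ y)
      have t3 := (((t1.pow 2).const_mul ((2 * Real.pi * ‖ξ‖) ^ 2)).add
          (t2.pow 2)).const_mul (‖y‖ ^ a)
      have t4 := ENNReal.tendsto_ofReal t3
      simpa using t4
  have hsp : Measurable (fun ξ => ‖specHat φ ξ‖ₑ ^ 2) :=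
    hφ.continuous_specHat.enorm.measurable.pow_const 2
  have hout := tendsto_lintegral_of_dominated_convergence (μ := (volume : Measure (Euc m)))
    (F := fun k ξ => ‖specHat φ ξ‖ₑ ^ 2 * ∫⁻ y, J k ξ y) (f := fun _ => 0)
    (fun ξ => ‖specHat φ ξ‖ₑ ^ 2 * ∫⁻ y, 4 * J0 ξ y)
    (fun k => hsp.mul (hJm k).lintegral_prod_right')
    (fun k => Eventually.of_forall fun ξ => by
      have := lintegral_mono_ae (hle k ξ)
      dsimp only
      gcongr) ?_ ?_
  · rw [lintegral_zero] at hout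
    refine hout.congr fun k => ?_
    rw [← lintegral_multField_sq hn hφ (hαs k) (hβs k)]
    apply lintegral_congr_ae
    filter_upwards [weightedVolume_ac (ae_snd_ne_zero hn)] with z hz
    rw [multField_sub hφ (hα k) (hβ k) hα' hβ' hz]
  · have e : ∀ ξ, ‖specHat φ ξ‖ₑ ^ 2 * ∫⁻ y, 4 * J0 ξ y = 4 * (‖specHat φ ξ‖ₑ ^ 2 * ∫⁻ y, J0 ξ y) :=
      fun ξ => by rw [lintegral_const_mul' _ _ (by norm_num)]; ring
    simp only [e]
    rw [lintegral_const_mul' _ _ (by norm_num), ← lintegral_multField_sq hn hφ hα' hβ',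
      ← eLpNorm_two_sq]
    exact ENNReal.mul_ne_top (by norm_num) (ENNReal.pow_ne_top htot.2.ne)
  · refine Eventually.of_forall fun ξ => ?_
    have := ENNReal.Tendsto.const_mul (hinner ξ) (Or.inr (ENNReal.pow_ne_top (n := 2)
      (enorm_ne_top (x := specHat φ ξ))))
    simpa using this

/-- The regularized gradients converge to the extension field in the energy norm. -/
theorem tendsto_lintegral_regField (hn : 2 ≤ n) (hs : s ∈ Set.Ioo (0 : ℝ) 1)
    (han : a + n = 2 - 2 * s) {φ : Euc m → ℝ} (hφ : IsTest φ) {ε : ℕ → ℝ}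
    (hε : Tendsto ε atTop (𝓝 0)) :
    Tendsto (fun k => ∫⁻ z, ‖multField φ (regMult n s (ε k)) (regDerivMult n s (ε k)) z -
      extField n s φ z‖ₑ ^ 2 ∂(weightedVolume m n a)) atTop (𝓝 0) := by
  refine tendsto_lintegral_multField_sub hn hφ (fun k => isMultiplier_regMult hs)
    (fun k => isMultiplier_regDerivMult hs) (isMultiplier_profMult hs)
        (isMultiplier_profDerivMult hs)
    (fun k l hl y _ => ?_) (fun k l hl y hy => abs_regDerivMult_le hs hl hy)
    (fun l y _ => tendsto_regMult hs.1 hε l y) (fun l y hy => tendsto_regDerivMult hs hε l hy)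
    (fun l hl => ?_) (memLp_extField hn hs han hφ)
  · rw [abs_of_nonneg (regMult_nonneg hs.1 l y)]
    exact (regMult_le_profMult hs.1 hl y).trans (le_abs_self _)
  · have h := lintegral_profile_energy hn hs han (by positivity : 0 ≤ 2 * Real.pi * l)
    simp only [profMult, profDerivMult]
    rw [h]
    exact ENNReal.ofReal_ne_top

/-- The weighted measure of balls in the normal variable. -/
theorem lintegral_weight_ball (hn : 2 ≤ n) (ha : -(n : ℝ) < a) {r : ℝ} (hr : 0 ≤ r) :
    ∫⁻ y in Metric.ball (0 : Euc n) r, ENNReal.ofReal (‖y‖ ^ a) =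
      ENNReal.ofReal (sphereArea n / (n + a) * r ^ (n + a)) := by
  have := nontrivial_euc' hn
  have hi := integrableOn_norm_rpow_ball (volume : Measure (Euc n)) (p := a)
    (by rw [finrank_euclideanSpace_fin]; exact ha) r
  rw [← ofReal_integral_eq_lintegral_ofReal hi (Eventually.of_forall fun y => by positivity)]
  congr 1
  have e1 : ∫ y in Metric.ball (0 : Euc n) r, ‖y‖ ^ a =
      ∫ y : Euc n, (Set.Iio r).indicator (fun t : ℝ => t ^ a) ‖y‖ := by
    rw [← integral_indicator measurableSet_ball]
    congr 1
    ext y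
    simp [Set.indicator, Metric.mem_ball]
  rw [e1, integral_fun_norm_addHaar (volume : Measure (Euc n))
    (fun t => (Set.Iio r).indicator (fun t : ℝ => t ^ a) t), finrank_euclideanSpace_fin]
  have e2 : ∫ t in Set.Ioi (0 : ℝ), t ^ (n - 1) • (Set.Iio r).indicator (fun t : ℝ => t ^ a) t =
      r ^ (n + a) / (n + a) := by
    have e3 : ∀ t ∈ Set.Ioi (0 : ℝ), t ^ (n - 1) • (Set.Iio r).indicator (fun t : ℝ => t ^ a) t =
        (Set.Iio r).indicator (fun t : ℝ => t ^ (n + a - 1)) t := fun t ht => by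
      have ht : 0 < t := ht
      by_cases h : t ∈ Set.Iio r
      · rw [Set.indicator_of_mem h, Set.indicator_of_mem h, smul_eq_mul, ← Real.rpow_natCast,
          ← Real.rpow_add ht, Nat.cast_sub (by lia)]
        congr 1; push_cast; ring
      · rw [Set.indicator_of_notMem h, Set.indicator_of_notMem h, smul_zero]
    rw [setIntegral_congr_fun measurableSet_Ioi e3, integral_indicator measurableSet_Iio,
      Measure.restrict_restrict measurableSet_Iio]
    have : Set.Iio r ∩ Set.Ioi (0 : ℝ) = Set.Ioo 0 r := by
      rw [Set.inter_comm]; rfl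
    rw [this, ← integral_Ioc_eq_integral_Ioo, ← intervalIntegral.integral_of_le hr,
      integral_rpow (Or.inl (by linarith))]
    rw [sub_add_cancel, Real.zero_rpow (by linarith), sub_zero]
  rw [e2, sphereArea_eq hn]
  simp only [nsmul_eq_mul, smul_eq_mul]
  ring

end Approximation

section Cutoff

variable {m n : ℕ} {a s : ℝ}

theorem tendsto_eLpNorm_two {α E : Type*} [MeasurableSpace α] {μ : Measure α}
    [NormedAddCommGroup E] {f : ℕ → α → E}
    (h : Tendsto (fun k => ∫⁻ x, ‖f k x‖ₑ ^ 2 ∂μ) atTop (𝓝 0)) :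
    Tendsto (fun k => eLpNorm (f k) 2 μ) atTop (𝓝 0) := by
  have h2 := h.ennrpow_const (1 / 2 : ℝ)
  rw [ENNReal.zero_rpow_of_pos (by norm_num)] at h2
  refine h2.congr fun k => ?_
  rw [← eLpNorm_two_sq, ← ENNReal.rpow_natCast, ← ENNReal.rpow_mul]
  norm_num

/-- Smooth cutoff functions at scale `R`, equal to `1` on the ball of radius `R`, with derivatives
of size `1/R` supported in the ball of radius `3R`. -/
theorem exists_cutoff (m n : ℕ) : ∃ (χ : ℝ → Euc m × Euc n → ℝ) (D : ℝ), 0 ≤ D ∧ ∀ R : ℝ, 0 < R →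
    IsTest (χ R) ∧ (∀ z, |χ R z| ≤ 1) ∧ (∀ z, ‖z‖ ≤ R → χ R z = 1) ∧
    ∀ z, ‖fderiv ℝ (χ R) z‖ ≤ D / R ∧ (z ∉ Metric.ball 0 (3 * R) → fderiv ℝ (χ R) z = 0) := by
  set f : ContDiffBump (0 : Euc m × Euc n) := ⟨1, 2, by norm_num, by norm_num⟩ with hf
  have hfc : ContDiff ℝ ∞ f := f.contDiff
  have hd' : Continuous (fderiv ℝ f) := hfc.continuous_fderiv (by norm_num)
  obtain ⟨D, hD⟩ := hd'.bounded_above_of_compact_support (f.hasCompactSupport.fderiv (𝕜 := ℝ))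
  have hD0 : 0 ≤ D := (norm_nonneg _).trans (hD 0)
  refine ⟨fun R z => f (R⁻¹ • z), D, hD0, fun R hR => ?_⟩
  have hder : ∀ z, fderiv ℝ (fun z => f (R⁻¹ • z)) z = R⁻¹ • fderiv ℝ f (R⁻¹ • z) := fun z => by
    have h1 : HasFDerivAt (fun z : Euc m × Euc n => R⁻¹ • z)
        (R⁻¹ • ContinuousLinearMap.id ℝ (Euc m × Euc n)) z := (hasFDerivAt_id z).const_smul R⁻¹
    have h2 := ((hfc.differentiable (by norm_num)) (R⁻¹ • z)).hasFDerivAt.comp z h1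
    rw [show (fun z => f (R⁻¹ • z)) = f ∘ fun z => R⁻¹ • z from rfl, h2.fderiv]
    ext1 <;> simp
  refine ⟨⟨hfc.comp (contDiff_const_smul _), ?_⟩, fun z => ?_, fun z hz => ?_,
      fun z => ⟨?_, fun hz => ?_⟩⟩
  · exact f.hasCompactSupport.comp_homeomorph (Homeomorph.smulOfNeZero R⁻¹ (inv_ne_zero hR.ne'))
  · rw [abs_of_nonneg f.nonneg]; exact f.le_one
  · refine f.one_of_mem_closedBall ?_
    rw [mem_closedBall_zero_iff, norm_smul, Real.norm_of_nonneg (by positivity)]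
    exact (inv_mul_le_one₀ hR).2 hz
  · rw [hder, norm_smul, Real.norm_of_nonneg (by positivity), inv_mul_eq_div]
    gcongr
    exact hD _
  · rw [hder, fderiv_of_notMem_tsupport ℝ, smul_zero]
    rw [f.tsupport_eq, mem_closedBall_zero_iff, norm_smul,
        Real.norm_of_nonneg (by positivity), not_le]
    rw [mem_ball_zero_iff, not_lt] at hz
    change 2 < R⁻¹ * ‖z‖
    rw [inv_mul_eq_div, lt_div_iff₀ hR]
    linarith

/-- The slices `y = const` of the regularized extensions are uniformly bounded in `L²`. -/
theorem lintegral_regExt_slice_le (hs : s ∈ Set.Ioo (0 : ℝ) 1) {φ : Euc m → ℝ} (hφ : IsTest φ)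
    {ε : ℝ} (hε : 0 < ε) {y : Euc n} (hy : y ≠ 0) :
    ∫⁻ x, ‖regExt s ε φ (x, y)‖ₑ ^ 2 ≤ eLpNorm (specHat φ) 2 volume ^ 2 := by
  have h := (isMultiplier_regMult (n := n) (ε := ε) hs).isSymbol_symN.lintegral_synth_sq hφ hy
  have e : ∀ x : Euc m, regExt s ε φ (x, y) = synth φ (symN (regMult n s ε)) (x, y) := fun x =>
    regExt_eq_synth hs hφ (regHeight_pos hε y)
  simp only [e]
  rw [h, eLpNorm_two_sq]
  refine lintegral_mono fun ξ => mul_le_of_le_one_right zero_le (pow_le_one₀ zero_le ?_)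
  rw [symN, ← ofReal_norm, ENNReal.ofReal_le_one, Complex.norm_real, Real.norm_eq_abs,
    abs_of_nonneg (regMult_nonneg hs.1 _ _)]
  exact profile_le_one hs.1 (sq_nonneg _)

theorem IsTest.memLp_specHat {φ : Euc m → ℝ} (hφ : IsTest φ) : MemLp (specHat φ) 2 volume := by
  simpa using hφ.memLp_mul_specHat (b := fun _ => (1 : ℂ)) (C := 1) (k := 0)
    aestronglyMeasurable_const (by simp)

/-- The error caused by cutting off at scale `R` decays like `R^{-2s}`: the square of the derivative
of the cutoff is `O(R^{-2})`, the weighted measure of `{|y| < 3R}` in `ℝⁿ` is a multiple of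
`R^{n+a} = R^{2-2s}`, and the slices are bounded in `L²(dx)`. -/
theorem lintegral_cutoff_error_le (hn : 2 ≤ n) (hs : s ∈ Set.Ioo (0 : ℝ) 1)
    (han : a + n = 2 - 2 * s) {φ : Euc m → ℝ} (hφ : IsTest φ) {ε R D : ℝ} (hε : 0 < ε) (hR : 0 < R)
    (hD : 0 ≤ D) {χ : Euc m × Euc n → ℝ}
    (hχ : ∀ z, ‖fderiv ℝ χ z‖ ≤ D / R ∧ (z ∉ Metric.ball 0 (3 * R) → fderiv ℝ χ z = 0)) :
    ∫⁻ z, ‖regExt s ε φ z • rieszPair (fderiv ℝ χ z)‖ₑ ^ 2 ∂(weightedVolume m n a) ≤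
      ENNReal.ofReal (D ^ 2 * (sphereArea n / (n + a) * 3 ^ (n + a)) * R ^ (-(2 * s))) *
        eLpNorm (specHat φ) 2 volume ^ 2 := by
  have := nontrivial_euc' hn
  have hne : ∀ᵐ y : Euc n, y ≠ 0 := by simp [ae_iff]
  have hsa := sphereArea_pos hn
  have hna : 0 < (n : ℝ) + a := by linarith [hs.2]
  have hmE : Measurable (regExt s ε φ : Euc m × Euc n → ℝ) :=
    (contDiff_regExt hε hφ).continuous.measurable
  set f : Euc m × Euc n → ENNReal := fun z => ENNReal.ofReal ((D / R) ^ 2) *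
    ((Metric.ball (0 : Euc n) (3 * R)).indicator 1 z.2 * ‖regExt s ε φ z‖ₑ ^ 2) with hf
  have hfm : Measurable f := by
    have h1 : Measurable ((Metric.ball (0 : Euc n) (3 * R)).indicator (1 : Euc n → ENNReal)) :=
      measurable_one.indicator measurableSet_ball
    exact ((h1.comp measurable_snd).mul (hmE.enorm.pow_const 2)).const_mul _
  have hle : ∀ z, ‖regExt s ε φ z • rieszPair (fderiv ℝ χ z)‖ₑ ^ 2 ≤ f z := fun z => by
    rw [enorm_smul, mul_pow]
    by_cases hz : z ∈ Metric.ball 0 (3 * R)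
    · have hz2 : z.2 ∈ Metric.ball (0 : Euc n) (3 * R) := by
        rw [mem_ball_zero_iff] at hz ⊢
        exact (norm_snd_le z).trans_lt hz
      simp only [hf, Set.indicator_of_mem hz2, Pi.one_apply, one_mul]
      rw [mul_comm, ENNReal.ofReal_pow (by positivity)]
      gcongr
      rw [← ofReal_norm]
      exact ENNReal.ofReal_le_ofReal ((norm_rieszPair_le _).trans (hχ z).1)
    · rw [(hχ z).2 hz, rieszPair_zero]
      simp
  refine (lintegral_mono hle).trans ?_
  rw [lintegral_weightedVolume hfm.aemeasurable]
  calc _ ≤ ∫⁻ y : Euc n, (Metric.ball (0 : Euc n) (3 * R)).indicator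
          (fun y => ENNReal.ofReal (‖y‖ ^ a)) y *
        (ENNReal.ofReal ((D / R) ^ 2) * eLpNorm (specHat φ) 2 volume ^ 2) := by
        refine lintegral_mono_ae ?_
        filter_upwards [hne] with y hy
        simp only [hf]
        rw [lintegral_const_mul' _ _ ENNReal.ofReal_ne_top]
        by_cases hyb : y ∈ Metric.ball (0 : Euc n) (3 * R)
        · simp only [Set.indicator_of_mem hyb, Pi.one_apply, one_mul]
          gcongr
          exact lintegral_regExt_slice_le hs hφ hε hy
        · simp [Set.indicator_of_notMem hyb]
    _ = _ := by
        rw [lintegral_mul_const' _ _ (ENNReal.mul_ne_top ENNReal.ofReal_ne_top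
          (ENNReal.pow_ne_top hφ.memLp_specHat.2.ne)), lintegral_indicator measurableSet_ball,
          lintegral_weight_ball hn (by linarith) (by positivity), ← mul_assoc,
          ← ENNReal.ofReal_mul (by positivity)]
        congr 2
        have e1 : R ^ (-(2 * s)) = R ^ ((n : ℝ) + a) / R ^ 2 := by
          rw [← Real.rpow_natCast R 2, ← Real.rpow_sub hR]
          congr 1
          push_cast
          linarith
        rw [e1, Real.mul_rpow (by norm_num) hR.le]
        field_simp

/-- A bound uniform in `ε` and `z`; for `ε = 0` it applies to the Poisson extension off the thin
set. -/
theorem norm_regExt_le (hs : s ∈ Set.Ioo (0 : ℝ) 1) {φ : Euc m → ℝ} (hφ : IsTest φ) {ε : ℝ}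
    {z : Euc m × Euc n} (hz : 0 < regHeight ε z.2) :
    ‖regExt s ε φ z‖ ≤ ∫ ξ, ‖specHat φ ξ‖ := by
  rw [← Complex.norm_real, ← fourierInv_regMult hs hφ hz]
  refine norm_integral_le_of_norm_le ?_ (Eventually.of_forall fun ξ => ?_)
  · simpa using hφ.integrable_pow_mul_specHat 0
  · rw [norm_mul, norm_planeWave, one_mul, norm_mul, Complex.norm_real, Real.norm_eq_abs,
      abs_of_nonneg (regMult_nonneg hs.1 _ _)]
    exact mul_le_of_le_one_left (norm_nonneg _) (profile_le_one hs.1 (sq_nonneg _))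

theorem tendsto_regExt (hs : s ∈ Set.Ioo (0 : ℝ) 1) {φ : Euc m → ℝ} (hφ : IsTest φ) {ε : ℕ → ℝ}
    (hε0 : ∀ k, 0 < ε k) (hε : Tendsto ε atTop (𝓝 0)) {z : Euc m × Euc n} (hz : z.2 ≠ 0) :
    Tendsto (fun k => regExt s (ε k) φ z) atTop (𝓝 (poissonExtension n s φ z)) := by
  have h0 : 0 < regHeight 0 z.2 := by rw [regHeight_zero]; exact norm_pos_iff.2 hz
  have hφ0 := hφ.integrable_pow_mul_specHat 0
  simp only [pow_zero, one_mul] at hφ0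
  have key : Tendsto (fun k => ∫ ξ, planeWave ξ z.1 *
      ((regMult n s (ε k) ‖ξ‖ z.2 : ℂ) * specHat φ ξ))
      atTop (𝓝 (∫ ξ, planeWave ξ z.1 * ((profMult n s ‖ξ‖ z.2 : ℂ) * specHat φ ξ))) := by
    refine tendsto_integral_of_dominated_convergence (fun ξ => ‖specHat φ ξ‖) (fun k => ?_) hφ0
      (fun k => Eventually.of_forall fun ξ => ?_) (Eventually.of_forall fun ξ => ?_)
    · have h1 : Measurable (fun ξ : Euc m => planeWave ξ z.1) :=
        (continuous_planeWave.comp (continuous_id.prodMk continuous_const)).measurable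
      have h2 : Measurable (fun ξ : Euc m => regMult n s (ε k) ‖ξ‖ z.2) :=
        (isMultiplier_regMult hs).measurable_comp measurable_norm measurable_const
      exact (h1.mul ((Complex.measurable_ofReal.comp h2).mul
        hφ.continuous_specHat.measurable)).aestronglyMeasurable
    · rw [norm_mul, norm_planeWave, one_mul, norm_mul, Complex.norm_real, Real.norm_eq_abs,
        abs_of_nonneg (regMult_nonneg hs.1 _ _)]
      exact mul_le_of_le_one_left (norm_nonneg _) (profile_le_one hs.1 (sq_nonneg _))
    · exact (((Complex.continuous_ofReal.tendsto _).comp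
        (tendsto_regMult hs.1 hε ‖ξ‖ z.2)).mul_const _).const_mul _
  have e1 : ∀ k, ∫ ξ, planeWave ξ z.1 * ((regMult n s (ε k) ‖ξ‖ z.2 : ℂ) * specHat φ ξ) =
      (regExt s (ε k) φ z : ℂ) := fun k => fourierInv_regMult hs hφ (regHeight_pos (hε0 k) _)
  have e2 : ∫ ξ, planeWave ξ z.1 * ((profMult n s ‖ξ‖ z.2 : ℂ) * specHat φ ξ) =
      (poissonExtension n s φ z : ℂ) := by
    rw [← regExt_zero, ← fourierInv_regMult hs hφ h0]
    simp only [regMult, profMult, regHeight_zero]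
  simp only [e1, e2] at key
  exact (Complex.continuous_re.tendsto _).comp key

theorem aestronglyMeasurable_poissonExtension (hn : 2 ≤ n) (hs : s ∈ Set.Ioo (0 : ℝ) 1)
    {φ : Euc m → ℝ} (hφ : IsTest φ) : AEStronglyMeasurable (poissonExtension n s φ) volume := by
  refine AEStronglyMeasurable.congr
    ((isMultiplier_profMult (n := n) hs).isSymbol_symN.measurable_synth hφ).aestronglyMeasurable ?_
  filter_upwards [ae_snd_ne_zero hn] with z hz
  have h0 : 0 < regHeight 0 z.2 := by rw [regHeight_zero]; exact norm_pos_iff.2 hz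
  rw [← regExt_zero, regExt_eq_synth hs hφ h0]
  congr 2
  ext l y
  simp only [regMult, profMult, regHeight_zero]

/-- The Poisson extension of a test function is the limit, in the energy space, of the cut off
regularized extensions. -/
theorem exists_test_tendsto_extension (hn : 2 ≤ n) (hs : s ∈ Set.Ioo (0 : ℝ) 1)
    (han : a + n = 2 - 2 * s) {φ : Euc m → ℝ} (hφ : IsTest φ) :
    ∃ ψ : ℕ → Euc m × Euc n → ℝ, (∀ k, IsTest (ψ k)) ∧
      Tendsto (fun k => eLpNorm (grad (ψ k) - extField n s φ) 2 (weightedVolume m n a))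
          atTop (𝓝 0) ∧
      TendstoL1loc ψ (poissonExtension n s φ) := by
  obtain ⟨χ, D, hD0, hχ⟩ := exists_cutoff m n
  set μ := weightedVolume m n a with hμ
  have hneμ : ∀ᵐ z ∂μ, z.2 ≠ 0 := weightedVolume_ac (ae_snd_ne_zero hn)
  -- the regularization parameter `1/(k+1)` and the cutoff scale `k+1` can be chosen independently
  set R : ℕ → ℝ := fun k => (k : ℝ) + 1 with hRdef
  have hR : ∀ k, 0 < R k := fun k => by positivity
  have hRt : Tendsto R atTop atTop := tendsto_atTop_add_const_right _ _ tendsto_natCast_atTop_atTop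
  set ε : ℕ → ℝ := fun k => 1 / ((k : ℝ) + 1) with hεdef
  have hε0 : ∀ k, 0 < ε k := fun k => by positivity
  have hεt : Tendsto ε atTop (𝓝 0) := tendsto_one_div_add_atTop_nhds_zero_nat
  set E : ℕ → Euc m × Euc n → ℝ := fun k => regExt s (ε k) φ with hE
  have hEc : ∀ k, ContDiff ℝ ∞ (E k) := fun k => contDiff_regExt (hε0 k) hφ
  set ψ : ℕ → Euc m × Euc n → ℝ := fun k z => χ (R k) z * E k z with hψdef
  have hψ : ∀ k, IsTest (ψ k) := fun k =>
    ⟨(hχ _ (hR k)).1.1.mul (hEc k), (hχ _ (hR k)).1.2.mul_right⟩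
  have hG := memLp_extField hn hs han hφ
  set G := extField n s φ with hGdef
  set M : ℕ → Euc m × Euc n → WithLp 2 (Euc m × Euc n) := fun k =>
    multField φ (regMult n s (ε k)) (regDerivMult n s (ε k)) with hM
  have hMm : ∀ k, AEStronglyMeasurable (M k) μ := fun k => (measurable_multField hφ
    (isMultiplier_regMult hs) (isMultiplier_regDerivMult hs)).aestronglyMeasurable
  have hMt : Tendsto (fun k => eLpNorm (fun z => M k z - G z) 2 μ) atTop (𝓝 0) :=
    tendsto_eLpNorm_two (tendsto_lintegral_regField hn hs han hφ hεt)
  have hχm : ∀ k, Measurable (χ (R k)) := fun k => (hχ _ (hR k)).1.continuous.measurable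
  refine ⟨ψ, hψ, ?_, ?_⟩
  · -- the error has three sources: the regularization (`f1`), the truncation of `G` (`f2`), and the
    -- derivative of the cutoff (`f3`)
    set f1 : ℕ → Euc m × Euc n → WithLp 2 (Euc m × Euc n) :=
        fun k z => χ (R k) z • (M k z - G z) with hf1
    set f2 : ℕ → Euc m × Euc n → WithLp 2 (Euc m × Euc n) :=
        fun k z => (χ (R k) z - 1) • G z with hf2
    set f3 : ℕ → Euc m × Euc n → WithLp 2 (Euc m × Euc n) := fun k z =>
      E k z • rieszPair (fderiv ℝ (χ (R k)) z) with hf3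
    have m1 : ∀ k, AEStronglyMeasurable (f1 k) μ := fun k =>
      (hχm k).aestronglyMeasurable.smul ((hMm k).sub hG.1)
    have m2 : ∀ k, AEStronglyMeasurable (f2 k) μ := fun k =>
      ((hχm k).sub_const 1).aestronglyMeasurable.smul hG.1
    have m3 : ∀ k, AEStronglyMeasurable (f3 k) μ := fun k =>
      (((hEc k).continuous).smul (continuous_rieszPair.comp
        ((hχ _ (hR k)).1.1.continuous_fderiv (by norm_num)))).aestronglyMeasurable
    have hdec : ∀ k, grad (ψ k) - G =ᵐ[μ] f1 k + f2 k + f3 k := fun k => by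
      filter_upwards [hneμ] with z hz
      have d1 := (hχ _ (hR k)).1.differentiable z
      have d2 : DifferentiableAt ℝ (E k) z := (hEc k).differentiable (by norm_num) z
      have hg : grad (E k) z = M k z := grad_regExt hs (hε0 k) hφ hz
      have e : grad (ψ k) z = χ (R k) z • M k z + E k z • rieszPair (fderiv ℝ (χ (R k)) z) := by
        refine ext_inner_left ℝ fun w => ?_
        rw [inner_grad ((hψ k).differentiable z), ← hg, inner_add_right, inner_smul_right,
          inner_smul_right, inner_grad d2, inner_rieszPair]
        have := fderiv_fun_mul d1 d2
        simp only [hψdef]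
        rw [this]
        rfl
      simp only [Pi.sub_apply, Pi.add_apply, hf1, hf2, hf3, e, smul_sub, sub_smul, one_smul]
      abel
    have t1 : Tendsto (fun k => eLpNorm (f1 k) 2 μ) atTop (𝓝 0) := by
      refine tendsto_of_tendsto_of_tendsto_of_le_of_le tendsto_const_nhds hMt (fun _ => zero_le)
          fun k => ?_
      refine eLpNorm_mono fun z => ?_
      simp only [hf1]
      rw [norm_smul]
      exact mul_le_of_le_one_left (norm_nonneg _) ((hχ _ (hR k)).2.1 z)
    have t2 : Tendsto (fun k => eLpNorm (f2 k) 2 μ) atTop (𝓝 0) := by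
      refine tendsto_eLpNorm_two ?_
      have hfin : ∫⁻ z, 4 * ‖G z‖ₑ ^ 2 ∂μ ≠ ⊤ := by
        rw [lintegral_const_mul' _ _ (by norm_num), ← eLpNorm_two_sq]
        exact ENNReal.mul_ne_top (by norm_num) (ENNReal.pow_ne_top hG.2.ne)
      have h := tendsto_lintegral_of_dominated_convergence' (μ := μ)
        (F := fun k z => ‖f2 k z‖ₑ ^ 2) (f := fun _ => 0) (fun z => 4 * ‖G z‖ₑ ^ 2)
        (fun k => (m2 k).enorm.pow_const 2) (fun k => Eventually.of_forall fun z => ?_) hfin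
        (Eventually.of_forall fun z => ?_)
      · simpa using h
      · simp only [hf2]
        rw [enorm_smul, mul_pow]
        gcongr
        have : ‖χ (R k) z - 1‖ ≤ 2 := by
          refine (norm_sub_le _ _).trans ?_
          have := (hχ _ (hR k)).2.1 z
          rw [norm_one, Real.norm_eq_abs]
          linarith
        calc ‖χ (R k) z - 1‖ₑ ^ 2 ≤ 2 ^ 2 := by
              gcongr
              rw [← ofReal_norm]
              exact (ENNReal.ofReal_le_ofReal this).trans (by norm_num)
          _ = 4 := by norm_num
      · refine tendsto_const_nhds.congr' ?_
        filter_upwards [hRt.eventually_ge_atTop ‖z‖] with k hk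
        simp only [hf2]
        rw [(hχ _ (hR k)).2.2.1 z hk]
        simp
    have t3 : Tendsto (fun k => eLpNorm (f3 k) 2 μ) atTop (𝓝 0) := by
      refine tendsto_eLpNorm_two ?_
      refine tendsto_of_tendsto_of_tendsto_of_le_of_le tendsto_const_nhds ?_ (fun _ => zero_le)
        fun k => lintegral_cutoff_error_le hn hs han hφ (hε0 k) (hR k) hD0 (hχ _ (hR k)).2.2.2
      have h1 := (tendsto_rpow_neg_atTop (mul_pos two_pos hs.1)).comp hRt
      have h2 := ENNReal.tendsto_ofReal
          (h1.const_mul (D ^ 2 * (sphereArea n / (n + a) * 3 ^ (n + a))))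
      have h3 := ENNReal.Tendsto.mul_const h2
          (Or.inr (ENNReal.pow_ne_top (n := 2) hφ.memLp_specHat.2.ne))
      simpa using h3
    refine tendsto_of_tendsto_of_tendsto_of_le_of_le tendsto_const_nhds
      (by simpa using (t1.add t2).add t3) (fun _ => zero_le) fun k => ?_
    rw [eLpNorm_congr_ae (hdec k)]
    refine (eLpNorm_add_le ((m1 k).add (m2 k)) (m3 k) (by norm_num)).trans ?_
    gcongr
    exact eLpNorm_add_le (m1 k) (m2 k) (by norm_num)
  · intro K hK
    set B : ℝ := ∫ ξ, ‖specHat φ ξ‖ with hB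
    have hB0 : 0 ≤ B := integral_nonneg fun ξ => norm_nonneg _
    have hne : ∀ᵐ z ∂(volume.restrict K : Measure (Euc m × Euc n)), z.2 ≠ 0 :=
      ae_restrict_of_ae (ae_snd_ne_zero hn)
    have h := tendsto_lintegral_of_dominated_convergence' (μ := volume.restrict K)
      (F := fun k z => ‖ψ k z - poissonExtension n s φ z‖ₑ) (f := fun _ => 0)
      (fun _ => ENNReal.ofReal (B + B))
      (fun k => ((hψ k).continuous.aestronglyMeasurable.sub
        (aestronglyMeasurable_poissonExtension hn hs hφ).restrict).enorm) (fun k => ?_) ?_ ?_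
    · simpa using h
    · filter_upwards [hne] with z hz
      have h0 : 0 < regHeight 0 z.2 := by rw [regHeight_zero]; exact norm_pos_iff.2 hz
      have b1 : ‖E k z‖ ≤ B := norm_regExt_le hs hφ (regHeight_pos (hε0 k) _)
      have b2 : ‖poissonExtension n s φ z‖ ≤ B := by
        rw [← regExt_zero]; exact norm_regExt_le hs hφ h0
      rw [← ofReal_norm]
      apply ENNReal.ofReal_le_ofReal
      refine (norm_sub_le _ _).trans (add_le_add ?_ b2)
      simp only [hψdef, norm_mul]
      exact (mul_le_of_le_one_left (norm_nonneg _) ((hχ _ (hR k)).2.1 z)).trans b1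
    · rw [lintegral_const]
      refine ENNReal.mul_ne_top ENNReal.ofReal_ne_top ?_
      rw [Measure.restrict_apply_univ]
      exact hK.measure_lt_top.ne
    · filter_upwards [hne] with z hz
      have h1 : Tendsto (fun k => ψ k z) atTop (𝓝 (poissonExtension n s φ z)) := by
        refine (tendsto_regExt hs hφ hε0 hεt hz).congr' ?_
        filter_upwards [hRt.eventually_ge_atTop ‖z‖] with k hk
        simp only [hψdef]
        rw [(hχ _ (hR k)).2.2.1 z hk, one_mul]
      have h2 := (h1.sub_const (poissonExtension n s φ z)).enorm
      simpa using h2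

end Cutoff

/-! ### The energy controls local integrals -/

section LocalBound

variable {m n : ℕ} {a s : ℝ}

theorem finrank_pair (m n : ℕ) : Module.finrank ℝ (Euc m × Euc n) = m + n := by simp

/-- The weighted `L²` norm of `|y|^{-a}` on a ball is finite and scales like the power
`(m + n - a)/2` of the radius: its square is `∫ |y|^{-a}`, and `a ≤ 0`. -/
theorem eLpNorm_inv_weight_le (hn : 2 ≤ n) (ha : a ≤ 0) {r : ℝ} (hr : 0 < r) :
    eLpNorm (fun z : Euc m × Euc n => (Metric.ball (0 : Euc m × Euc n) r).indicator
      (fun z => ‖z.2‖ ^ (-a)) z) 2 (weightedVolume m n a) ≤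
    ENNReal.ofReal (√((volume : Measure (Euc m × Euc n)).real (Metric.ball 0 1)) *
      r ^ (((m : ℝ) + n - a) / 2)) := by
  have := nontrivial_euc' hn
  have hm1 : Measurable ((Metric.ball (0 : Euc m × Euc n) r).indicator
      (fun z : Euc m × Euc n => ‖z.2‖ ^ (-a))) := by
    refine Measurable.indicator ?_ measurableSet_ball
    fun_prop
  set V := (volume : Measure (Euc m × Euc n)).real (Metric.ball 0 1) with hV
  have hVE : (volume : Measure (Euc m × Euc n)) (Metric.ball 0 1) = ENNReal.ofReal V := by
    rw [hV, Measure.real, ENNReal.ofReal_toReal measure_ball_lt_top.ne]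
  have hsq : eLpNorm (fun z : Euc m × Euc n => (Metric.ball (0 : Euc m × Euc n) r).indicator
      (fun z => ‖z.2‖ ^ (-a)) z) 2 (weightedVolume m n a) ^ 2 ≤
      ENNReal.ofReal (√V * r ^ (((m : ℝ) + n - a) / 2)) ^ 2 := by
    rw [eLpNorm_two_sq, weightedVolume, lintegral_withDensity_eq_lintegral_mul _ measurable_weight
      (hm1.enorm.pow_const 2)]
    calc _ ≤ ∫⁻ z : Euc m × Euc n, (Metric.ball (0 : Euc m × Euc n) r).indicator
          (fun _ => ENNReal.ofReal (r ^ (-a))) z := by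
          refine lintegral_mono_ae ?_
          filter_upwards [ae_snd_ne_zero (m := m) hn] with z hz
          by_cases hzb : z ∈ Metric.ball (0 : Euc m × Euc n) r
          · have h0 := norm_pos_iff.2 hz
            have hzr : ‖z.2‖ ≤ r := (norm_snd_le z).trans (mem_ball_zero_iff.1 hzb).le
            simp only [Pi.mul_apply, Set.indicator_of_mem hzb]
            rw [← ofReal_norm, ← ENNReal.ofReal_pow (norm_nonneg _),
                ← ENNReal.ofReal_mul (by positivity),
              Real.norm_of_nonneg (by positivity)]
            apply ENNReal.ofReal_le_ofReal
            have e : ‖z.2‖ ^ a * (‖z.2‖ ^ (-a)) ^ 2 = ‖z.2‖ ^ (-a) := by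
              rw [← Real.rpow_natCast, ← Real.rpow_mul h0.le, ← Real.rpow_add h0]
              congr 1; push_cast; ring
            rw [e]
            exact Real.rpow_le_rpow h0.le hzr (by linarith)
          · simp [Set.indicator_of_notMem hzb]
      _ = _ := by
          rw [lintegral_indicator_const measurableSet_ball, Measure.addHaar_ball _ _ hr.le,
              finrank_pair,
            hVE, ← ENNReal.ofReal_mul (by positivity), ← ENNReal.ofReal_mul (by positivity),
            ← ENNReal.ofReal_pow (by positivity)]
          congr 1
          have hV0 : 0 ≤ V := ENNReal.toReal_nonneg
          rw [mul_pow, Real.sq_sqrt hV0, ← Real.rpow_natCast (r ^ _) 2, ← Real.rpow_mul hr.le,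
            ← Real.rpow_natCast r (m + n), show ((m : ℝ) + n - a) / 2 * (2 : ℕ) =
                (m + n : ℕ) + -a by
              push_cast; ring, Real.rpow_add hr]
          ring
  exact (ENNReal.pow_le_pow_left_iff two_ne_zero).1 hsq

/-- Weighted square integrable functions are locally integrable, by the Cauchy-Schwarz inequality
against `|y|^{-a}`. -/
theorem setLIntegral_ball_le (hn : 2 ≤ n) (ha : a ≤ 0) {E : Type*} [NormedAddCommGroup E]
    {f : Euc m × Euc n → E} (hf : AEStronglyMeasurable f (weightedVolume m n a)) {r : ℝ}
    (hr : 0 < r) :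
    ∫⁻ z in Metric.ball (0 : Euc m × Euc n) r, ‖f z‖ₑ ≤ eLpNorm f 2 (weightedVolume m n a) *
      ENNReal.ofReal (√((volume : Measure (Euc m × Euc n)).real (Metric.ball 0 1)) *
        r ^ (((m : ℝ) + n - a) / 2)) := by
  have hm1 : Measurable ((Metric.ball (0 : Euc m × Euc n) r).indicator
      (fun z : Euc m × Euc n => ‖z.2‖ ^ (-a))) := by
    refine Measurable.indicator ?_ measurableSet_ball
    fun_prop
  have hf' : AEStronglyMeasurable f volume := hf.mono_ac (volume_ac_weightedVolume hn)
  calc ∫⁻ z in Metric.ball (0 : Euc m × Euc n) r, ‖f z‖ₑ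
      = ∫⁻ z, ‖f z‖ₑ * ‖(Metric.ball (0 : Euc m × Euc n) r).indicator
          (fun z => ‖z.2‖ ^ (-a)) z‖ₑ ∂(weightedVolume m n a) := by
        refine Eq.trans ?_ (lintegral_withDensity_eq_lintegral_mul₀ measurable_weight.aemeasurable
          (hf'.enorm.mul hm1.enorm.aemeasurable)).symm
        rw [← lintegral_indicator measurableSet_ball]
        apply lintegral_congr_ae
        filter_upwards [ae_snd_ne_zero (m := m) hn] with z hz
        by_cases hzb : z ∈ Metric.ball (0 : Euc m × Euc n) r
        · have h0 := norm_pos_iff.2 hz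
          simp only [Pi.mul_apply, Set.indicator_of_mem hzb]
          rw [mul_left_comm, ← ofReal_norm (‖z.2‖ ^ (-a)), Real.norm_of_nonneg (by positivity),
            ← ENNReal.ofReal_mul (by positivity), ← Real.rpow_add h0]
          simp
        · simp [Set.indicator_of_notMem hzb]
    _ ≤ _ := (lintegral_enorm_mul_le_eLpNorm_two hf hm1.aestronglyMeasurable).trans
        (by gcongr; exact eLpNorm_inv_weight_le hn ha hr)

theorem norm_toLp_le (z : Euc m × Euc n) :
    ‖(WithLp.toLp 2 z : WithLp 2 (Euc m × Euc n))‖ ≤ 2 * ‖z‖ := by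
  have h : ‖(WithLp.toLp 2 z : WithLp 2 (Euc m × Euc n))‖ ^ 2 ≤ (2 * ‖z‖) ^ 2 := by
    rw [WithLp.prod_norm_sq_eq_of_L2]
    have h1 := norm_fst_le z
    have h2 := norm_snd_le z
    change ‖z.1‖ ^ 2 + ‖z.2‖ ^ 2 ≤ _
    have := norm_nonneg z.1
    have := norm_nonneg z.2
    nlinarith
  exact (sq_le_sq₀ (norm_nonneg _) (by positivity)).1 h

/-- The factor between the energy norm and the `L¹` norm on the ball of radius `R`. The integral is
over the position `|t| ≥ 1` on a ray: `|t|^{-(m+n)}` is the Jacobian of the dilation by `|t|`, the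
other factor the bound of `setLIntegral_ball_le` on the ball of radius `|t|R`. -/
noncomputable def localConst (m n : ℕ) (a R : ℝ) : ENNReal :=
  ENNReal.ofReal (2 * R) * ∫⁻ t in Set.Iic (-1 : ℝ), ENNReal.ofReal (|t| ^ (-(m + n : ℕ) : ℝ)) *
    ENNReal.ofReal (√((volume : Measure (Euc m × Euc n)).real (Metric.ball 0 1)) *
      (|t| * R) ^ (((m : ℝ) + n - a) / 2))

theorem integrableOn_abs_rpow {p : ℝ} (hp : p < -1) :
    IntegrableOn (fun t : ℝ => |t| ^ p) (Set.Iic (-1)) := by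
  have hi := integrableOn_Ioi_rpow_of_lt (a := p) (c := 1 / 2) hp (by norm_num)
  have h : IntegrableOn ((fun t : ℝ => t ^ p) ∘ Neg.neg) (Neg.neg ⁻¹' Set.Ioi (1 / 2 : ℝ)) :=
    ((Measure.measurePreserving_neg (volume : Measure ℝ)).integrableOn_comp_preimage
      (Homeomorph.neg ℝ).measurableEmbedding).2 hi
  refine (h.mono_set fun t ht => ?_).congr_fun (fun t ht => ?_) measurableSet_Iic
  · have : t ≤ -1 := ht
    change (1 / 2 : ℝ) < -t
    linarith
  · have : t < 0 := lt_of_le_of_lt ht (by norm_num)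
    simp [abs_of_neg this]

theorem lintegral_scale_ne_top {p q C R : ℝ} (hC : 0 ≤ C) (hpq : p + q < -1) (hR : 0 < R) :
    ∫⁻ t in Set.Iic (-1 : ℝ),
        ENNReal.ofReal (|t| ^ p) * ENNReal.ofReal (C * (|t| * R) ^ q) ≠ ⊤ := by
  have h3 := ((integrableOn_abs_rpow hpq).const_mul (C * R ^ q)).2
  refine (lt_of_le_of_lt (le_of_eq ?_) h3).ne
  refine setLIntegral_congr_fun measurableSet_Iic fun t ht => ?_
  have ht0 : 0 < |t| := abs_pos.2 (lt_of_le_of_lt ht (by norm_num)).ne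
  change ENNReal.ofReal (|t| ^ p) * ENNReal.ofReal (C * (|t| * R) ^ q) =
    ‖C * R ^ q * |t| ^ (p + q)‖ₑ
  rw [← ENNReal.ofReal_mul (by positivity), ← ofReal_norm, Real.norm_of_nonneg (by positivity),
    Real.mul_rpow ht0.le hR.le, Real.rpow_add ht0]
  congr 1
  ring

/-- The integrand in `localConst` is a multiple of `|t|^{-(m+n+a)/2}`, which is integrable at
infinity when `m + n + a > 2`. -/
theorem localConst_ne_top (hda : 2 < (m : ℝ) + n + a) {R : ℝ} (hR : 0 < R) :
    localConst m n a R ≠ ⊤ :=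
  ENNReal.mul_ne_top ENNReal.ofReal_ne_top
    (lintegral_scale_ne_top (Real.sqrt_nonneg _) (by push_cast; linarith) hR)

/-- The `L¹` norm of a test function on a ball is bounded by its energy: integrate the gradient
along the rays through the origin, from infinity. -/
theorem IsTest.setLIntegral_ball_le (hn : 2 ≤ n) (ha : a ≤ 0) {ψ : Euc m × Euc n → ℝ}
    (hψ : IsTest ψ) {R : ℝ} (hR : 0 < R) :
    ∫⁻ z in Metric.ball (0 : Euc m × Euc n) R, ‖ψ z‖ₑ ≤
      localConst m n a R * eLpNorm (grad ψ) 2 (weightedVolume m n a) := by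
  have := nontrivial_euc' hn
  have hgc := continuous_grad hψ
  have hray : ∀ z ∈ Metric.ball (0 : Euc m × Euc n) R, z ≠ 0 →
      ‖ψ z‖ₑ ≤ ∫⁻ t in Set.Iic (-1 : ℝ), ENNReal.ofReal (2 * R) * ‖grad ψ ((-t) • z)‖ₑ := by
    intro z hz hz0
    -- the ray through `z`, parametrized from infinity at `t = -∞` to `z` at `t = -1`
    set f : ℝ → ℝ := fun t => ψ ((-t) • z) with hf
    have hfc : ContDiff ℝ 1 f := (hψ.1.of_le (by norm_cast)).comp (by fun_prop)
    have hemb : Topology.IsClosedEmbedding (fun t : ℝ => (-t) • z) :=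
      (isClosedEmbedding_smul_left hz0).comp (Homeomorph.neg ℝ).isClosedEmbedding
    have hfs : HasCompactSupport f := hψ.2.comp_isClosedEmbedding hemb
    have h := hfs.enorm_le_lintegral_Ici_deriv hfc (-1)
    have e : f (-1) = ψ z := by simp [hf]
    rw [e] at h
    refine h.trans (lintegral_mono fun t => ?_)
    have hd : HasDerivAt f (fderiv ℝ ψ ((-t) • z) (-z)) t := by
      have h1 : HasDerivAt (fun t : ℝ => (-t) • z) (-z) t := by
        simpa using (hasDerivAt_neg t).smul_const z
      exact ((hψ.differentiable _).hasFDerivAt).comp_hasDerivAt t h1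
    rw [hd.deriv, ← inner_grad (hψ.differentiable _) (WithLp.toLp 2 (-z)), ← ofReal_norm,
        ← ofReal_norm,
      ← ENNReal.ofReal_mul (by positivity)]
    apply ENNReal.ofReal_le_ofReal
    refine (norm_inner_le_norm _ _).trans ?_
    gcongr
    refine (norm_toLp_le _).trans ?_
    rw [norm_neg]
    have := (mem_ball_zero_iff.1 hz).le
    gcongr
  -- dilation by `|t|` carries the ball of radius `R` to the ball of radius `|t| R`
  have hscale : ∀ t ∈ Set.Iic (-1 : ℝ), ∫⁻ z in Metric.ball (0 : Euc m × Euc n) R,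
      ‖grad ψ ((-t) • z)‖ₑ ≤
      ENNReal.ofReal (|t| ^ (-(m + n : ℕ) : ℝ)) *
        (eLpNorm (grad ψ) 2 (weightedVolume m n a) *
        ENNReal.ofReal (√((volume : Measure (Euc m × Euc n)).real (Metric.ball 0 1)) *
          (|t| * R) ^ (((m : ℝ) + n - a) / 2))) := by
    intro t ht
    have ht0 : t < 0 := lt_of_le_of_lt ht (by norm_num)
    have hta : |t| = -t := abs_of_neg ht0
    have htp : 0 < -t := by linarith
    set F : Euc m × Euc n → ENNReal :=
      (Metric.ball (0 : Euc m × Euc n) (|t| * R)).indicator fun z => ‖grad ψ z‖ₑ with hF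
    have hFm : Measurable F := hgc.enorm.measurable.indicator measurableSet_ball
    have e1 : ∫⁻ z in Metric.ball (0 : Euc m × Euc n) R, ‖grad ψ ((-t) • z)‖ₑ =
        ∫⁻ z, F ((-t) • z) := by
      rw [← lintegral_indicator measurableSet_ball]
      congr 1
      ext z
      have : (-t) • z ∈ Metric.ball (0 : Euc m × Euc n) (|t| * R) ↔ z ∈ Metric.ball 0 R := by
        rw [mem_ball_zero_iff, mem_ball_zero_iff, norm_smul, Real.norm_of_nonneg htp.le, hta]
        exact mul_lt_mul_iff_right₀ htp
      by_cases hz : z ∈ Metric.ball (0 : Euc m × Euc n) R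
      · rw [Set.indicator_of_mem hz, hF, Set.indicator_of_mem (this.2 hz)]
      · rw [Set.indicator_of_notMem hz, hF, Set.indicator_of_notMem (fun h => hz (this.1 h))]
    rw [e1, ← lintegral_map hFm (measurable_const_smul (-t)),
      Measure.map_addHaar_smul (volume : Measure (Euc m × Euc n)) htp.ne', lintegral_smul_measure,
      finrank_pair, hF, lintegral_indicator measurableSet_ball, smul_eq_mul]
    have e2 : |((-t) ^ (m + n))⁻¹| = |t| ^ (-(m + n : ℕ) : ℝ) := by
      rw [abs_of_nonneg (by positivity), hta, Real.rpow_neg htp.le, Real.rpow_natCast]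
    rw [e2]
    gcongr
    exact ThinExtension.setLIntegral_ball_le hn ha hgc.aestronglyMeasurable
      (mul_pos (by rw [hta]; exact htp) hR)
  have hgm : Measurable
      (fun p : (Euc m × Euc n) × ℝ => ENNReal.ofReal (2 * R) * ‖grad ψ ((-p.2) • p.1)‖ₑ) := by
    have : Continuous (fun p : (Euc m × Euc n) × ℝ => grad ψ ((-p.2) • p.1)) :=
        hgc.comp (by fun_prop)
    exact this.enorm.measurable.const_mul _
  calc ∫⁻ z in Metric.ball (0 : Euc m × Euc n) R, ‖ψ z‖ₑ
      ≤ ∫⁻ z in Metric.ball (0 : Euc m × Euc n) R,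
          ∫⁻ t in Set.Iic (-1 : ℝ), ENNReal.ofReal (2 * R) * ‖grad ψ ((-t) • z)‖ₑ := by
        refine lintegral_mono_ae ?_
        have hz0 : ∀ᵐ z ∂(volume.restrict (Metric.ball (0 : Euc m × Euc n) R)), z ≠ 0 := by
          refine ae_restrict_of_ae ?_
          filter_upwards [ae_snd_ne_zero (m := m) hn] with z hz h
          exact hz (by rw [h]; rfl)
        filter_upwards [hz0, ae_restrict_mem measurableSet_ball] with z h0 hz using hray z hz h0
    _ = ∫⁻ t in Set.Iic (-1 : ℝ), ENNReal.ofReal (2 * R) *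
          ∫⁻ z in Metric.ball (0 : Euc m × Euc n) R, ‖grad ψ ((-t) • z)‖ₑ := by
        rw [lintegral_lintegral_swap hgm.aemeasurable]
        simp only [lintegral_const_mul' _ _ ENNReal.ofReal_ne_top]
    _ ≤ ∫⁻ t in Set.Iic (-1 : ℝ), ENNReal.ofReal (2 * R) *
          ((ENNReal.ofReal (|t| ^ (-(m + n : ℕ) : ℝ)) *
        ENNReal.ofReal (√((volume : Measure (Euc m × Euc n)).real (Metric.ball 0 1)) *
          (|t| * R) ^ (((m : ℝ) + n - a) / 2))) * eLpNorm (grad ψ) 2 (weightedVolume m n a)) := by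
        refine setLIntegral_mono' measurableSet_Iic fun t ht => ?_
        have h := hscale t ht
        rw [mul_comm (eLpNorm _ _ _), ← mul_assoc] at h
        gcongr
    _ = _ := by
        have hmeas : Measurable fun t : ℝ => ENNReal.ofReal (|t| ^ (-(m + n : ℕ) : ℝ)) *
            ENNReal.ofReal (√((volume : Measure (Euc m × Euc n)).real (Metric.ball 0 1)) *
            (|t| * R) ^ (((m : ℝ) + n - a) / 2)) := by fun_prop
        rw [lintegral_const_mul' _ _ ENNReal.ofReal_ne_top, lintegral_mul_const _ hmeas, localConst,
          mul_assoc]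

end LocalBound

/-! ### Uniqueness of the weak gradient -/

section GradientUniqueness

variable {m n : ℕ} {a : ℝ}

/-- Completeness of `L²` for sequences of functions, with a Cauchy condition in terms of a null
sequence. -/
theorem exists_tendsto_eLpNorm_two {α E : Type*} [MeasurableSpace α] {μ : Measure α}
    [NormedAddCommGroup E] [CompleteSpace E] {f : ℕ → α → E} (hf : ∀ k, MemLp (f k) 2 μ)
    {e : ℕ → ENNReal} (he : Tendsto e atTop (𝓝 0))
    (h : ∀ j k, eLpNorm (f j - f k) 2 μ ≤ e j + e k) :
    ∃ G, MemLp G 2 μ ∧ Tendsto (fun k => eLpNorm (f k - G) 2 μ) atTop (𝓝 0) := by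
  have hc : CauchySeq fun k => (hf k).toLp (f k) := by
    rw [EMetric.cauchySeq_iff]
    intro ε hε
    obtain ⟨N, hN⟩ := eventually_atTop.1 (he.eventually_lt_const (ENNReal.half_pos hε.ne'))
    refine ⟨N, fun j hj k hk => ?_⟩
    rw [Lp.edist_toLp_toLp]
    calc _ ≤ e j + e k := h j k
      _ < ε / 2 + ε / 2 := ENNReal.add_lt_add (hN j hj) (hN k hk)
      _ = ε := ENNReal.add_halves ε
  obtain ⟨G, hG⟩ := cauchySeq_tendsto_of_complete hc
  refine ⟨G, Lp.memLp G, ?_⟩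
  have := (Lp.tendsto_Lp_iff_tendsto_eLpNorm' _ G).1 hG
  refine this.congr fun k => eLpNorm_congr_ae ?_
  filter_upwards [(hf k).coeFn_toLp] with x hx
  simp [hx]

theorem tendsto_eLpNorm_of_sub {α E : Type*} [MeasurableSpace α] {μ : Measure α}
    [NormedAddCommGroup E] {f : ℕ → α → E} {g : α → E} (hf : ∀ k, MemLp (f k) 2 μ)
    (hg : MemLp g 2 μ) (h : Tendsto (fun k => eLpNorm (f k - g) 2 μ) atTop (𝓝 0)) :
    Tendsto (fun k => eLpNorm (f k) 2 μ) atTop (𝓝 (eLpNorm g 2 μ)) := by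
  have h1 := h.const_add (eLpNorm g 2 μ)
  have h2 := ENNReal.Tendsto.sub (tendsto_const_nhds (x := eLpNorm g 2 μ)) h
    (Or.inl hg.2.ne)
  rw [add_zero] at h1
  rw [tsub_zero] at h2
  refine tendsto_of_tendsto_of_tendsto_of_le_of_le h2 h1 (fun k => ?_) (fun k => ?_)
  · refine tsub_le_iff_right.2 ?_
    calc eLpNorm g 2 μ = eLpNorm (f k - (f k - g)) 2 μ := by rw [sub_sub_cancel]
      _ ≤ _ := eLpNorm_sub_le (hf k).1 ((hf k).sub hg).1 (by norm_num)
  · calc eLpNorm (f k) 2 μ = eLpNorm (g + (f k - g)) 2 μ := by rw [add_sub_cancel]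
      _ ≤ _ := eLpNorm_add_le hg.1 ((hf k).sub hg).1 (by norm_num)

theorem TendstoD1a.sub (hn : 2 ≤ n) (ha : -(n : ℝ) < a) {φ ψ : ℕ → Euc m × Euc n → ℝ}
    {U V : Euc m × Euc n → ℝ} {G H : Euc m × Euc n → WithLp 2 (Euc m × Euc n)}
    (hU : TendstoD1a a φ U G) (hV : TendstoD1a a ψ V H) :
    TendstoD1a a (fun k => φ k - ψ k) (U - V) (G - H) where
  test k := (hU.test k).sub (hV.test k)
  locInt := hU.locInt.sub hV.locInt
  tendsto_fun := hU.tendsto_fun.sub hV.tendsto_fun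
    (fun k => (hU.test k).continuous.aestronglyMeasurable) hU.locInt.aestronglyMeasurable
  memLp := hU.memLp.sub hV.memLp
  tendsto_energy := by
    have h1 := hU.tendsto_energy.add hV.tendsto_energy
    rw [add_zero] at h1
    refine tendsto_of_tendsto_of_tendsto_of_le_of_le tendsto_const_nhds h1 (fun _ => zero_le) ?_
    intro k
    have e : grad (φ k - ψ k) - (G - H) = (grad (φ k) - G) - (grad (ψ k) - H) := by
      rw [grad_sub (hU.test k) (hV.test k)]
      abel
    simp only [e]
    exact eLpNorm_sub_le ((memLp_grad hn ha (hU.test k)).sub hU.memLp).1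
      ((memLp_grad hn ha (hV.test k)).sub hV.memLp).1 (by norm_num)

theorem TendstoD1a.tendsto_eLpNorm (hn : 2 ≤ n) (ha : -(n : ℝ) < a) {φ : ℕ → Euc m × Euc n → ℝ}
    {U : Euc m × Euc n → ℝ} {G : Euc m × Euc n → WithLp 2 (Euc m × Euc n)}
    (hU : TendstoD1a a φ U G) :
    Tendsto (fun k => eLpNorm (grad (φ k)) 2 (weightedVolume m n a)) atTop
      (𝓝 (eLpNorm G 2 (weightedVolume m n a))) :=
  tendsto_eLpNorm_of_sub (fun k => memLp_grad hn ha (hU.test k)) hU.memLp hU.tendsto_energy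

/-- The energy controls the local `L¹` norms of the elements of `𝓓^{1,a}`. -/
theorem TendstoD1a.setLIntegral_ball_le (hn : 2 ≤ n) (ha : -(n : ℝ) < a) (ha0 : a ≤ 0)
    (hda : 2 < (m : ℝ) + n + a) {φ : ℕ → Euc m × Euc n → ℝ} {U : Euc m × Euc n → ℝ}
    {G : Euc m × Euc n → WithLp 2 (Euc m × Euc n)} (hU : TendstoD1a a φ U G) {R : ℝ} (hR : 0 < R) :
    ∫⁻ z in Metric.ball (0 : Euc m × Euc n) R, ‖U z‖ₑ ≤
      localConst m n a R * eLpNorm G 2 (weightedVolume m n a) := by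
  have key : ∀ f : Euc m × Euc n → ℝ, ∫⁻ z, ‖f z‖ₑ * (Metric.ball (0 : Euc m × Euc n) R).indicator
      (fun _ => (1 : ENNReal)) z = ∫⁻ z in Metric.ball (0 : Euc m × Euc n) R, ‖f z‖ₑ := by
    intro f
    rw [← lintegral_indicator measurableSet_ball]
    congr 1
    ext z
    by_cases hz : z ∈ Metric.ball (0 : Euc m × Euc n) R <;> simp [hz]
  rw [← key]
  refine hU.tendsto_fun.lintegral_mul_le (fun k => (hU.test k).continuous.aestronglyMeasurable)
    hU.locInt.aestronglyMeasurable ((measurable_const.indicator measurableSet_ball).aemeasurable)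
    (B := fun k => localConst m n a R * eLpNorm (grad (φ k)) 2 (weightedVolume m n a)) ?_
    (ENNReal.Tendsto.const_mul (hU.tendsto_eLpNorm hn ha) (Or.inr (localConst_ne_top hda hR)))
  intro k
  rw [key]
  exact (hU.test k).setLIntegral_ball_le hn ha0 hR

/-- An element of `𝓓^{1,a}` with vanishing gradient vanishes. -/
theorem HasEnergyGradient.ae_eq_zero_of_eLpNorm_eq_zero (hn : 2 ≤ n) (ha : -(n : ℝ) < a)
    (ha0 : a ≤ 0) (hda : 2 < (m : ℝ) + n + a) {U : Euc m × Euc n → ℝ}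
    {G : Euc m × Euc n → WithLp 2 (Euc m × Euc n)} (hU : HasEnergyGradient a U G)
    (hG : eLpNorm G 2 (weightedVolume m n a) = 0) : U =ᵐ[volume] 0 := by
  obtain ⟨φ, hφ⟩ := hU
  have h1 : ∀ N : ℕ, ∀ᵐ z ∂(volume.restrict (Metric.ball (0 : Euc m × Euc n) (N + 1))),
      U z = 0 := by
    intro N
    have h := hφ.setLIntegral_ball_le hn ha ha0 hda (R := N + 1) (by positivity)
    rw [hG, mul_zero, nonpos_iff_eq_zero,
      lintegral_eq_zero_iff' hφ.locInt.aestronglyMeasurable.restrict.enorm] at h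
    filter_upwards [h] with z hz
    simpa using hz
  have h2 : (⋃ N : ℕ, Metric.ball (0 : Euc m × Euc n) (N + 1)) = Set.univ :=
    Set.eq_univ_of_forall fun z => Set.mem_iUnion.2 <| by
      obtain ⟨N, hN⟩ := exists_nat_gt ‖z‖
      exact ⟨N, mem_ball_zero_iff.2 (by linarith)⟩
  have h3 := (ae_restrict_iUnion_iff (fun N : ℕ => Metric.ball (0 : Euc m × Euc n) (N + 1))
    (fun z => U z = 0)).2 h1
  rwa [h2, Measure.restrict_univ] at h3

/-- Pairings with a fixed compactly supported function are controlled by the `L¹` norm on a ball. -/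
theorem exists_lintegral_enorm_mul_le {X E : Type*} [NormedAddCommGroup X] [MeasureSpace X]
    [BorelSpace X] [NormedAddCommGroup E] {η : X → ℝ} (hη : Continuous η)
    (hc : HasCompactSupport η) : ∃ (C : ENNReal) (R : ℝ), C ≠ ⊤ ∧ 0 < R ∧ ∀ f : X → E,
      ∫⁻ x, ‖η x‖ₑ * ‖f x‖ₑ ≤ C * ∫⁻ x in Metric.ball 0 R, ‖f x‖ₑ := by
  obtain ⟨C, hC⟩ := hc.exists_bound_of_continuous hη
  obtain ⟨R, hR, hsub⟩ := hc.isCompact.isBounded.subset_ball_lt 0 0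
  refine ⟨ENNReal.ofReal C, R, ENNReal.ofReal_ne_top, hR, fun f => ?_⟩
  rw [← lintegral_const_mul' _ _ ENNReal.ofReal_ne_top, ← lintegral_indicator measurableSet_ball]
  refine lintegral_mono fun x => ?_
  by_cases hx : x ∈ Metric.ball (0 : X) R
  · simp only [Set.indicator_of_mem hx]
    gcongr
    rw [← ofReal_norm]
    exact ENNReal.ofReal_le_ofReal (hC x)
  · simp [image_eq_zero_of_notMem_tsupport (fun h => hx (hsub h))]

/-- The gradient of the zero element of `𝓓^{1,a}` vanishes: integrate by parts against a test
function, using that `G` is locally integrable because `a ≤ 0`. -/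
theorem TendstoD1a.ae_eq_zero (hn : 2 ≤ n) (ha : -(n : ℝ) < a) (ha0 : a ≤ 0)
    {χ : ℕ → Euc m × Euc n → ℝ} {G : Euc m × Euc n → WithLp 2 (Euc m × Euc n)}
    (hχ : TendstoD1a a χ 0 G) : G =ᵐ[volume] 0 := by
  have hloc : LocallyIntegrable G volume := by
    rw [locallyIntegrable_iff]
    intro K hK
    obtain ⟨R, hR, hsub⟩ := hK.isBounded.subset_ball_lt 0 0
    refine IntegrableOn.mono_set ⟨(hχ.memLp.1.mono_ac
        (volume_ac_weightedVolume hn)).restrict, ?_⟩ hsub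
    exact (ThinExtension.setLIntegral_ball_le hn ha0 hχ.memLp.1 hR).trans_lt
      (ENNReal.mul_lt_top hχ.memLp.2 ENNReal.ofReal_lt_top)
  refine ae_eq_zero_of_integral_contDiff_smul_eq_zero hloc fun η hη hηc => ?_
  have hηt : IsTest η := ⟨hη, hηc⟩
  have hηi : ∀ k, Integrable (fun z => η z • grad (χ k) z) volume := fun k =>
    (hη.continuous.smul (continuous_grad (hχ.test k))).integrable_of_hasCompactSupport
        hηc.smul_right
  have hηG : Integrable (fun z => η z • G z) volume :=
    hloc.integrable_smul_left_of_hasCompactSupport hη.continuous hηc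
  have hlim : Tendsto (fun k => ∫ z, η z • grad (χ k) z) atTop (𝓝 (∫ z, η z • G z)) := by
    obtain ⟨C, R, hC, hR, hb⟩ := exists_lintegral_enorm_mul_le
      (E := WithLp 2 (Euc m × Euc n)) hη.continuous hηc
    rw [tendsto_iff_edist_tendsto_0]
    refine tendsto_of_tendsto_of_tendsto_of_le_of_le tendsto_const_nhds
      (h := fun k => C * (eLpNorm (grad (χ k) - G) 2 (weightedVolume m n a) *
        ENNReal.ofReal (√((volume : Measure (Euc m × Euc n)).real (Metric.ball 0 1)) *
        R ^ (((m : ℝ) + n - a) / 2)))) ?_ (fun _ => zero_le) (fun k => ?_)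
    · have h1 := ENNReal.Tendsto.mul_const hχ.tendsto_energy (Or.inr (ENNReal.ofReal_ne_top
        (r := √((volume : Measure (Euc m × Euc n)).real (Metric.ball 0 1)) *
        R ^ (((m : ℝ) + n - a) / 2))))
      simpa using ENNReal.Tendsto.const_mul h1 (Or.inr hC)
    · rw [edist_eq_enorm_sub, ← integral_sub (hηi k) hηG]
      refine (enorm_integral_le_lintegral_enorm _).trans ?_
      have := hb (grad (χ k) - G)
      refine le_trans (le_of_eq ?_) (this.trans ?_)
      · refine lintegral_congr fun z => ?_
        rw [← smul_sub, enorm_smul]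
        rfl
      · exact mul_le_mul' le_rfl (ThinExtension.setLIntegral_ball_le hn ha0
          ((memLp_grad hn ha (hχ.test k)).sub hχ.memLp).1 hR)
  refine ext_inner_left ℝ fun w => ?_
  rw [inner_zero_right]
  have hlim2 : Tendsto (fun k => inner ℝ w (∫ z, η z • grad (χ k) z)) atTop
      (𝓝 (inner ℝ w (∫ z, η z • G z))) := tendsto_const_nhds.inner hlim
  refine tendsto_nhds_unique hlim2 ?_
  have hd : Continuous fun z => fderiv ℝ η z w.ofLp :=
    (hη.continuous_fderiv (by simp)).clm_apply continuous_const
  have hdc : HasCompactSupport fun z => fderiv ℝ η z w.ofLp :=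
    hηc.fderiv_apply (𝕜 := ℝ) w.ofLp
  have hparts : ∀ k, inner ℝ w (∫ z, η z • grad (χ k) z) = -∫ z, fderiv ℝ η z w.ofLp * χ k z := by
    intro k
    have hχk := hχ.test k
    rw [← integral_inner (hηi k)]
    have e : ∀ z, inner ℝ w (η z • grad (χ k) z) = η z * fderiv ℝ (χ k) z w.ofLp := fun z => by
      rw [real_inner_smul_right, inner_grad (hχk.differentiable z)]
    simp only [e]
    refine integral_mul_fderiv_eq_neg_fderiv_mul_of_integrable ?_ ?_ ?_
      (fun z _ => hηt.differentiable z) (fun z _ => hχk.differentiable z)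
    · exact (hd.mul hχk.1.continuous).integrable_of_hasCompactSupport hdc.mul_right
    · exact (hη.continuous.mul ((hχk.1.continuous_fderiv (by simp)).clm_apply
        continuous_const)).integrable_of_hasCompactSupport hηc.mul_right
    · exact (hη.continuous.mul hχk.1.continuous).integrable_of_hasCompactSupport hηc.mul_right
  simp only [hparts]
  rw [← neg_zero]
  refine Tendsto.neg ?_
  obtain ⟨C, R, hC, hR, hb⟩ := exists_lintegral_enorm_mul_le (E := ℝ) hd hdc
  rw [tendsto_iff_edist_tendsto_0]
  have h0 := ENNReal.Tendsto.const_mul (hχ.tendsto_fun _ (isCompact_closedBall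
    (0 : Euc m × Euc n) R)) (Or.inr hC)
  rw [mul_zero] at h0
  refine tendsto_of_tendsto_of_tendsto_of_le_of_le tendsto_const_nhds h0 (fun _ => zero_le)
      fun k => ?_
  rw [edist_zero_right]
  refine (enorm_integral_le_lintegral_enorm _).trans ?_
  simp only [enorm_mul]
  refine (hb _).trans ?_
  refine mul_le_mul' le_rfl ?_
  simp only [Pi.zero_apply, sub_zero]
  exact lintegral_mono_set Metric.ball_subset_closedBall

/-- The energy gradient of an element of `𝓓^{1,a}` is unique. -/
theorem HasEnergyGradient.ae_eq (hn : 2 ≤ n) (ha : -(n : ℝ) < a) (ha0 : a ≤ 0)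
    {U : Euc m × Euc n → ℝ} {G H : Euc m × Euc n → WithLp 2 (Euc m × Euc n)}
    (hG : HasEnergyGradient a U G) (hH : HasEnergyGradient a U H) :
    G =ᵐ[weightedVolume m n a] H := by
  obtain ⟨φ, hφ⟩ := hG
  obtain ⟨ψ, hψ⟩ := hH
  have h := hφ.sub hn ha hψ
  rw [sub_self] at h
  exact (sub_ae_eq_zero _ _).1 (weightedVolume_ac.ae_eq (h.ae_eq_zero hn ha ha0))

end GradientUniqueness

/-! ### The Poisson extension of an element of `𝓓^s` -/

section PoissonExtension

variable {m n : ℕ} {a s : ℝ}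

/-- A bound for the norm, as a functional on `𝓓^s`, of the evaluation of Poisson extensions at
height `r`. -/
noncomputable def evalConst (m : ℕ) (s r : ℝ) : ENNReal :=
  dualityConst m s * (eLpNorm (radialKernel s r : Euc m → ℝ) 1 volume +
    eLpNorm (radialKernel s r : Euc m → ℝ) 2 volume)

theorem evalConst_ne_top (hs : s ∈ Set.Ioo (0 : ℝ) 1) (hm : 2 * s < m) {r : ℝ} (hr : 0 < r) :
    evalConst m s r ≠ ⊤ :=
  ENNReal.mul_ne_top (dualityConst_ne_top hs hm) (ENNReal.add_ne_top.2
    ⟨(memLp_one_iff_integrable.2 (integrable_radialKernel hs.1 hr)).2.ne,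
      (memLp_radialKernel hs.1 hr).2.ne⟩)

theorem TendstoDs.lintegral_mul_poissonKernel_le {φ : ℕ → Euc m → ℝ} {u g : Euc m → ℝ}
    (H : TendstoDs s φ u g) (hs : s ∈ Set.Ioo (0 : ℝ) 1) (hm : 2 * s < m) (x : Euc m) {y : Euc n}
    (hy : y ≠ 0) :
    ∫⁻ ξ, ‖u ξ * poissonKernel s (x - ξ) y‖ₑ ≤ evalConst m s ‖y‖ * eLpNorm g 2 volume := by
  have hr := norm_pos_iff.2 hy
  have hmp := Measure.measurePreserving_sub_left (volume : Measure (Euc m)) x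
  have h1 := (integrable_radialKernel (m := m) hs.1 hr).comp_sub_left x
  have h2 := (memLp_radialKernel (m := m) hs.1 hr).comp_measurePreserving hmp
  have h := H.lintegral_mul_le hs hm h1 h2
  have e1 := eLpNorm_comp_measurePreserving (p := 1) (memLp_radialKernel (m := m) hs.1 hr).1 hmp
  have e2 := eLpNorm_comp_measurePreserving (p := 2) (memLp_radialKernel (m := m) hs.1 hr).1 hmp
  simp only [enorm_mul, poissonKernel_eq, evalConst]
  rw [← e1, ← e2]
  exact h

theorem TendstoDs.integrable_mul_poissonKernel {φ : ℕ → Euc m → ℝ} {u g : Euc m → ℝ}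
    (H : TendstoDs s φ u g) (hs : s ∈ Set.Ioo (0 : ℝ) 1) (hm : 2 * s < m) (x : Euc m) {y : Euc n}
    (hy : y ≠ 0) : Integrable fun ξ => u ξ * poissonKernel s (x - ξ) y := by
  have hr := norm_pos_iff.2 hy
  refine ⟨H.locInt.aestronglyMeasurable.mul ?_, ?_⟩
  · simp only [poissonKernel_eq]
    exact ((continuous_radialKernel hr).comp
        (continuous_const.sub continuous_id)).aestronglyMeasurable
  · exact (H.lintegral_mul_poissonKernel_le hs hm x hy).trans_lt
      (ENNReal.mul_lt_top (evalConst_ne_top hs hm hr).lt_top H.memLp.2)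

theorem TendstoDs.enorm_poissonExtension_le {φ : ℕ → Euc m → ℝ} {u g : Euc m → ℝ}
    (H : TendstoDs s φ u g) (hs : s ∈ Set.Ioo (0 : ℝ) 1) (hm : 2 * s < m) {z : Euc m × Euc n}
    (hz : z.2 ≠ 0) :
    ‖poissonExtension n s u z‖ₑ ≤ evalConst m s ‖z.2‖ * eLpNorm g 2 volume :=
  (enorm_integral_le_lintegral_enorm _).trans (H.lintegral_mul_poissonKernel_le hs hm z.1 hz)

theorem IsTest.tendstoDs {φ : Euc m → ℝ} (hφ : IsTest φ) (hs : s ∈ Set.Ioo (0 : ℝ) 1) :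
    TendstoDs s (fun _ => φ) φ (fracLaplacian (s / 2) φ) where
  test _ := hφ
  locInt := hφ.continuous.locallyIntegrable
  tendsto_fun K _ := by simp
  memLp := hφ.memLp_fracLaplacian hs
  tendsto_energy := by simp

/-- Point evaluations of Poisson extensions off the thin set are continuous on `𝓓^s`. -/
theorem TendstoDs.tendsto_poissonExtension {φ : ℕ → Euc m → ℝ} {u g : Euc m → ℝ}
    (H : TendstoDs s φ u g) (hs : s ∈ Set.Ioo (0 : ℝ) 1) (hm : 2 * s < m) {z : Euc m × Euc n}
    (hz : z.2 ≠ 0) :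
    Tendsto (fun k => poissonExtension n s (φ k) z) atTop (𝓝 (poissonExtension n s u z)) := by
  rw [tendsto_iff_edist_tendsto_0]
  have h0 := ENNReal.Tendsto.const_mul H.tendsto_energy
    (Or.inr (evalConst_ne_top hs hm (norm_pos_iff.2 hz)))
  rw [mul_zero] at h0
  refine tendsto_of_tendsto_of_tendsto_of_le_of_le tendsto_const_nhds h0 (fun _ => zero_le)
      fun k => ?_
  have hk := (H.test k).tendstoDs hs
  have e : poissonExtension n s (φ k - u) z =
      poissonExtension n s (φ k) z - poissonExtension n s u z := by
    simp only [poissonExtension, Pi.sub_apply, sub_mul]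
    exact integral_sub (hk.integrable_mul_poissonKernel hs hm z.1 hz)
      (H.integrable_mul_poissonKernel hs hm z.1 hz)
  rw [edist_eq_enorm_sub, ← e]
  exact (hk.sub H hs).enorm_poissonExtension_le hs hm hz

end PoissonExtension

/-! ### Closedness of the energy space -/

section Closedness

variable {m n : ℕ} {a s : ℝ}

theorem TendstoL1loc.locallyIntegrable {X : Type*} [NormedAddCommGroup X] [ProperSpace X]
    [MeasureSpace X] {φ : ℕ → X → ℝ} {u : X → ℝ} (h : TendstoL1loc φ u)
    (hφ : ∀ k, LocallyIntegrable (φ k) volume) (hu : AEStronglyMeasurable u volume) :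
    LocallyIntegrable u volume := by
  rw [locallyIntegrable_iff]
  intro K hK
  obtain ⟨k, hk⟩ := ((h K hK).eventually_lt_const ENNReal.zero_lt_top).exists
  have hi : IntegrableOn (φ k) K volume := (hφ k).integrableOn_isCompact hK
  have hd : IntegrableOn (φ k - u) K volume := ⟨hi.1.sub hu.restrict, hk⟩
  simpa using hi.sub hd

/-- The energy space is closed: gradients converging in the weighted `L²` space, together with
functions converging almost everywhere, converge to an element of `𝓓^{1,a}`; approximating test
functions are found along a diagonal. -/
theorem exists_diagonal (hn : 2 ≤ n) (ha : -(n : ℝ) < a) (ha0 : a ≤ 0)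
    (hda : 2 < (m : ℝ) + n + a) {Ψ : ℕ → ℕ → Euc m × Euc n → ℝ} {E : ℕ → Euc m × Euc n → ℝ}
    {M : ℕ → Euc m × Euc n → WithLp 2 (Euc m × Euc n)} (hΨ : ∀ k, TendstoD1a a (Ψ k) (E k) (M k))
    {U : Euc m × Euc n → ℝ} {G : Euc m × Euc n → WithLp 2 (Euc m × Euc n)}
    (hU : ∀ᵐ z, Tendsto (fun k => E k z) atTop (𝓝 (U z))) (hG : MemLp G 2 (weightedVolume m n a))
    (hM : Tendsto (fun k => eLpNorm (M k - G) 2 (weightedVolume m n a)) atTop (𝓝 0)) :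
    ∃ l : ℕ → ℕ, TendstoD1a a (fun k => Ψ k (l k)) U G ∧
      Tendsto (fun k => eLpNorm (grad (Ψ k (l k)) - M k) 2 (weightedVolume m n a)) atTop (𝓝 0) := by
  have hUm : AEStronglyMeasurable U volume :=
    aestronglyMeasurable_of_tendsto_ae atTop (fun k => (hΨ k).locInt.aestronglyMeasurable) hU
  -- the local bound for `E k - E j`, in the limit `j → ∞` by Fatou's lemma
  have hball : ∀ (k : ℕ) (R : ℝ), 0 < R → ∫⁻ z in Metric.ball (0 : Euc m × Euc n) R,
      ‖E k z - U z‖ₑ ≤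
      localConst m n a R * eLpNorm (M k - G) 2 (weightedVolume m n a) := by
    intro k R hR
    have hlim : Tendsto (fun j => eLpNorm (M k - M j) 2 (weightedVolume m n a)) atTop
        (𝓝 (eLpNorm (M k - G) 2 (weightedVolume m n a))) := by
      refine tendsto_eLpNorm_of_sub (fun j => (hΨ k).memLp.sub (hΨ j).memLp) ((hΨ k).memLp.sub hG)
        (hM.congr fun j => ?_)
      rw [← eLpNorm_neg]
      congr 1
      abel
    calc ∫⁻ z in Metric.ball (0 : Euc m × Euc n) R, ‖E k z - U z‖ₑ
        ≤ ∫⁻ z in Metric.ball (0 : Euc m × Euc n) R, liminf (fun j => ‖(E k - E j) z‖ₑ) atTop := by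
          refine lintegral_mono_ae (ae_restrict_of_ae ?_)
          filter_upwards [hU] with z hz
          exact ((hz.const_sub (E k z)).enorm).liminf_eq.ge
      _ ≤ liminf (fun j => ∫⁻ z in Metric.ball (0 : Euc m × Euc n) R, ‖(E k - E j) z‖ₑ) atTop :=
          lintegral_liminf_le' fun j =>
            ((hΨ k).locInt.aestronglyMeasurable.sub
                (hΨ j).locInt.aestronglyMeasurable).restrict.enorm
      _ ≤ liminf (fun j => localConst m n a R *
          eLpNorm (M k - M j) 2 (weightedVolume m n a)) atTop :=
          liminf_le_liminf (Eventually.of_forall fun j =>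
            ((hΨ k).sub hn ha (hΨ j)).setLIntegral_ball_le hn ha ha0 hda hR)
      _ = _ := (ENNReal.Tendsto.const_mul hlim (Or.inr (localConst_ne_top hda hR))).liminf_eq
  have hEU : TendstoL1loc E U := by
    intro K hK
    obtain ⟨R, hR, hsub⟩ := hK.isBounded.subset_ball_lt 0 0
    have h0 := ENNReal.Tendsto.const_mul hM (Or.inr (localConst_ne_top (m := m) (n := n) hda hR))
    rw [mul_zero] at h0
    exact tendsto_of_tendsto_of_tendsto_of_le_of_le tendsto_const_nhds h0
        (fun _ => zero_le) fun k =>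
      (lintegral_mono_set hsub).trans (hball k R hR)
  have hone : Tendsto (fun k : ℕ => ENNReal.ofReal (1 / ((k : ℝ) + 1))) atTop (𝓝 0) := by
    simpa using ENNReal.tendsto_ofReal tendsto_one_div_add_atTop_nhds_zero_nat
  have hpos : ∀ k : ℕ, 0 < ENNReal.ofReal (1 / ((k : ℝ) + 1)) := fun k =>
    ENNReal.ofReal_pos.2 (by positivity)
  -- for each `k`, an index at which `Ψ k` is within `1/(k+1)` of its limits, on the ball of radius
  -- `k`
  have hex : ∀ k : ℕ, ∃ l : ℕ, eLpNorm (grad (Ψ k l) - M k) 2 (weightedVolume m n a) <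
        ENNReal.ofReal (1 / ((k : ℝ) + 1)) ∧
      ∫⁻ z in Metric.closedBall (0 : Euc m × Euc n) k, ‖Ψ k l z - E k z‖ₑ <
        ENNReal.ofReal (1 / ((k : ℝ) + 1)) := fun k =>
    (((hΨ k).tendsto_energy.eventually_lt_const (hpos k)).and
      (((hΨ k).tendsto_fun _ (isCompact_closedBall (0 : Euc m × Euc n) k)).eventually_lt_const
        (hpos k))).exists
  choose l hl1 hl2 using hex
  have hgrad : Tendsto (fun k => eLpNorm (grad (Ψ k (l k)) - M k) 2 (weightedVolume m n a))
      atTop (𝓝 0) :=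
    tendsto_of_tendsto_of_tendsto_of_le_of_le tendsto_const_nhds hone (fun _ => zero_le)
      fun k => (hl1 k).le
  refine ⟨l, ⟨fun k => (hΨ k).test _, hEU.locallyIntegrable (fun k => (hΨ k).locInt) hUm,
      ?_, hG, ?_⟩,
    hgrad⟩
  · intro K hK
    have hsum := hone.add (hEU K hK)
    rw [add_zero] at hsum
    obtain ⟨R, hsub⟩ := hK.isBounded.subset_closedBall (0 : Euc m × Euc n)
    refine tendsto_of_tendsto_of_tendsto_of_le_of_le' tendsto_const_nhds hsum
      (Eventually.of_forall fun _ => zero_le) ?_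
    filter_upwards [eventually_ge_atTop ⌈R⌉₊] with k hk
    have hKk : K ⊆ Metric.closedBall (0 : Euc m × Euc n) k :=
      hsub.trans (Metric.closedBall_subset_closedBall (Nat.ceil_le.1 hk))
    have hm : AEMeasurable (fun z => ‖Ψ k (l k) z - E k z‖ₑ) (volume.restrict K) :=
      (((hΨ k).test (l k)).continuous.aestronglyMeasurable.sub
        (hΨ k).locInt.aestronglyMeasurable).restrict.enorm
    calc ∫⁻ z in K, ‖Ψ k (l k) z - U z‖ₑ
        ≤ ∫⁻ z in K, (‖Ψ k (l k) z - E k z‖ₑ + ‖E k z - U z‖ₑ) := by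
          refine lintegral_mono fun z => ?_
          rw [← sub_add_sub_cancel (Ψ k (l k) z) (E k z) (U z)]
          exact enorm_add_le _ _
      _ = (∫⁻ z in K, ‖Ψ k (l k) z - E k z‖ₑ) + ∫⁻ z in K, ‖E k z - U z‖ₑ :=
          lintegral_add_left' hm _
      _ ≤ _ := by
          gcongr
          exact (lintegral_mono_set hKk).trans (hl2 k).le
  · have hsum := hgrad.add hM
    rw [add_zero] at hsum
    refine tendsto_of_tendsto_of_tendsto_of_le_of_le tendsto_const_nhds hsum (fun _ => zero_le)
        fun k => ?_
    have e : grad (Ψ k (l k)) - G = (grad (Ψ k (l k)) - M k) + (M k - G) := by abel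
    simp only [e]
    exact eLpNorm_add_le ((memLp_grad hn ha ((hΨ k).test _)).sub (hΨ k).memLp).1
      ((hΨ k).memLp.sub hG).1 (by norm_num)

end Closedness

/-! ### The weak equation and the energy of the Poisson extension -/

section Existence

variable {m n : ℕ} {a s : ℝ}

theorem le_mul_of_mul_sq_le {c : ℝ} (hc : 0 < c) {x y : ENNReal}
    (h : ENNReal.ofReal c * x ^ 2 ≤ y ^ 2) :
    x ≤ ENNReal.ofReal (√c)⁻¹ * y := by
  have hc' : 0 < √c := Real.sqrt_pos.2 hc
  have h1 : (ENNReal.ofReal √c * x) ^ 2 ≤ y ^ 2 := by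
    rw [mul_pow, ← ENNReal.ofReal_pow hc'.le, Real.sq_sqrt hc.le]
    exact h
  have h2 := (ENNReal.pow_le_pow_left_iff two_ne_zero).1 h1
  calc x = ENNReal.ofReal (√c)⁻¹ * (ENNReal.ofReal √c * x) := by
        rw [← mul_assoc, ← ENNReal.ofReal_mul (by positivity), inv_mul_cancel₀ hc'.ne',
          ENNReal.ofReal_one, one_mul]
    _ ≤ _ := by gcongr

/-- The extension is, up to a factor, an isometry from `𝓓^s` to the gradients of `𝓓^{1,a}`. -/
theorem eLpNorm_extField_sub (hn : 2 ≤ n) (hs : s ∈ Set.Ioo (0 : ℝ) 1) (han : a + n = 2 - 2 * s)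
    {φ ψ : Euc m → ℝ} (hφ : IsTest φ) (hψ : IsTest ψ) :
    eLpNorm (extField n s φ - extField n s ψ) 2 (weightedVolume m n a) =
      ENNReal.ofReal √(energyConst n s) *
        eLpNorm (fracLaplacian (s / 2) φ - fracLaplacian (s / 2) ψ) 2 volume := by
  have hc := energyConst_pos hn hs
  have e : extField n s φ - extField n s ψ =ᵐ[weightedVolume m n a] extField n s (φ - ψ) := by
    filter_upwards [weightedVolume_ac (ae_snd_ne_zero (m := m) hn)] with z hz
    exact (extField_sub hs hφ hψ hz).symm
  rw [eLpNorm_congr_ae e, ← fracLaplacian_sub hφ hψ hs]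
  have h := integral_extField_sq hn hs han (hφ.sub hψ)
  have h1 := ofReal_integral_norm_sq (memLp_extField hn hs han (hφ.sub hψ))
  have h2 := ofReal_integral_norm_sq ((hφ.sub hψ).memLp_fracLaplacian hs)
  rw [h, ENNReal.ofReal_mul hc.le, h2] at h1
  rw [← Real.sq_sqrt hc.le, ENNReal.ofReal_pow (Real.sqrt_nonneg _), ← mul_pow] at h1
  exact (le_antisymm ((ENNReal.pow_le_pow_left_iff two_ne_zero).1 h1.le)
    ((ENNReal.pow_le_pow_left_iff two_ne_zero).1 h1.ge)).symm

/-- The Poisson extension of a test function belongs to `𝓓^{1,a}`, with gradient `extField`. -/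
theorem IsTest.exists_tendstoD1a (hn : 2 ≤ n) (hs : s ∈ Set.Ioo (0 : ℝ) 1)
    (han : a + n = 2 - 2 * s) {φ : Euc m → ℝ} (hφ : IsTest φ) :
    ∃ ψ, TendstoD1a a ψ (poissonExtension n s φ) (extField n s φ) := by
  obtain ⟨ψ, h1, h2, h3⟩ := exists_test_tendsto_extension hn hs han hφ
  exact ⟨ψ, h1, h3.locallyIntegrable (fun k => (h1 k).continuous.locallyIntegrable)
    (aestronglyMeasurable_poissonExtension hn hs hφ), h3, memLp_extField hn hs han hφ, h2⟩

/-- The approximating test functions of an element of `𝓓^s` may be replaced by others at vanishing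
distance in the energy norm. -/
theorem TendstoDs.of_tendsto_sub (hs : s ∈ Set.Ioo (0 : ℝ) 1) (hm : 2 * s < m)
    {φ χ : ℕ → Euc m → ℝ} {u g : Euc m → ℝ} (H : TendstoDs s φ u g) (hχ : ∀ k, IsTest (χ k))
    (h : Tendsto (fun k => eLpNorm (fracLaplacian (s / 2) (χ k) - fracLaplacian (s / 2) (φ k)) 2
      volume) atTop (𝓝 0)) : TendstoDs s χ u g where
  test := hχ
  locInt := H.locInt
  memLp := H.memLp
  tendsto_fun := by
    intro K hK
    -- the duality estimate with the indicator function of `K` as the weight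
    set w : Euc m → ℝ := K.indicator fun _ => 1 with hw
    have hKm := hK.measurableSet
    have hKf := hK.measure_lt_top (μ := (volume : Measure (Euc m)))
    have w1 : Integrable w := (integrable_indicator_iff hKm).2 (integrableOn_const hKf.ne)
    have w2 : MemLp w 2 volume := memLp_indicator_const 2 hKm 1 (Or.inr hKf.ne)
    have hm0 : 0 < m := by
      have : (0 : ℝ) < m := by linarith [hs.1]
      exact_mod_cast this
    have hC : dualityConst m s * (eLpNorm w 1 volume + eLpNorm w 2 volume) ≠ ⊤ :=
      ENNReal.mul_ne_top (dualityConst_ne_top hs hm)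
        (ENNReal.add_ne_top.2 ⟨(memLp_one_iff_integrable.2 w1).2.ne, w2.2.ne⟩)
    have hsum := (ENNReal.Tendsto.const_mul h (Or.inr hC)).add (H.tendsto_fun K hK)
    rw [mul_zero, add_zero] at hsum
    refine tendsto_of_tendsto_of_tendsto_of_le_of_le tendsto_const_nhds hsum (fun _ => zero_le)
        fun k => ?_
    have hd := (hχ k).sub (H.test k)
    have h1 := hd.lintegral_mul_le hs hm0 w1 w2
    rw [fracLaplacian_sub (hχ k) (H.test k) hs] at h1
    have e : ∫⁻ x, ‖(χ k - φ k) x‖ₑ * ‖w x‖ₑ = ∫⁻ x in K, ‖(χ k - φ k) x‖ₑ := by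
      rw [← lintegral_indicator hKm]
      congr 1
      ext x
      by_cases hx : x ∈ K <;> simp [hw, hx]
    rw [e] at h1
    calc ∫⁻ x in K, ‖χ k x - u x‖ₑ
        ≤ ∫⁻ x in K, (‖(χ k - φ k) x‖ₑ + ‖φ k x - u x‖ₑ) := by
          refine lintegral_mono fun x => ?_
          rw [← sub_add_sub_cancel (χ k x) (φ k x) (u x)]
          exact enorm_add_le _ _
      _ = (∫⁻ x in K, ‖(χ k - φ k) x‖ₑ) + ∫⁻ x in K, ‖φ k x - u x‖ₑ :=
          lintegral_add_left' hd.continuous.enorm.measurable.aemeasurable _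
      _ ≤ _ := by gcongr
  tendsto_energy := by
    have hsum := h.add H.tendsto_energy
    rw [add_zero] at hsum
    refine tendsto_of_tendsto_of_tendsto_of_le_of_le tendsto_const_nhds hsum (fun _ => zero_le)
        fun k => ?_
    have h1 := (hχ k).memLp_fracLaplacian hs
    have h2 := (H.test k).memLp_fracLaplacian hs
    rw [← sub_add_sub_cancel (fracLaplacian (s / 2) (χ k)) (fracLaplacian (s / 2) (φ k)) g]
    exact eLpNorm_add_le (h1.sub h2).1 (h2.sub H.memLp).1 (by norm_num)

/-- The Poisson extension of `u ∈ 𝓓^s` belongs to `𝓓^{1,a}`, has trace `u`, and satisfies the weak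
equation and the energy identity. -/
theorem TendstoDs.exists_extension (hn : 2 ≤ n) (hs : s ∈ Set.Ioo (0 : ℝ) 1)
    (han : a + n = 2 - 2 * s) (hm : 2 * s < m) {φ : ℕ → Euc m → ℝ} {u g : Euc m → ℝ}
    (H : TendstoDs s φ u g) :
    ∃ (G : Euc m × Euc n → WithLp 2 (Euc m × Euc n)) (ψ : ℕ → Euc m × Euc n → ℝ),
      TendstoD1a a ψ (poissonExtension n s u) G ∧ TendstoDs s (fun k x => ψ k (x, 0)) u g ∧
      ∫ z, ‖G z‖ ^ 2 ∂(weightedVolume m n a) = energyConst n s * ∫ x, ‖g x‖ ^ 2 ∧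
      ∀ η : Euc m × Euc n → ℝ, IsTest η →
        ∫ z, inner ℝ (G z) (grad η z) ∂(weightedVolume m n a) =
          energyConst n s * ∫ x, g x * fracLaplacian (s / 2) (fun t => η (t, 0)) x := by
  have hc := energyConst_pos hn hs
  have hn2 : (2 : ℝ) ≤ n := by exact_mod_cast hn
  have ha : -(n : ℝ) < a := by linarith [hs.2]
  have ha0 : a ≤ 0 := by linarith [hs.1]
  have hda : 2 < (m : ℝ) + n + a := by linarith
  have hE := fun k => memLp_extField hn hs han (H.test k)
  have hg := fun k => (H.test k).memLp_fracLaplacian hs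
  have he := ENNReal.Tendsto.const_mul H.tendsto_energy
    (Or.inr (ENNReal.ofReal_ne_top (r := √(energyConst n s))))
  rw [mul_zero] at he
  obtain ⟨G, hG, hGt⟩ := exists_tendsto_eLpNorm_two hE he fun j k => by
    rw [eLpNorm_extField_sub hn hs han (H.test j) (H.test k), ← mul_add]
    gcongr
    rw [← sub_sub_sub_cancel_right _ _ g]
    exact eLpNorm_sub_le ((hg j).sub H.memLp).1 ((hg k).sub H.memLp).1 (by norm_num)
  choose Ψ hΨ using fun k => (H.test k).exists_tendstoD1a (n := n) hn hs han
  -- the diagonal test functions have the distance of their gradients to `extField n s (φ k)` under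
  -- control, as the trace estimate requires
  obtain ⟨l, hl, hl'⟩ := exists_diagonal hn ha ha0 hda hΨ (U := poissonExtension n s u) (G := G) (by
    filter_upwards [ae_snd_ne_zero (m := m) hn] with z hz
    exact H.tendsto_poissonExtension hs hm hz) hG hGt
  refine ⟨G, fun k => Ψ k (l k), hl, ?_, ?_, ?_⟩
  · refine H.of_tendsto_sub hs hm (fun k => (hl.test k).slice_left 0) ?_
    have h0 := ENNReal.Tendsto.const_mul hl'
      (Or.inr (ENNReal.ofReal_ne_top (r := (√(energyConst n s))⁻¹)))
    rw [mul_zero] at h0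
    exact tendsto_of_tendsto_of_tendsto_of_le_of_le tendsto_const_nhds h0
        (fun _ => zero_le) fun k =>
      le_mul_of_mul_sq_le hc (eLpNorm_trace_le hn hs han (H.test k) (hl.test k))
  · have h1 : Tendsto (fun k => ∫ z, ‖extField n s (φ k) z‖ ^ 2 ∂(weightedVolume m n a)) atTop
        (𝓝 (∫ z, ‖G z‖ ^ 2 ∂(weightedVolume m n a))) := by
      rw [integral_norm_sq_eq hG]
      refine Tendsto.congr (fun k => (integral_norm_sq_eq (hE k)).symm) ?_
      exact ((ENNReal.tendsto_toReal hG.2.ne).comp (tendsto_eLpNorm_of_sub hE hG hGt)).pow 2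
    have h2 : Tendsto (fun k => ∫ x, ‖fracLaplacian (s / 2) (φ k) x‖ ^ 2) atTop
        (𝓝 (∫ x, ‖g x‖ ^ 2)) := by
      rw [integral_norm_sq_eq H.memLp]
      refine Tendsto.congr (fun k => (integral_norm_sq_eq (hg k)).symm) ?_
      exact ((ENNReal.tendsto_toReal H.memLp.2.ne).comp
        (tendsto_eLpNorm_of_sub hg H.memLp H.tendsto_energy)).pow 2
    refine tendsto_nhds_unique h1 ((h2.const_mul (energyConst n s)).congr fun k => ?_)
    rw [integral_extField_sq hn hs han (H.test k)]
  · intro η hη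
    have h1 := tendsto_integral_inner (memLp_grad hn ha hη) hE hG hGt
    have h2 := tendsto_integral_inner ((hη.slice_left 0).memLp_fracLaplacian hs) hg H.memLp
      H.tendsto_energy
    have e : ∀ M : Euc m × Euc n → WithLp 2 (Euc m × Euc n),
        ∫ z, inner ℝ (grad η z) (M z) ∂(weightedVolume m n a) =
        ∫ z, inner ℝ (M z) (grad η z) ∂(weightedVolume m n a) := fun M =>
      integral_congr_ae (ae_of_all _ fun z => real_inner_comm _ _)
    simp only [e] at h1
    refine tendsto_nhds_unique h1 ((h2.const_mul (energyConst n s)).congr fun k => ?_)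
    rw [integral_inner_extField hn hs han (H.test k) hη]
    rfl

end Existence

/-! ### Minimality -/

section Minimality

variable {m n : ℕ} {a s : ℝ}

theorem eLpNorm_two_eq_zero_of_integral_le {α E : Type*} [MeasurableSpace α] {μ : Measure α}
    [NormedAddCommGroup E] {f : α → E} (hf : MemLp f 2 μ) (h : ∫ x, ‖f x‖ ^ 2 ∂μ ≤ 0) :
    eLpNorm f 2 μ = 0 := by
  have h1 := ofReal_integral_norm_sq hf
  rw [ENNReal.ofReal_of_nonpos h] at h1
  exact (pow_eq_zero_iff two_ne_zero).1 h1.symm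

/-- The half Laplacian of an element of `𝓓^s` is well defined: if the functions tend to `0`, so do
their Poisson extensions, hence the gradients of these, whose norm is that of the half
Laplacian. -/
theorem HasHalfFracLaplacian.ae_eq (hs : s ∈ Set.Ioo (0 : ℝ) 1) (hm : 2 * s < m) {u g h : Euc m → ℝ}
    (hg : HasHalfFracLaplacian s u g) (hh : HasHalfFracLaplacian s u h) : g =ᵐ[volume] h := by
  obtain ⟨φ, hφ⟩ := hg
  obtain ⟨ψ, hψ⟩ := hh
  have H := hφ.sub hψ hs
  rw [sub_self] at H
  -- any extension dimension will do
  obtain ⟨G, χ, hχ, -, hE, -⟩ := H.exists_extension (n := 2) (a := -2 * s) le_rfl hs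
    (by push_cast; ring) hm
  have e : poissonExtension 2 s (0 : Euc m → ℝ) = 0 := by
    ext z
    simp [poissonExtension]
  rw [e] at hχ
  have hG : G =ᵐ[weightedVolume m 2 (-2 * s)] 0 :=
      weightedVolume_ac.ae_eq (hχ.ae_eq_zero le_rfl (by push_cast; linarith [hs.2])
    (by linarith [hs.1]))
  have h0 : ∫ z, ‖G z‖ ^ 2 ∂(weightedVolume m 2 (-2 * s)) = 0 := by
    refine integral_eq_zero_of_ae ?_
    filter_upwards [hG] with z hz
    simp [hz]
  rw [h0] at hE
  have h1 : ∫ x, ‖(g - h) x‖ ^ 2 = 0 :=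
    (mul_eq_zero.1 hE.symm).resolve_left (energyConst_pos le_rfl hs).ne'
  have h2 := eLpNorm_two_eq_zero_of_integral_le H.memLp h1.le
  rw [eLpNorm_eq_zero_iff H.memLp.1 two_ne_zero] at h2
  exact (sub_ae_eq_zero _ _).1 h2

theorem HasEnergyGradient.memLp {U : Euc m × Euc n → ℝ}
    {G : Euc m × Euc n → WithLp 2 (Euc m × Euc n)} (h : HasEnergyGradient a U G) :
    MemLp G 2 (weightedVolume m n a) := h.choose_spec.memLp

theorem TendstoD1a.congr {φ : ℕ → Euc m × Euc n → ℝ} {U V : Euc m × Euc n → ℝ}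
    {G : Euc m × Euc n → WithLp 2 (Euc m × Euc n)} (h : TendstoD1a a φ U G) (hUV : V =ᵐ[volume] U) :
    TendstoD1a a φ V G where
  test := h.test
  locInt := h.locInt.congr hUV.symm
  tendsto_fun K hK := by
    refine (h.tendsto_fun K hK).congr fun k => lintegral_congr_ae (ae_restrict_of_ae ?_)
    filter_upwards [hUV] with z hz
    rw [hz]
  memLp := h.memLp
  tendsto_energy := h.tendsto_energy

theorem HasEnergyGradient.congr {U V : Euc m × Euc n → ℝ}
    {G : Euc m × Euc n → WithLp 2 (Euc m × Euc n)} (h : HasEnergyGradient a U G)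
    (hUV : V =ᵐ[volume] U) : HasEnergyGradient a V G := by
  obtain ⟨φ, hφ⟩ := h
  exact ⟨φ, hφ.congr hUV⟩

theorem IsTrace.congr {U V : Euc m × Euc n → ℝ} {u : Euc m → ℝ} (h : IsTrace a s U u)
    (hUV : V =ᵐ[volume] U) : IsTrace a s V u := by
  obtain ⟨φ, G, g, h1, h2⟩ := h
  exact ⟨φ, G, g, h1.congr hUV, h2⟩

/-- The gradient `G` of the Poisson extension solves the weak equation, and every `V` with the same
trace satisfies Pythagoras' identity: the energy of the difference is the difference of the
energies. -/
theorem exists_gradient_poissonExtension (hn : 2 ≤ n) (hs : s ∈ Set.Ioo (0 : ℝ) 1)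
    (han : a + n = 2 - 2 * s) (hm : 2 * s < m) {u : Euc m → ℝ} (hu : MemDs s u) :
    ∃ G : Euc m × Euc n → WithLp 2 (Euc m × Euc n),
      HasEnergyGradient a (poissonExtension n s u) G ∧ IsTrace a s (poissonExtension n s u) u ∧
      (∀ g, HasHalfFracLaplacian s u g → ∀ η : Euc m × Euc n → ℝ, IsTest η →
        ∫ z, inner ℝ (G z) (grad η z) ∂(weightedVolume m n a) =
          energyConst n s * ∫ x, g x * fracLaplacian (s / 2) (fun t => η (t, 0)) x) ∧
      ∀ (V : Euc m × Euc n → ℝ) (H : Euc m × Euc n → WithLp 2 (Euc m × Euc n)),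
        HasEnergyGradient a V H → IsTrace a s V u →
        ∫ z, ‖(H - G) z‖ ^ 2 ∂(weightedVolume m n a) =
          ∫ z, ‖H z‖ ^ 2 ∂(weightedVolume m n a) - ∫ z, ‖G z‖ ^ 2 ∂(weightedVolume m n a) := by
  obtain ⟨g, φ, hφ⟩ := hu
  obtain ⟨G, ψ, hψ, htr, hE, hweak⟩ := hφ.exists_extension (n := n) hn hs han hm
  have hn2 : (2 : ℝ) ≤ n := by exact_mod_cast hn
  have ha : -(n : ℝ) < a := by linarith [hs.2]
  have ha0 : a ≤ 0 := by linarith [hs.1]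
  refine ⟨G, ⟨ψ, hψ⟩, ⟨ψ, G, g, hψ, htr⟩, fun g' hg' η hη => ?_, fun V H hVH hV => ?_⟩
  · rw [hweak η hη]
    congr 1
    refine integral_congr_ae ?_
    filter_upwards [HasHalfFracLaplacian.ae_eq hs hm ⟨φ, hφ⟩ hg'] with x hx
    rw [hx]
  · obtain ⟨χ, H', h, hχ, hχt⟩ := hV
    have hH : H =ᵐ[weightedVolume m n a] H' := hVH.ae_eq hn ha ha0 ⟨χ, hχ⟩
    have hgh : g =ᵐ[volume] h := HasHalfFracLaplacian.ae_eq hs hm ⟨φ, hφ⟩ ⟨_, hχt⟩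
    have t1 := tendsto_integral_inner hψ.memLp (fun k => memLp_grad hn ha (hχ.test k)) hχ.memLp
      hχ.tendsto_energy
    have t2 := tendsto_integral_inner hφ.memLp (fun k => (hχt.test k).memLp_fracLaplacian hs)
      hχt.memLp hχt.tendsto_energy
    have e : ∀ w : Euc m → ℝ, ∫ x, inner ℝ (g x) (w x) = ∫ x, g x * w x := fun w =>
      integral_congr_ae (ae_of_all _ fun x => mul_comm _ _)
    -- test the weak equation with the approximants of `V`, whose traces converge to `u`
    have key : ∫ z, inner ℝ (G z) (H z) ∂(weightedVolume m n a) =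
        ∫ z, ‖G z‖ ^ 2 ∂(weightedVolume m n a) := by
      calc ∫ z, inner ℝ (G z) (H z) ∂(weightedVolume m n a)
          = ∫ z, inner ℝ (G z) (H' z) ∂(weightedVolume m n a) := by
            refine integral_congr_ae ?_
            filter_upwards [hH] with z hz
            rw [hz]
        _ = energyConst n s * ∫ x, inner ℝ (g x) (h x) := by
            refine tendsto_nhds_unique t1 ((t2.const_mul (energyConst n s)).congr fun k => ?_)
            rw [hweak _ (hχ.test k), e]
        _ = energyConst n s * ∫ x, ‖g x‖ ^ 2 := by
            congr 1
            refine integral_congr_ae ?_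
            filter_upwards [hgh] with x hx
            rw [← hx, real_inner_self_eq_norm_sq]
        _ = _ := hE.symm
    have hsq := integral_norm_sub_sq hVH.memLp hψ.memLp
    have hcomm : ∫ z, inner ℝ (H z) (G z) ∂(weightedVolume m n a) =
        ∫ z, inner ℝ (G z) (H z) ∂(weightedVolume m n a) :=
      integral_congr_ae (ae_of_all _ fun z => real_inner_comm _ _)
    rw [hsq, hcomm, key]
    ring

/-- By Pythagoras' identity a minimizer has the same gradient as the Poisson extension, and an
element of `𝓓^{1,a}` is determined by its gradient. -/
theorem isMinimalExtension_iff (hn : 2 ≤ n) (hs : s ∈ Set.Ioo (0 : ℝ) 1)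
    (han : a + n = 2 - 2 * s) (hm : 2 * s < m) {u : Euc m → ℝ} (hu : MemDs s u)
    (U : Euc m × Euc n → ℝ) :
    IsMinimalExtension a s u U ↔ U =ᵐ[volume] poissonExtension n s u := by
  have hn2 : (2 : ℝ) ≤ n := by exact_mod_cast hn
  obtain ⟨G, hG, htr, -, hmin⟩ := exists_gradient_poissonExtension hn hs han hm hu
  constructor
  · rintro ⟨H, hH, hU, hle⟩
    have h := hmin U H hH hU
    -- the Poisson extension competes with `U`, so the energy of the difference is at most zero
    have h2 := eLpNorm_two_eq_zero_of_integral_le (hH.memLp.sub hG.memLp)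
      (by linarith [hle _ G hG htr])
    have ha : -(n : ℝ) < a := by linarith [hs.2]
    obtain ⟨φ, hφ⟩ := hH
    obtain ⟨ψ, hψ⟩ := hG
    exact (sub_ae_eq_zero _ _).1 (HasEnergyGradient.ae_eq_zero_of_eLpNorm_eq_zero hn ha
      (by linarith [hs.1]) (by linarith) ⟨_, hφ.sub hn ha hψ⟩ h2)
  · intro hU
    refine ⟨G, hG.congr hU, htr.congr hU, fun V H hH hV => ?_⟩
    have h := hmin V H hH hV
    have : 0 ≤ ∫ z, ‖(H - G) z‖ ^ 2 ∂(weightedVolume m n a) :=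
        integral_nonneg fun z => by positivity
    linarith

theorem energyConst_eq (h : s = (2 - a - n) / 2) : energyConst n s =
    sphereArea n * conormalConst a n := by
  subst h
  rw [energyConst, dtnConst, conormalConst, show 1 - 2 * ((2 - a - n) / 2) = a + n - 1 by ring,
    show 1 - (2 - a - (n : ℝ)) / 2 = (a + n) / 2 by ring]

end Minimality

end ThinExtension

open ThinExtension in
theorem proposition10p3 (d n : ℕ) (hn : 2 ≤ n) (hnd : n < d) (a s : ℝ)
    (hda : 2 < (d : ℝ) + a) (han : a + n ∈ Set.Ioo (0 : ℝ) 2) (hs : s = (2 - a - n) / 2)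
    (u : Euc (d - n) → ℝ) (hu : MemDs s u) :
    -- the convolution `u ∗ P` converges absolutely off the thin set
    (∀ (x : Euc (d - n)) (y : Euc n), y ≠ 0 →
      Integrable (fun ξ => u ξ * poissonKernel s (x - ξ) y) volume) ∧
    -- `u ∗ P` is the minimal-energy extension of `u`, and the only one
    (∀ U : Euc (d - n) × Euc n → ℝ,
      IsMinimalExtension a s u U ↔ U =ᵐ[volume] poissonExtension n s u) ∧
    -- the weak formulation of the equation and of the conormal condition, with `G = ∇(u ∗ P)` and
    -- `g = (-Δ)^{s/2} u`; the last integral is the dual pairing of `(-Δ)^s u` with `φ(·, 0)`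
    (∃ G : Euc (d - n) × Euc n → WithLp 2 (Euc (d - n) × Euc n),
      HasEnergyGradient a (poissonExtension n s u) G ∧
      ∀ g : Euc (d - n) → ℝ, HasHalfFracLaplacian s u g →
      ∀ φ : Euc (d - n) × Euc n → ℝ, IsTest φ →
        ∫ z, inner ℝ (G z) (grad φ z) ∂(weightedVolume (d - n) n a) =
          sphereArea n * conormalConst a n *
            ∫ x, g x * fracLaplacian (s / 2) (fun t => φ (t, 0)) x) := by
  have hs01 : s ∈ Set.Ioo (0 : ℝ) 1 := by
    constructor <;> linarith [han.1, han.2]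
  have han' : a + n = 2 - 2 * s := by linarith
  have hm : 2 * s < (d - n : ℕ) := by
    rw [Nat.cast_sub hnd.le]
    linarith
  refine ⟨fun x y hy => ?_, isMinimalExtension_iff hn hs01 han' hm hu, ?_⟩
  · obtain ⟨g, φ, hφ⟩ := hu
    exact hφ.integrable_mul_poissonKernel hs01 hm x hy
  · obtain ⟨G, hG, -, hweak, -⟩ := exists_gradient_poissonExtension hn hs01 han' hm hu
    refine ⟨G, hG, fun g hg φ hφ => ?_⟩
    rw [hweak g hg φ hφ, energyConst_eq hs]
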